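/- Write $\mathbb{R}^2_+=\{x=(x_1,x_2): x_2>0\}$, $y^*=(y_1,-y_2)$, $E(x)=-\frac1{2\pi}\log|x|$, $D(x,y)=E(x-y)-E(x-y^*)$, $\Gamma(x,t)=\frac{1}{4\pi t}e^{-|x|^2/4t}$. For a function $\omega_0$ on $\mathbb{R}^2_+$ let $K\omega_0(x)=\int_{\mathbb{R}^2_+}\nabla_x^\perp D(x,y)\,\omega_0(y)\,dy$, $\nabla^\perp=(\partial_2,-\partial_1)$, be the Biot–Savart velocity. Let $H$ be the Hilbert transform in the first variable, $H\varphi(x_1)=\lim_{s\downarrow0}\frac1\pi\int_{\mathbb{R}}\frac{x_1-y_1}{(x_1-y_1)^2+s^2}\varphi(y_1)\,dy_1$, and let $A$ be the generator on $L^q(\mathbb{R})$ of the Poisson semigroup $e^{sA}g(x_1)=\frac1\pi\int_{\mathbb{R}}\frac{s}{(x_1-y_1)^2+s^2}g(y_1)\,dy_1$ (so $A=-H\partial_1$). For $t>0$ put $$T_0(t)\omega_0(x)=\int_{\mathbb{R}^2_+}W_0(x,y,t)\,\omega_0(y)\,dy,\qquad W_0(x,y,t)=\Gamma(x-y,t)-\Gamma(x-y^*,t)+2\big[(H\partial_1-\partial_2)(\partial_2E*\Gamma(\cdot,t))\big](x-y^*),$$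 where $*$ is the convolution in $\mathbb{R}^2$. **Theorem A.1.** Let $q\in(1,2)$ and let $\omega_0\in L^q(\mathbb{R}^2_+)$ be such that $u_0=K\omega_0$ has zero tangential trace, i.e. $u_0^1(x_1,0)=0$ for almost every $x_1\in\mathbb{R}$. Then, for every $t>0$, the limit defining the Hilbert transform in $W_0$ exists at every point, the integral defining $T_0(t)\omega_0(x)$ converges absolutely for every $x\in\overline{\mathbb{R}^2_+}$, and $T_0(t)\omega_0\in L^q(\mathbb{R}^2_+)$. The function $\omega(x,t)=T_0(t)\omega_0(x)$ is of class $C^2$ on $\overline{\mathbb{R}^2_+}\times(0,\infty)$ and satisfies $$\partial_t\omega-\Delta\omega=0\ \text{ in }\mathbb{R}^2_+\times(0,\infty),\qquad \partial_2\omega-A\omega=0\ \text{ on }\partial\mathbb{R}^2_+\times(0,\infty),$$ where the boundary condition means that for each $t>0$ the trace $\omega(\cdot,0,t)$ lies in the domain of $A$ in $L^q(\mathbb{R})$ and $A\,\omega(\cdot,0,t)=\partial_2\omega(\cdot,0,t)$. Moreover, $T_0(t)\omega_0\to\omega_0$ in $L^q(\mathbb{R}^2_+)$ as $t\downarrow0$.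 -/

import Mathlib

open MeasureTheory Filter Topology Set
open scoped ENNReal

noncomputable section

namespace HalfPlaneVorticity

/-- The open half plane `ℝ²₊`. Points of the plane are pairs `x = (x.1, x.2)`. -/
def halfPlane : Set (ℝ × ℝ) := {x | 0 < x.2}

/-- The closed half plane. -/
def closedHalfPlane : Set (ℝ × ℝ) := {x | 0 ≤ x.2}

/-- The reflected point `y* = (y₁, -y₂)`. -/
def reflect (y : ℝ × ℝ) : ℝ × ℝ := (y.1, -y.2)

/-- Partial derivative in the first space variable. -/
def partial1 (f : ℝ × ℝ → ℝ) (x : ℝ × ℝ) : ℝ := deriv (fun r : ℝ => f (r, x.2)) x.1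

/-- Partial derivative in the second space variable. -/
def partial2 (f : ℝ × ℝ → ℝ) (x : ℝ × ℝ) : ℝ := deriv (fun s : ℝ => f (x.1, s)) x.2

/-- The fundamental solution `E(x) = -(2π)⁻¹ log |x|` of `-Δ` (Euclidean length of `x`). -/
def E (x : ℝ × ℝ) : ℝ :=
  -(1 / (2 * Real.pi)) * Real.log (Real.sqrt (x.1 ^ 2 + x.2 ^ 2))

/-- The Green function `D(x, y) = E(x - y) - E(x - y*)` of the half plane. -/
def greenD (x y : ℝ × ℝ) : ℝ := E (x - y) - E (x - reflect y)

/-- The Biot-Savart operator `K ω (x) = ∫ ∇ₓ^⊥ D(x, y) ω(y) dy` with `∇^⊥ = (∂₂, -∂₁)`. -/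
def biotSavart (ω : ℝ × ℝ → ℝ) (x : ℝ × ℝ) : ℝ × ℝ :=
  (∫ y in halfPlane, partial2 (fun z => greenD z y) x * ω y,
   ∫ y in halfPlane, -(partial1 (fun z => greenD z y) x) * ω y)

/-- The Gauss kernel `Γ(x, t) = (4πt)⁻¹ exp(-|x|² / 4t)` of the plane. -/
def heatKernel (t : ℝ) (x : ℝ × ℝ) : ℝ :=
  1 / (4 * Real.pi * t) * Real.exp (-(x.1 ^ 2 + x.2 ^ 2) / (4 * t))

/-- The Poisson kernel `P_s(r) = s / (π (r² + s²))`. -/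
def linePoissonKernel (s r : ℝ) : ℝ := s / (Real.pi * (r ^ 2 + s ^ 2))

/-- The conjugate Poisson kernel `Q_s(r) = r / (π (r² + s²))`. -/
def lineConjPoissonKernel (s r : ℝ) : ℝ := r / (Real.pi * (r ^ 2 + s ^ 2))

/-- The Poisson semigroup `e^{sA} g = P_s * g` on the line. -/
def poissonSemigroup (s : ℝ) (g : ℝ → ℝ) (r : ℝ) : ℝ :=
  ∫ y : ℝ, linePoissonKernel s (r - y) * g y

/-- `g` belongs to the domain of the generator `A` of the Poisson semigroup on `L^q(ℝ)`, and
`A g = h`: the difference quotients `(e^{sA} g - g) / s` converge to `h` in `L^q(ℝ)`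
as `s ↓ 0`. -/
def IsPoissonGenerator (q : ℝ≥0∞) (g h : ℝ → ℝ) : Prop :=
  MemLp g q volume ∧ MemLp h q volume ∧
    Tendsto (fun s : ℝ =>
        eLpNorm (fun r : ℝ => s⁻¹ * (poissonSemigroup s g r - g r) - h r) q volume)
      (𝓝[>] 0) (𝓝 0)

/-- The Hilbert transform on the line, `Hφ(r) = lim_{s ↓ 0} (Q_s * φ)(r)`. -/
def hilbert (φ : ℝ → ℝ) (r : ℝ) : ℝ :=
  limUnder (𝓝[>] (0 : ℝ)) (fun s : ℝ => ∫ y : ℝ, lineConjPoissonKernel s (r - y) * φ y)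

/-- The integrals and the limit that define `Hφ(r)` exist, and `Hφ(r) = v`. -/
def HasHilbertAt (φ : ℝ → ℝ) (r v : ℝ) : Prop :=
  (∀ s : ℝ, 0 < s → Integrable (fun y : ℝ => lineConjPoissonKernel s (r - y) * φ y)) ∧
    Tendsto (fun s : ℝ => ∫ y : ℝ, lineConjPoissonKernel s (r - y) * φ y) (𝓝[>] 0) (𝓝 v)

/-- The convolution `(∂₂E * Γ(·, t))(z)` over the whole plane. -/
def gradConv (t : ℝ) (z : ℝ × ℝ) : ℝ :=
  ∫ w : ℝ × ℝ, partial2 E w * heatKernel t (z - w)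

/-- The function `(H∂₁ - ∂₂)(∂₂E * Γ(·, t))`, where `H` acts in the first variable. -/
def nonlocalKernel (t : ℝ) (z : ℝ × ℝ) : ℝ :=
  hilbert (fun r : ℝ => partial1 (gradConv t) (r, z.2)) z.1 - partial2 (gradConv t) z

/-- The kernel
`W₀(x, y, t) = Γ(x - y, t) - Γ(x - y*, t) + 2 ((H∂₁ - ∂₂) ∂₂E * Γ)(x - y*, t)`. -/
def kernelW0 (t : ℝ) (x y : ℝ × ℝ) : ℝ :=
  heatKernel t (x - y) - heatKernel t (x - reflect y) + 2 * nonlocalKernel t (x - reflect y)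

/-- The operator `T₀(t) ω (x) = ∫ W₀(x, y, t) ω(y) dy`, the integral being over the half plane.
The formula makes sense for `x` on the boundary too. -/
def T0 (ω : ℝ × ℝ → ℝ) (t : ℝ) (x : ℝ × ℝ) : ℝ :=
  ∫ y in halfPlane, kernelW0 t x y * ω y

/-- `ω` (a function of time and of the point of the closed half plane) is a classical solution,
for positive times, of the heat equation `∂ₜω = Δω` in `ℝ²₊ × (0, ∞)` with the boundary
condition `∂₂ω - Aω = 0` on `∂ℝ²₊ × (0, ∞)`, where `A` is the generator of the Poisson semigroup
on `L^q(ℝ)` in the tangential variable. -/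
structure IsNonlocalHeatSolution (q : ℝ≥0∞) (ω : ℝ → ℝ × ℝ → ℝ) : Prop where
  /-- All derivatives up to second order exist, and are continuous up to the boundary. -/
  regular : ContDiffOn ℝ 2 (fun p : ℝ × (ℝ × ℝ) => ω p.1 p.2) (Ioi (0 : ℝ) ×ˢ closedHalfPlane)
  heat : ∀ t : ℝ, 0 < t → ∀ x ∈ halfPlane,
    deriv (fun τ : ℝ => ω τ x) t
      = partial1 (partial1 (ω t)) x + partial2 (partial2 (ω t)) x
  boundary : ∀ t : ℝ, 0 < t →
    IsPoissonGenerator q (fun r : ℝ => ω t (r, 0))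
      (fun r : ℝ => derivWithin (fun s : ℝ => ω t (r, s)) (Ici 0) 0)

end HalfPlaneVorticity

end

noncomputable section

namespace HalfPlaneVorticity

/-! Write M_n(t, ζ) for the Laplace moment `lapMom n t ζ`, g_t for the Gauss kernel of the line, P_s
and Q_s for the Poisson and conjugate Poisson kernels. Along a vertical line, r ↦ M_n(t, w + ir) is
a superposition of the waves e^{-ikr} with k > 0 only. Therefore the operators of the problem act on
it explicitly: P_s shifts w by s, Q_s does the same and multiplies by i (`poisson_conv_lapMom`,
`conjPoisson_conv_lapMom`), and Gaussian convolution adds to the time (`gauss_conv_lapMom`).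
Moreover P_w * g_t = π⁻¹ Re M_0(t, w + i·), and ∂₂E is -1/2 times a Poisson kernel at signed height.
Hence ∂₂E * Γ, its derivatives and the Hilbert transform are one-dimensional integrals, and the
nonlocal term equals Γ - L with L(z) = π⁻¹ ∫₀^∞ Re M_1(t, w + i z₁) g_t(z₂ - w) dw
(`nonlocalKernel_eq`, `lapConv`). So W₀(x, y, t) = Γ(x - y) + R_t(x - y*) with R_t = Γ - 2L, and
|R_t(z)| ≤ C / (t + |z|²) with C independent of t (`abs_reflKernel_le`).

Heat equation. Convolution over the whole plane gives Γ_τ * R_t = R_{t+τ}, so T₀(t + τ)ω₀ = Γ_τ *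
T₀(t)ω₀, where T₀(t)ω₀ is given by its formula on all of ℝ² and is bounded there (`T0_add`).
Smoothness up to the boundary and the heat equation are then properties of Gaussian integrals of
bounded functions, obtained from exponential families (`ExpIntegrable.contDiffOn`, `caloric_heat`).

Boundary condition. On x₂ = 0 the two Gauss kernels coincide and W₀ = 2(Γ - L). The Poisson
extension of Γ - L to height s is known in closed form, and its s-derivative at 0 is -L', where L'
has g_t' in place of g_t (`hasDerivAt_poissonExt`). The normal derivative of W₀ at the boundary is
-2L' as well, because the derivatives of the two Gauss kernels cancel. Domination by (t + |·|²)⁻¹,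
which maps L^q of the half plane to L^q of the line, transfers this from the kernels to L^q
(`isPoissonGenerator_T0`).

Initial condition. The Gauss part is an approximate identity. As t ↓ 0, R_t tends pointwise to twice
the normal derivative of the Poisson kernel (`tendsto_reflKernel`), dominated by |x - y*|⁻², which
is bounded on L^q by Schur's test (`dominatedKernel_reflect`). The limiting operator kills ω₀: the
tangential trace of the velocity is ∫ P_{y₂}(r - y₁) ω₀(y) dy, so its vanishing makes its harmonic
extension, and the normal derivative of that extension, vanish (`integral_re_inv_sq_eq_zero`). Only
here does the trace condition enter. The condition q < 2 puts (1 + |z|²)^(-1/2) into the dual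
Lebesgue space, which gives the absolute convergence. -/

/-! ### Laplace moments: differentiation and quadratic decay -/

/-- The Laplace moments `∫₀^∞ kⁿ exp (-ζ k - t k²) dk`. -/
def lapMom (n : ℕ) (t : ℝ) (ζ : ℂ) : ℂ :=
  ∫ k in Ioi (0 : ℝ), (k : ℂ) ^ n * Complex.exp (-ζ * k - t * k ^ 2)

/-- The Gauss kernel of the line. -/
def gauss (t x : ℝ) : ℝ := (√(4 * Real.pi * t))⁻¹ * Real.exp (-x ^ 2 / (4 * t))

lemma integrable_exp_quadratic {t : ℝ} (ht : 0 < t) (c : ℝ) :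
    Integrable (fun x : ℝ => Real.exp (c * x - t * x ^ 2)) := by
  have h := (integrable_cexp_quadratic' (b := -t) (by simpa using ht) c 0).norm
  refine h.congr (Eventually.of_forall fun x => ?_)
  simp only [Complex.norm_exp]
  congr 1
  norm_cast
  ring

lemma norm_lapMom_integrand (n : ℕ) (t : ℝ) (ζ : ℂ) {k : ℝ} (hk : 0 < k) :
    ‖(k : ℂ) ^ n * Complex.exp (-ζ * k - t * k ^ 2)‖
      = k ^ n * Real.exp (-ζ.re * k - t * k ^ 2) := by
  rw [norm_mul, norm_pow, Complex.norm_exp, Complex.norm_real, Real.norm_of_nonneg hk.le]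
  congr 2
  simp [← Complex.ofReal_pow]

lemma integrableOn_pow_mul_exp (n : ℕ) {t : ℝ} (ht : 0 < t) (c : ℝ) :
    IntegrableOn (fun k : ℝ => k ^ n * Real.exp (c * k - t * k ^ 2)) (Ioi 0) := by
  -- The power is traded for one unit of exponential rate through k^n ≤ n! e^k, hence `c + 1`.
  refine Integrable.mono' (((integrable_exp_quadratic ht (c + 1)).const_mul
    (n.factorial : ℝ)).integrableOn) (by fun_prop) ?_
  filter_upwards [ae_restrict_mem measurableSet_Ioi] with k hk
  have hk : (0 : ℝ) < k := hk
  rw [Real.norm_of_nonneg (by positivity)]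
  have h1 : k ^ n ≤ n.factorial * Real.exp k := by
    have := Real.pow_div_factorial_le_exp k hk.le n
    rw [div_le_iff₀ (by positivity)] at this
    linarith
  calc k ^ n * Real.exp (c * k - t * k ^ 2)
      ≤ (n.factorial * Real.exp k) * Real.exp (c * k - t * k ^ 2) := by gcongr
    _ = n.factorial * Real.exp ((c + 1) * k - t * k ^ 2) := by
      rw [mul_assoc, ← Real.exp_add]; ring_nf

lemma integrableOn_lapMom (n : ℕ) {t : ℝ} (ht : 0 < t) (ζ : ℂ) :
    IntegrableOn (fun k : ℝ => (k : ℂ) ^ n * Complex.exp (-ζ * k - t * k ^ 2)) (Ioi 0) := by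
  refine Integrable.mono' (integrableOn_pow_mul_exp n ht (-ζ.re))
    (by fun_prop) ?_
  filter_upwards [ae_restrict_mem measurableSet_Ioi] with k hk
  rw [norm_lapMom_integrand n t ζ hk]

lemma hasDerivAt_lapMom (n : ℕ) {t : ℝ} (ht : 0 < t) (ζ : ℂ) :
    HasDerivAt (lapMom n t) (-lapMom (n + 1) t ζ) ζ := by
  have key := hasDerivAt_integral_of_dominated_loc_of_deriv_le
    (μ := volume.restrict (Ioi (0 : ℝ))) (s := Metric.ball ζ 1) (x₀ := ζ)
    (F := fun ζ (k : ℝ) => (k : ℂ) ^ n * Complex.exp (-ζ * k - t * k ^ 2))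
    (F' := fun ζ (k : ℝ) => -((k : ℂ) ^ (n + 1) * Complex.exp (-ζ * k - t * k ^ 2)))
    (bound := fun k => k ^ (n + 1) * Real.exp ((-ζ.re + 1) * k - t * k ^ 2))
    (Metric.ball_mem_nhds ζ one_pos)
    (Eventually.of_forall fun z => (by fun_prop))
    (integrableOn_lapMom n ht ζ)
    (by fun_prop)
    ?_ (integrableOn_pow_mul_exp (n + 1) ht _) ?_
  · have h2 := key.2
    rw [integral_neg] at h2
    exact h2
  · filter_upwards [ae_restrict_mem measurableSet_Ioi] with k hk z hz
    have hk' : (0 : ℝ) < k := hk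
    rw [norm_neg, norm_lapMom_integrand _ t z hk]
    gcongr
    have h1 := Complex.abs_re_le_norm (z - ζ)
    rw [Metric.mem_ball, dist_eq_norm] at hz
    have h2 := abs_le.1 (h1.trans hz.le)
    simp only [Complex.sub_re] at h2
    linarith [h2.1]
  · refine Eventually.of_forall fun k z _ => ?_
    have h1 : HasDerivAt (fun z : ℂ => -z * k - t * k ^ 2) (-1 * k) z :=
      ((hasDerivAt_id z).neg.mul_const _).sub_const _
    refine (h1.cexp.const_mul ((k : ℂ) ^ n)).congr_deriv ?_
    ring

lemma continuous_lapMom (n : ℕ) {t : ℝ} (ht : 0 < t) : Continuous (lapMom n t) :=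
  continuous_iff_continuousAt.2 fun ζ => (hasDerivAt_lapMom n ht ζ).continuousAt

/-- A bound for the Laplace moments on the half plane `c ≤ Re ζ`. -/
def lapBound (n : ℕ) (t c : ℝ) : ℝ := ∫ k in Ioi (0 : ℝ), k ^ n * Real.exp (-c * k - t * k ^ 2)

lemma norm_lapMom_le (n : ℕ) {t : ℝ} (ht : 0 < t) {c : ℝ} {ζ : ℂ} (hζ : c ≤ ζ.re) :
    ‖lapMom n t ζ‖ ≤ lapBound n t c := by
  refine norm_integral_le_of_norm_le (integrableOn_pow_mul_exp n ht (-c)) ?_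
  filter_upwards [ae_restrict_mem measurableSet_Ioi] with k hk
  have hk' : (0 : ℝ) < k := hk
  rw [norm_lapMom_integrand n t ζ hk]
  gcongr

lemma lapBound_one {t : ℝ} (ht : 0 < t) : lapBound 1 t 0 = 1 / (2 * t) := by
  unfold lapBound
  have hd : ∀ k ∈ Ici (0 : ℝ), HasDerivAt (fun k : ℝ => -(1 / (2 * t)) * Real.exp (-t * k ^ 2))
      (k ^ 1 * Real.exp (-0 * k - t * k ^ 2)) k := by
    intro k _
    have h := (((hasDerivAt_pow 2 k).const_mul (-t)).exp).const_mul (-(1 / (2 * t)))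
    refine h.congr_deriv ?_
    rw [neg_zero, zero_mul, zero_sub, neg_mul]
    field_simp
    simp
  have ht' : Tendsto (fun k : ℝ => -(1 / (2 * t)) * Real.exp (-t * k ^ 2)) atTop (𝓝 0) := by
    rw [show (0 : ℝ) = -(1 / (2 * t)) * 0 by simp]
    refine Tendsto.const_mul _ (Real.tendsto_exp_atBot.comp ?_)
    exact (tendsto_pow_atTop two_ne_zero).const_mul_atTop_of_neg (by linarith)
  rw [integral_Ioi_of_hasDerivAt_of_tendsto' hd (integrableOn_pow_mul_exp 1 ht (-0)) ht']
  simp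

lemma tendsto_mul_exp_neg_sq {t : ℝ} (ht : 0 < t) :
    Tendsto (fun k : ℝ => k * Real.exp (-t * k ^ 2)) atTop (𝓝 0) := by
  have h1 : Tendsto (fun k : ℝ => Real.sqrt t * k) atTop atTop :=
    tendsto_id.const_mul_atTop (Real.sqrt_pos.2 ht)
  have h2 := (Real.tendsto_pow_mul_exp_neg_atTop_nhds_zero 1).comp
    ((tendsto_pow_atTop two_ne_zero).comp h1)
  have h3 : Tendsto (fun k : ℝ => 1 / t * ((fun x : ℝ => x ^ 1 * Real.exp (-x)) ∘
      ((fun x : ℝ => x ^ 2) ∘ fun k => √t * k)) k) atTop (𝓝 (1 / t * 0)) := h2.const_mul _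
  rw [mul_zero] at h3
  refine squeeze_zero' (eventually_ge_atTop (0 : ℝ) |>.mono fun k hk => by positivity) ?_ h3
  filter_upwards [eventually_ge_atTop (1 : ℝ)] with k hk
  simp only [Function.comp_apply, pow_one, mul_pow, Real.sq_sqrt ht.le]
  rw [← mul_assoc, show 1 / t * (t * k ^ 2) = k ^ 2 by field_simp, neg_mul]
  gcongr
  nlinarith

/-- The primitive is elementary, and the two summands contribute 3 and 2. This bounds the remainder
after two integrations by parts in `sq_norm_mul_norm_lapMom_le`, independently of t. -/
lemma integral_cube_exp_neg_sq {t : ℝ} (ht : 0 < t) :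
    ∫ k in Ioi (0 : ℝ), (6 * t * k + 4 * t ^ 2 * k ^ 3) * Real.exp (-t * k ^ 2) = 5
      ∧ IntegrableOn (fun k : ℝ => (6 * t * k + 4 * t ^ 2 * k ^ 3) * Real.exp (-t * k ^ 2))
        (Ioi 0) := by
  have hd : ∀ k ∈ Ici (0 : ℝ), HasDerivAt
      (fun k : ℝ => -(5 + 2 * t * k ^ 2) * Real.exp (-t * k ^ 2))
      ((6 * t * k + 4 * t ^ 2 * k ^ 3) * Real.exp (-t * k ^ 2)) k := by
    intro k _
    have h := ((((hasDerivAt_pow 2 k).const_mul (2 * t)).const_add 5).neg).mul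
      ((hasDerivAt_pow 2 k).const_mul (-t)).exp
    refine h.congr_deriv ?_
    simp only [Pi.neg_apply]
    push_cast
    ring
  have hk2 : Tendsto (fun k : ℝ => t * k ^ 2) atTop atTop :=
    (tendsto_pow_atTop two_ne_zero).const_mul_atTop ht
  have ht' : Tendsto (fun k : ℝ => -(5 + 2 * t * k ^ 2) * Real.exp (-t * k ^ 2)) atTop (𝓝 0) := by
    have h1 := (Real.tendsto_pow_mul_exp_neg_atTop_nhds_zero 1).comp hk2
    have h0 := (Real.tendsto_pow_mul_exp_neg_atTop_nhds_zero 0).comp hk2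
    have h2 := (h0.const_mul (-5)).add (h1.const_mul (-2))
    simp only [mul_zero, add_zero] at h2
    refine h2.congr fun k => ?_
    simp only [Function.comp_apply, pow_zero, pow_one, one_mul, neg_mul]
    ring
  have hpos : ∀ k ∈ Ioi (0 : ℝ), 0 ≤ (6 * t * k + 4 * t ^ 2 * k ^ 3) * Real.exp (-t * k ^ 2) := by
    intro k hk
    have : (0 : ℝ) < k := hk
    positivity
  refine ⟨?_, integrableOn_Ioi_deriv_of_nonneg' hd hpos ht'⟩
  rw [integral_Ioi_of_hasDerivAt_of_nonneg' hd hpos ht']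
  simp

/-- Two integrations by parts give ζ² M_1 = 1 + remainder. The 1 is the boundary term at k = 0, and
the remainder is at most 5 in absolute value. -/
lemma sq_norm_mul_norm_lapMom_le {t : ℝ} (ht : 0 < t) {ζ : ℂ} (hζ : 0 ≤ ζ.re) :
    ‖ζ‖ ^ 2 * ‖lapMom 1 t ζ‖ ≤ 6 := by
  set e : ℝ → ℂ := fun k => Complex.exp (-ζ * k - t * k ^ 2) with he
  have hnorm : ∀ k : ℝ, 0 ≤ k → ‖e k‖ ≤ Real.exp (-t * k ^ 2) := by
    intro k hk
    rw [he, Complex.norm_exp]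
    gcongr
    have : 0 ≤ ζ.re * k := by positivity
    simp [← Complex.ofReal_pow]
    linarith
  have hde : ∀ k : ℝ, HasDerivAt e (e k * (-ζ - 2 * t * k)) k := by
    intro k
    have h0 : HasDerivAt (fun k : ℝ => (k : ℂ)) 1 k := Complex.ofRealCLM.hasDerivAt
    have h1 : HasDerivAt (fun k : ℝ => -ζ * (k : ℂ) - t * (k : ℂ) ^ 2)
        (-ζ * 1 - t * ((2 : ℕ) * (k : ℂ) ^ (2 - 1) * 1)) k :=
      (h0.const_mul (-ζ)).sub ((h0.pow 2).const_mul (t : ℂ))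
    refine h1.cexp.congr_deriv ?_
    simp [he]
    ring
  set rest : ℝ → ℂ := fun k => (-6 * t * k + 4 * t ^ 2 * k ^ 3) * e k with hrest
  have hrest_norm : ∀ᵐ k ∂(volume.restrict (Ioi (0 : ℝ))),
      ‖rest k‖ ≤ (6 * t * k + 4 * t ^ 2 * k ^ 3) * Real.exp (-t * k ^ 2) := by
    filter_upwards [ae_restrict_mem measurableSet_Ioi] with k hk
    have hk' : (0 : ℝ) < k := hk
    rw [hrest, norm_mul]
    have h1 : ‖(-6 * t * k + 4 * t ^ 2 * k ^ 3 : ℂ)‖ ≤ 6 * t * k + 4 * t ^ 2 * k ^ 3 := by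
      have h2 : (-6 * t * k + 4 * t ^ 2 * k ^ 3 : ℂ)
        = ((-6 * t * k + 4 * t ^ 2 * k ^ 3 : ℝ) : ℂ) := by push_cast; ring
      rw [h2, Complex.norm_real, Real.norm_eq_abs, abs_le]
      constructor
      · nlinarith [show 0 ≤ t ^ 2 * k ^ 3 by positivity, mul_pos ht hk']
      · nlinarith [mul_pos ht hk']
    exact mul_le_mul h1 (hnorm k hk'.le) (norm_nonneg _) (by positivity)
  have hri : IntegrableOn rest (Ioi 0) :=
    Integrable.mono' (integral_cube_exp_neg_sq ht).2 (by fun_prop) hrest_norm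
  have hzi := integrableOn_lapMom 1 ht ζ
  -- The bracket ζk + 1 - 2tk² is chosen so that, on differentiating, all terms linear in ζ cancel;
  -- what remains besides ζ²k is independent of ζ up to the exponential.
  have hd : ∀ k ∈ Ici (0 : ℝ), HasDerivAt
      (fun k : ℝ => (ζ * k + (1 - 2 * t * k ^ 2)) * e k)
      (rest k - ζ ^ 2 * ((k : ℂ) ^ 1 * e k)) k := by
    intro k _
    have h0 : HasDerivAt (fun k : ℝ => (k : ℂ)) 1 k := Complex.ofRealCLM.hasDerivAt
    have h1 : HasDerivAt (fun k : ℝ => ζ * (k : ℂ) + (1 - 2 * t * (k : ℂ) ^ 2))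
        (ζ * 1 + (- (2 * t * ((2 : ℕ) * (k : ℂ) ^ (2 - 1) * 1)))) k :=
      (h0.const_mul ζ).add (((h0.pow 2).const_mul (2 * t : ℂ)).const_sub 1)
    refine (h1.mul (hde k)).congr_deriv ?_
    simp [hrest]
    ring
  have hlim : Tendsto (fun k : ℝ => (ζ * k + (1 - 2 * t * k ^ 2)) * e k) atTop (𝓝 0) := by
    have hk2 : Tendsto (fun k : ℝ => t * k ^ 2) atTop atTop :=
      (tendsto_pow_atTop two_ne_zero).const_mul_atTop ht
    have h1 := (Real.tendsto_pow_mul_exp_neg_atTop_nhds_zero 1).comp hk2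
    have h0 := (Real.tendsto_pow_mul_exp_neg_atTop_nhds_zero 0).comp hk2
    have h2 := ((tendsto_mul_exp_neg_sq ht).const_mul ‖ζ‖).add (h0.add (h1.const_mul 2))
    simp only [mul_zero, add_zero] at h2
    refine squeeze_zero_norm' ?_ h2
    filter_upwards [eventually_ge_atTop (0 : ℝ)] with k hk
    simp only [Function.comp_apply, pow_zero, pow_one, one_mul]
    rw [norm_mul]
    have h3 : ‖(ζ * k + (1 - 2 * t * k ^ 2) : ℂ)‖ ≤ ‖ζ‖ * k + (1 + 2 * (t * k ^ 2)) := by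
      refine (norm_add_le _ _).trans (add_le_add ?_ ?_)
      · rw [norm_mul, Complex.norm_real, Real.norm_of_nonneg hk]
      · refine (norm_sub_le _ _).trans ?_
        have : (2 * t * k ^ 2 : ℂ) = ((2 * (t * k ^ 2) : ℝ) : ℂ) := by push_cast; ring
        rw [this, Complex.norm_real, Real.norm_of_nonneg (by positivity), norm_one]
    calc ‖(ζ * k + (1 - 2 * t * k ^ 2) : ℂ)‖ * ‖e k‖
        ≤ (‖ζ‖ * k + (1 + 2 * (t * k ^ 2))) * Real.exp (-t * k ^ 2) :=
          mul_le_mul h3 (hnorm k hk) (norm_nonneg _) (by positivity)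
      _ = _ := by rw [neg_mul]; ring
  have hint := integral_Ioi_of_hasDerivAt_of_tendsto' hd (hri.sub (hzi.const_mul _)) hlim
  rw [integral_sub hri (hzi.const_mul _), integral_const_mul] at hint
  have hmain : ζ ^ 2 * lapMom 1 t ζ = (∫ k in Ioi (0 : ℝ), rest k) + 1 := by
    have h4 : (0 : ℂ) - (ζ * (0 : ℝ) + (1 - 2 * t * (0 : ℝ) ^ 2)) * e 0 = -1 := by simp [he]
    rw [h4] at hint
    unfold lapMom
    linear_combination -hint
  rw [← norm_pow, ← norm_mul, hmain]
  refine (norm_add_le _ _).trans ?_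
  have h5 := norm_integral_le_of_norm_le (integral_cube_exp_neg_sq ht).2 hrest_norm
  rw [(integral_cube_exp_neg_sq ht).1] at h5
  rw [norm_one]
  linarith

/-- The first Laplace moment decays quadratically on the closed right half plane. -/
lemma norm_lapMom_one_le {t : ℝ} (ht : 0 < t) {ζ : ℂ} (hζ : 0 ≤ ζ.re) :
    ‖lapMom 1 t ζ‖ ≤ 7 / (t + ‖ζ‖ ^ 2) := by
  rw [le_div_iff₀ (by positivity)]
  -- The crude bound gives t ‖M_1‖ ≤ 1/2; added to ‖ζ‖² ‖M_1‖ ≤ 6 it stays below 7.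
  have h1 := norm_lapMom_le 1 ht hζ
  rw [lapBound_one ht, le_div_iff₀ (by positivity)] at h1
  have h2 := sq_norm_mul_norm_lapMom_le ht hζ
  nlinarith

/-! ### The Gauss kernel of the line and its action on the moments -/

lemma gauss_nonneg (t x : ℝ) : 0 ≤ gauss t x := by unfold gauss; positivity

lemma gauss_neg (t x : ℝ) : gauss t (-x) = gauss t x := by simp [gauss]

@[fun_prop]
lemma continuous_gauss (t : ℝ) : Continuous (gauss t) := by unfold gauss; fun_prop

lemma integrable_gauss {t : ℝ} (ht : 0 < t) : Integrable (gauss t) := by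
  have h := (integrable_exp_neg_mul_sq (b := 1 / (4 * t)) (by positivity)).const_mul
    ((√(4 * Real.pi * t))⁻¹)
  refine h.congr (Eventually.of_forall fun x => ?_)
  simp only [gauss]
  congr 2
  ring

lemma integral_gauss {t : ℝ} (ht : 0 < t) : ∫ x, gauss t x = 1 := by
  unfold gauss
  have h : ∀ x : ℝ, -x ^ 2 / (4 * t) = -(1 / (4 * t)) * x ^ 2 := fun x => by ring
  simp_rw [h]
  rw [integral_const_mul, integral_gaussian]
  have : Real.pi / (1 / (4 * t)) = 4 * Real.pi * t := by field_simp
  rw [this]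
  exact inv_mul_cancel₀ (Real.sqrt_pos.2 (by positivity)).ne'

lemma heatKernel_eq_gauss_mul {t : ℝ} (ht : 0 < t) (z : ℝ × ℝ) :
    heatKernel t z = gauss t z.1 * gauss t z.2 := by
  unfold heatKernel gauss
  have h : √(4 * Real.pi * t) * √(4 * Real.pi * t) = 4 * Real.pi * t :=
    Real.mul_self_sqrt (by positivity)
  rw [mul_mul_mul_comm, ← mul_inv, h, ← Real.exp_add, one_div]
  congr 2
  ring

/-- The characteristic function of the Gauss kernel. -/
lemma integral_cexp_mul_gauss {t : ℝ} (ht : 0 < t) (k : ℝ) :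
    ∫ y : ℝ, Complex.exp (k * y * Complex.I) * (gauss t y : ℂ) = Complex.exp (-t * k ^ 2) := by
  have hb : (0 : ℝ) < ((1 / (4 * t) : ℝ) : ℂ).re := by
    rw [Complex.ofReal_re]; positivity
  have h := fourierIntegral_gaussian hb k
  have h1 : ∀ y : ℝ, Complex.exp (k * y * Complex.I) * (gauss t y : ℂ)
      = ((√(4 * Real.pi * t))⁻¹ : ℝ) * (Complex.exp (Complex.I * k * y) *
        Complex.exp (-((1 / (4 * t) : ℝ) : ℂ) * y ^ 2)) := by
    intro y
    unfold gauss
    push_cast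
    rw [show (-(y : ℂ) ^ 2 / (4 * t)) = -(1 / (4 * t)) * y ^ 2 by ring,
      show (k : ℂ) * y * Complex.I = Complex.I * k * y by ring]
    ring
  simp_rw [h1]
  rw [integral_const_mul, h]
  have h2 : ((Real.pi : ℂ) / ((1 / (4 * t) : ℝ) : ℂ)) = ((4 * Real.pi * t : ℝ) : ℂ) := by
    push_cast
    have : (t : ℂ) ≠ 0 := by exact_mod_cast ht.ne'
    field_simp
  have h3 : ((4 * Real.pi * t : ℝ) : ℂ) ^ (1 / 2 : ℂ) = ((√(4 * Real.pi * t) : ℝ) : ℂ) := by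
    rw [Real.sqrt_eq_rpow, Complex.ofReal_cpow (by positivity)]
    norm_num
  rw [h2, h3, ← mul_assoc, ← Complex.ofReal_mul,
    inv_mul_cancel₀ (Real.sqrt_pos.2 (by positivity)).ne', Complex.ofReal_one, one_mul]
  congr 1
  have : (t : ℂ) ≠ 0 := by exact_mod_cast ht.ne'
  push_cast
  field_simp

/-- The Gauss kernel is the Fourier transform of e^{-tk²}; by evenness half of the frequency line
suffices and the exponential becomes a cosine. -/
lemma gauss_eq_re_lapMom {t : ℝ} (ht : 0 < t) (r : ℝ) :
    gauss t r = 1 / Real.pi * (lapMom 0 t (r * Complex.I)).re := by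
  set f : ℝ → ℝ := fun k => Real.exp (-t * k ^ 2) * Real.cos (k * r) with hf
  have hint : Integrable (fun k : ℝ => Complex.exp (Complex.I * r * k) *
      Complex.exp (-(t : ℂ) * k ^ 2)) := by
    have h := integrable_cexp_quadratic' (b := -t) (by simpa using ht) (Complex.I * r) 0
    refine h.congr (Eventually.of_forall fun k => ?_)
    simp only
    rw [← Complex.exp_add]
    ring_nf
  have hre : ∀ k : ℝ, (Complex.exp (Complex.I * r * k) * Complex.exp (-(t : ℂ) * k ^ 2)).re
      = f k := by
    intro k
    rw [show Complex.exp (-(t : ℂ) * k ^ 2) = ((Real.exp (-t * k ^ 2) : ℝ) : ℂ) by push_cast; rfl,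
      show Complex.I * r * k = ((k * r : ℝ) : ℂ) * Complex.I by push_cast; ring,
      Complex.re_mul_ofReal, Complex.exp_ofReal_mul_I_re, mul_comm]
  have h1 := fourierIntegral_gaussian (b := (t : ℂ)) (by simpa using ht) r
  have h2 : ∫ k, f k = √(Real.pi / t) * Real.exp (-r ^ 2 / (4 * t)) := by
    have h3 : ((∫ k : ℝ, Complex.exp (Complex.I * r * k) *
        Complex.exp (-(t : ℂ) * k ^ 2)) : ℂ).re = ∫ k, f k := by
      rw [← RCLike.re_eq_complex_re, ← integral_re hint]
      exact integral_congr_ae (Eventually.of_forall fun k => hre k)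
    rw [← h3, h1]
    have h4 : ((Real.pi : ℂ) / t) ^ (1 / 2 : ℂ) * Complex.exp (-(r : ℂ) ^ 2 / (4 * t))
        = ((√(Real.pi / t) * Real.exp (-r ^ 2 / (4 * t)) : ℝ) : ℂ) := by
      rw [Real.sqrt_eq_rpow]
      push_cast
      rw [Complex.ofReal_cpow (by positivity)]
      norm_num
    rw [h4, Complex.ofReal_re]
  have heven : ∫ k, f k = 2 * ∫ k in Ioi (0 : ℝ), f k := by
    rw [← integral_comp_abs (f := f)]
    refine integral_congr_ae (Eventually.of_forall fun k => ?_)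
    rcases abs_cases k with ⟨h, _⟩ | ⟨h, _⟩ <;> simp [hf, h]
  have hZ : (lapMom 0 t (r * Complex.I)).re = ∫ k in Ioi (0 : ℝ), f k := by
    unfold lapMom
    rw [← RCLike.re_eq_complex_re, ← integral_re (integrableOn_lapMom 0 ht _)]
    refine integral_congr_ae (Eventually.of_forall fun k => ?_)
    simp only [pow_zero, one_mul, RCLike.re_eq_complex_re]
    rw [show -((r : ℂ) * Complex.I) * k - t * k ^ 2
      = ((-(k * r) : ℝ) : ℂ) * Complex.I + ((-t * k ^ 2 : ℝ) : ℂ) by push_cast; ring,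
      Complex.exp_add, ← Complex.ofReal_exp, Complex.re_mul_ofReal, Complex.exp_ofReal_mul_I_re,
      mul_comm, Real.cos_neg]
  rw [hZ]
  have h5 : ∫ k in Ioi (0 : ℝ), f k = √(Real.pi / t) * Real.exp (-r ^ 2 / (4 * t)) / 2 := by
    linarith
  rw [h5]
  unfold gauss
  have h6 : √(4 * Real.pi * t) = 2 * (√Real.pi * √t) := by
    rw [show 4 * Real.pi * t = 2 ^ 2 * (Real.pi * t) by ring, Real.sqrt_mul (by positivity),
      Real.sqrt_sq (by norm_num), Real.sqrt_mul Real.pi_pos.le]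
  rw [h6, Real.sqrt_div Real.pi_pos.le]
  have h7 : √Real.pi * √Real.pi = Real.pi := Real.mul_self_sqrt Real.pi_pos.le
  have h8 : 0 < √Real.pi := Real.sqrt_pos.2 Real.pi_pos
  have h9 : 0 < √t := Real.sqrt_pos.2 ht
  have h10 : Real.pi ≠ 0 := Real.pi_ne_zero
  field_simp
  nlinarith

/-- Gaussian convolution in the imaginary direction acts on the Laplace moments by a shift of the
time. -/
lemma gauss_conv_lapMom (n : ℕ) {t τ : ℝ} (ht : 0 < t) (hτ : 0 < τ) (w r : ℝ) :
    ∫ y : ℝ, (gauss τ (r - y) : ℂ) * lapMom n t (w + y * Complex.I)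
      = lapMom n (t + τ) (w + r * Complex.I) := by
  unfold lapMom
  have hprod : Integrable (fun p : ℝ × ℝ => (gauss τ (r - p.1) : ℂ) *
      ((p.2 : ℂ) ^ n * Complex.exp (-(w + p.1 * Complex.I) * p.2 - t * p.2 ^ 2)))
      (volume.prod (volume.restrict (Ioi 0))) := by
    have h1 : Integrable (fun p : ℝ × ℝ => gauss τ (r - p.1) *
        (p.2 ^ n * Real.exp (-w * p.2 - t * p.2 ^ 2)))
        (volume.prod (volume.restrict (Ioi 0))) :=
      ((integrable_gauss hτ).comp_sub_left r).mul_prod (integrableOn_pow_mul_exp n ht (-w))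
    refine Integrable.mono h1 (by fun_prop) ?_
    refine Eventually.of_forall fun p => le_of_eq ?_
    rw [norm_mul, norm_mul, Complex.norm_real, norm_mul, norm_mul, norm_pow, norm_pow,
      Complex.norm_exp, Complex.norm_real, Real.norm_of_nonneg (Real.exp_pos _).le]
    congr 3
    simp [← Complex.ofReal_pow]
  simp_rw [← integral_const_mul]
  rw [integral_integral_swap hprod]
  refine setIntegral_congr_fun measurableSet_Ioi fun k _ => ?_
  have h1 : ∀ y : ℝ, (gauss τ (r - y) : ℂ) *
      ((k : ℂ) ^ n * Complex.exp (-(w + y * Complex.I) * k - t * k ^ 2))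
      = (k : ℂ) ^ n * Complex.exp (-(w + r * Complex.I) * k - t * k ^ 2) *
        (Complex.exp (k * (r - y : ℝ) * Complex.I) * (gauss τ (r - y) : ℂ)) := by
    intro y
    have h2 : Complex.exp (-(w + y * Complex.I) * k - t * k ^ 2)
        = Complex.exp (-(w + r * Complex.I) * k - t * k ^ 2) *
          Complex.exp (k * (r - y : ℝ) * Complex.I) := by
      rw [← Complex.exp_add]
      congr 1
      push_cast
      ring
    rw [h2]
    ring
  simp_rw [h1]
  -- For fixed k the integral in y is the characteristic function e^{-τk²}, which turns t into t + τ
  -- in the exponent.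
  rw [integral_const_mul, integral_sub_left_eq_self (fun y : ℝ =>
    Complex.exp (k * (y : ℝ) * Complex.I) * (gauss τ y : ℂ)) volume r,
    integral_cexp_mul_gauss hτ, mul_assoc, ← Complex.exp_add]
  congr 2
  push_cast
  ring

/-- The real part of `gauss_conv_lapMom` for the zeroth moment on the imaginary axis. -/
lemma gauss_conv_gauss {t τ : ℝ} (ht : 0 < t) (hτ : 0 < τ) (r : ℝ) :
    ∫ y : ℝ, gauss τ (r - y) * gauss t y = gauss (t + τ) r := by
  have h := gauss_conv_lapMom 0 ht hτ 0 r
  simp only [Complex.ofReal_zero, zero_add] at h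
  rw [gauss_eq_re_lapMom (by positivity), ← h, ← RCLike.re_eq_complex_re, ← integral_re,
    ← integral_const_mul]
  · refine integral_congr_ae (Eventually.of_forall fun y => ?_)
    simp only [RCLike.re_eq_complex_re]
    rw [Complex.re_ofReal_mul, gauss_eq_re_lapMom ht y]
    ring
  · refine ((integrable_gauss hτ).comp_sub_left r).ofReal.mul_bdd (c := lapBound 0 t 0) ?_ ?_
    · have := continuous_lapMom 0 ht
      fun_prop
    · exact Eventually.of_forall fun y => norm_lapMom_le 0 ht (by simp)

/-! ### Cauchy transforms and Fourier inversion along vertical lines -/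

lemma re_pos_add_mul_I {s : ℝ} (hs : 0 < s) (x : ℝ) : 0 < ((s : ℂ) + x * Complex.I).re := by
  simpa using hs

lemma add_mul_I_ne_zero {s : ℝ} (hs : 0 < s) (x : ℝ) : (s : ℂ) + x * Complex.I ≠ 0 := by
  intro h
  have := re_pos_add_mul_I hs x
  rw [h] at this
  simp at this

lemma integral_exp_neg_mul_Ioi {ζ : ℂ} (hζ : 0 < ζ.re) :
    ∫ k in Ioi (0 : ℝ), Complex.exp (-ζ * k) = ζ⁻¹ := by
  rw [integral_exp_mul_complex_Ioi (by simpa using hζ)]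
  simp [neg_div_neg_eq]

/-- The Cauchy transform of an integrable function as a Laplace transform of its Fourier
transform. -/
lemma integral_mul_cauchy {f : ℝ → ℂ} (hf : Integrable f) {s : ℝ} (hs : 0 < s) (σ r : ℝ) :
    ∫ y : ℝ, f y * ((s : ℂ) + (σ * (r - y) : ℝ) * Complex.I)⁻¹
      = ∫ k in Ioi (0 : ℝ), Complex.exp (-(s + (σ * r : ℝ) * Complex.I) * k) *
          ∫ y : ℝ, Complex.exp ((σ * k * y : ℝ) * Complex.I) * f y := by
  -- The Cauchy kernel is itself a Laplace integral in k, so Fubini produces the Fourier transform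
  -- of f. The sign σ selects which half of the frequencies is seen.
  have h1 : ∀ y : ℝ, f y * ((s : ℂ) + (σ * (r - y) : ℝ) * Complex.I)⁻¹
      = ∫ k in Ioi (0 : ℝ), f y *
          Complex.exp (-((s : ℂ) + (σ * (r - y) : ℝ) * Complex.I) * k) := by
    intro y
    rw [integral_const_mul, integral_exp_neg_mul_Ioi (re_pos_add_mul_I hs _)]
  simp_rw [h1]
  have hexp : IntegrableOn (fun k : ℝ => Real.exp (-s * k)) (Ioi 0) :=
    integrableOn_exp_mul_Ioi (by linarith) 0
  have hprod : Integrable (fun p : ℝ × ℝ => f p.1 *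
      Complex.exp (-((s : ℂ) + (σ * (r - p.1) : ℝ) * Complex.I) * p.2))
      (volume.prod (volume.restrict (Ioi 0))) := by
    refine Integrable.mono (hf.norm.mul_prod hexp)
      (hf.aestronglyMeasurable.comp_fst.mul (by fun_prop)) ?_
    refine Eventually.of_forall fun p => le_of_eq ?_
    rw [norm_mul, norm_mul, norm_norm, Complex.norm_exp,
      Real.norm_of_nonneg (Real.exp_pos _).le]
    congr 2
    simp
  rw [integral_integral_swap hprod]
  refine setIntegral_congr_fun measurableSet_Ioi fun k _ => ?_
  rw [← integral_const_mul]
  refine integral_congr_ae (Eventually.of_forall fun y => ?_)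
  simp only
  rw [← mul_assoc, ← Complex.exp_add, mul_comm]
  congr 2
  push_cast
  ring

/-- Fourier inversion with the kernel `exp (-iky)`. -/
lemma fourier_inversion {a u : ℝ → ℂ} (ha : Integrable a)
    (hu : ∀ y, u y = ∫ k : ℝ, Complex.exp (-(k * y : ℝ) * Complex.I) * a k)
    (hui : Integrable u) {k : ℝ} (hk : ContinuousAt a k) :
    ∫ y : ℝ, Complex.exp ((k * y : ℝ) * Complex.I) * u y = 2 * Real.pi * a k := by
  -- The library transform carries 2π in the exponent, so it is a dilate of u; undoing the dilation
  -- produces the factor 2π.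
  have h1 : ∀ y : ℝ, FourierTransform.fourier a y = u (2 * Real.pi * y) := by
    intro y
    rw [Real.fourier_eq', hu]
    refine integral_congr_ae (Eventually.of_forall fun k => ?_)
    simp only [smul_eq_mul, RCLike.inner_apply, conj_trivial]
    congr 2
    push_cast
    ring
  have h2 : Integrable (FourierTransform.fourier a) := by
    rw [funext h1]
    exact hui.comp_mul_left' (by positivity)
  have h3 := ha.fourierInv_fourier_eq h2 hk
  rw [Real.fourierInv_eq'] at h3
  rw [← h3]
  have h4 := Measure.integral_comp_mul_left
    (fun y : ℝ => Complex.exp ((k * y : ℝ) * Complex.I) * u y) (2 * Real.pi)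
  have h5 : ∀ y : ℝ, Complex.exp ((k * (2 * Real.pi * y) : ℝ) * Complex.I) * u (2 * Real.pi * y)
      = Complex.exp ((2 * Real.pi * inner ℝ y k : ℝ) * Complex.I) •
        FourierTransform.fourier a y := by
    intro y
    rw [h1, smul_eq_mul]
    simp only [RCLike.inner_apply, conj_trivial]
    congr 3
    push_cast
    ring
  simp_rw [h5] at h4
  rw [h4, abs_of_pos (by positivity), Complex.real_smul]
  push_cast
  rw [mul_inv_cancel_left₀]
  exact_mod_cast (by positivity : (2 * Real.pi : ℝ) ≠ 0)

lemma integrable_inv_add_sq {c : ℝ} (hc : 0 < c) : Integrable (fun y : ℝ => (c + y ^ 2)⁻¹) := by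
  have h := (integrable_inv_one_add_sq).comp_mul_left' (R := (√c)⁻¹) (by positivity)
  refine (h.const_mul c⁻¹).congr (Eventually.of_forall fun y => ?_)
  simp only
  rw [mul_pow, inv_pow, Real.sq_sqrt hc.le, ← mul_inv, mul_add, mul_inv_cancel_left₀ hc.ne',
    mul_one]

lemma norm_sq_add_mul_I (w y : ℝ) : ‖(w : ℂ) + y * Complex.I‖ ^ 2 = w ^ 2 + y ^ 2 := by
  rw [Complex.sq_norm, Complex.normSq_add_mul_I]

lemma norm_lapMom_line_le {t : ℝ} (ht : 0 < t) {w : ℝ} (hw : 0 ≤ w) (y : ℝ) :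
    ‖lapMom 1 t (w + y * Complex.I)‖ ≤ 7 / (t + (w ^ 2 + y ^ 2)) := by
  have := norm_lapMom_one_le ht (ζ := w + y * Complex.I) (by simpa using hw)
  rwa [norm_sq_add_mul_I] at this

/-- Quadratic decay makes the first moment integrable even on the imaginary axis; the zeroth moment
decays only to first order. -/
lemma integrable_lapMom_line {t : ℝ} (ht : 0 < t) {w : ℝ} (hw : 0 ≤ w) :
    Integrable (fun y : ℝ => lapMom 1 t (w + y * Complex.I)) := by
  refine Integrable.mono' ((integrable_inv_add_sq ht).const_mul 7)
    (by have := continuous_lapMom 1 ht; fun_prop) (Eventually.of_forall fun y => ?_)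
  refine (norm_lapMom_line_le ht hw y).trans ?_
  rw [div_eq_mul_inv]
  gcongr
  nlinarith

/-- The Fourier transform of the first Laplace moment along vertical lines. -/
lemma integral_cexp_mul_lapMom {t : ℝ} (ht : 0 < t) {w : ℝ} (hw : 0 ≤ w) {k : ℝ} (hk : k ≠ 0) :
    ∫ y : ℝ, Complex.exp ((k * y : ℝ) * Complex.I) * lapMom 1 t (w + y * Complex.I)
      = 2 * Real.pi * (if 0 < k then k * Complex.exp (-w * k - t * k ^ 2) else 0) := by
  set a : ℝ → ℂ := (Ioi (0 : ℝ)).indicator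
    (fun k : ℝ => (k : ℂ) ^ 1 * Complex.exp (-w * k - t * k ^ 2)) with ha
  have hai : Integrable a := (integrableOn_lapMom 1 ht w).integrable_indicator measurableSet_Ioi
  have hval : a k = (if 0 < k then k * Complex.exp (-w * k - t * k ^ 2) else 0) := by
    simp [ha, indicator]
  rw [← hval]
  -- M_1 on the line is the transform of a density carried by k > 0, so inversion returns that
  -- density, and zero at negative frequencies.
  refine fourier_inversion hai (fun y => ?_) (integrable_lapMom_line ht hw) ?_
  · have h1 : ∀ k : ℝ, Complex.exp (-(k * y : ℝ) * Complex.I) * a k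
        = (Ioi (0 : ℝ)).indicator (fun k : ℝ =>
          (k : ℂ) ^ 1 * Complex.exp (-(w + y * Complex.I) * k - t * k ^ 2)) k := by
      intro k
      by_cases h : k ∈ Ioi (0 : ℝ)
      · rw [ha, indicator_of_mem h, indicator_of_mem h, mul_left_comm, ← Complex.exp_add]
        congr 2
        push_cast
        ring
      · rw [ha, indicator_of_notMem h, indicator_of_notMem h, mul_zero]
    simp_rw [h1]
    rw [integral_indicator measurableSet_Ioi]
    rfl
  · rcases hk.lt_or_gt with h | h
    · have : a =ᶠ[𝓝 k] fun _ => 0 := by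
        filter_upwards [Iio_mem_nhds h] with x hx
        exact indicator_of_notMem (by simpa using le_of_lt hx) _
      exact continuousAt_const.congr this.symm
    · have : a =ᶠ[𝓝 k] fun k : ℝ => (k : ℂ) ^ 1 * Complex.exp (-w * k - t * k ^ 2) := by
        filter_upwards [Ioi_mem_nhds h] with x hx
        exact indicator_of_mem hx _
      refine ContinuousAt.congr ?_ this.symm
      fun_prop

/-- This sign of the Cauchy kernel tests exactly the frequencies that M_1 carries and damps them by
e^{-sk}, which amounts to a shift of ζ by s. -/
lemma integral_lapMom_mul_cauchy {t : ℝ} (ht : 0 < t) {w s : ℝ} (hw : 0 ≤ w) (hs : 0 < s)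
    (r : ℝ) :
    ∫ y : ℝ, lapMom 1 t (w + y * Complex.I) * ((s : ℂ) + (r - y : ℝ) * Complex.I)⁻¹
      = 2 * Real.pi * lapMom 1 t ((s + w : ℝ) + r * Complex.I) := by
  have h := integral_mul_cauchy (integrable_lapMom_line ht hw) hs 1 r
  simp only [one_mul] at h
  rw [h]
  unfold lapMom
  rw [← integral_const_mul]
  refine setIntegral_congr_fun measurableSet_Ioi fun k hk => ?_
  have hk' : (0 : ℝ) < k := hk
  have h2 := integral_cexp_mul_lapMom ht hw hk'.ne'
  rw [if_pos hk'] at h2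
  unfold lapMom at h2
  rw [h2, mul_left_comm, mul_left_comm (Complex.exp _), ← Complex.exp_add, pow_one]
  congr 3
  push_cast
  ring

/-- With the opposite sign only the frequencies absent from M_1 are tested. -/
lemma integral_lapMom_mul_cauchy_conj {t : ℝ} (ht : 0 < t) {w s : ℝ} (hw : 0 ≤ w) (hs : 0 < s)
    (r : ℝ) :
    ∫ y : ℝ, lapMom 1 t (w + y * Complex.I) * ((s : ℂ) + (-(r - y) : ℝ) * Complex.I)⁻¹ = 0 := by
  have h := integral_mul_cauchy (integrable_lapMom_line ht hw) hs (-1) r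
  simp only [neg_one_mul] at h
  rw [h]
  refine setIntegral_eq_zero_of_forall_eq_zero fun k hk => ?_
  have hk' : (0 : ℝ) < k := hk
  have h2 := integral_cexp_mul_lapMom ht hw (neg_ne_zero.2 hk'.ne')
  rw [if_neg (by linarith)] at h2
  rw [h2]
  simp

/-! ### Poisson and conjugate Poisson kernels -/

lemma poisson_eq_cauchy {s : ℝ} (hs : 0 < s) (x : ℝ) :
    (linePoissonKernel s x : ℂ) = (2 * (Real.pi : ℂ))⁻¹ *
      (((s : ℂ) + x * Complex.I)⁻¹ + ((s : ℂ) + (-x : ℝ) * Complex.I)⁻¹) := by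
  have h1 := add_mul_I_ne_zero hs x
  have h2 := add_mul_I_ne_zero hs (-x)
  have h3 : (x : ℂ) ^ 2 + s ^ 2 ≠ 0 := by
    have : (0 : ℝ) < x ^ 2 + s ^ 2 := by positivity
    exact_mod_cast this.ne'
  have h4 : (Real.pi : ℂ) ≠ 0 := by exact_mod_cast Real.pi_ne_zero
  unfold linePoissonKernel
  push_cast at h2 ⊢
  rw [neg_mul, ← sub_eq_add_neg] at h2 ⊢
  field_simp
  ring_nf
  simp only [Complex.I_sq]
  ring

lemma conjPoisson_eq_cauchy {s : ℝ} (hs : 0 < s) (x : ℝ) :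
    (lineConjPoissonKernel s x : ℂ) = (2 * (Real.pi : ℂ))⁻¹ * Complex.I *
      (((s : ℂ) + x * Complex.I)⁻¹ - ((s : ℂ) + (-x : ℝ) * Complex.I)⁻¹) := by
  have h1 := add_mul_I_ne_zero hs x
  have h2 := add_mul_I_ne_zero hs (-x)
  have h3 : (x : ℂ) ^ 2 + s ^ 2 ≠ 0 := by
    have : (0 : ℝ) < x ^ 2 + s ^ 2 := by positivity
    exact_mod_cast this.ne'
  have h4 : (Real.pi : ℂ) ≠ 0 := by exact_mod_cast Real.pi_ne_zero
  unfold lineConjPoissonKernel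
  push_cast at h2 ⊢
  rw [neg_mul, ← sub_eq_add_neg] at h2 ⊢
  field_simp
  ring_nf
  simp only [Complex.I_sq]
  ring

lemma norm_inv_add_mul_I_le {s : ℝ} (hs : 0 < s) (x : ℝ) :
    ‖((s : ℂ) + x * Complex.I)⁻¹‖ ≤ s⁻¹ := by
  rw [norm_inv]
  gcongr
  have := Complex.abs_re_le_norm ((s : ℂ) + x * Complex.I)
  simpa [abs_of_pos hs] using this

lemma continuous_inv_add_mul_I {s : ℝ} (hs : 0 < s) :
    Continuous (fun x : ℝ => ((s : ℂ) + x * Complex.I)⁻¹) :=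
  Continuous.inv₀ (by fun_prop) fun x => add_mul_I_ne_zero hs x

lemma integrable_mul_cauchy {f : ℝ → ℂ} (hf : Integrable f) {s : ℝ} (hs : 0 < s) (σ r : ℝ) :
    Integrable (fun y : ℝ => f y * ((s : ℂ) + (σ * (r - y) : ℝ) * Complex.I)⁻¹) := by
  refine hf.mul_bdd (c := s⁻¹) ?_ (Eventually.of_forall fun y => norm_inv_add_mul_I_le hs _)
  have := (continuous_inv_add_mul_I hs).comp (show Continuous fun y : ℝ => σ * (r - y) by fun_prop)
  exact this.aestronglyMeasurable

/-- Of the two Cauchy halves of the Poisson kernel one annihilates M_1 and the other shifts it. -/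
lemma poisson_conv_lapMom {t : ℝ} (ht : 0 < t) {w s : ℝ} (hw : 0 ≤ w) (hs : 0 < s) (r : ℝ) :
    ∫ y : ℝ, (linePoissonKernel s (r - y) : ℂ) * lapMom 1 t (w + y * Complex.I)
      = lapMom 1 t ((s + w : ℝ) + r * Complex.I) := by
  have h1 : ∀ y : ℝ, (linePoissonKernel s (r - y) : ℂ) * lapMom 1 t (w + y * Complex.I)
      = (2 * (Real.pi : ℂ))⁻¹ * (lapMom 1 t (w + y * Complex.I) *
          ((s : ℂ) + (r - y : ℝ) * Complex.I)⁻¹ + lapMom 1 t (w + y * Complex.I) *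
          ((s : ℂ) + (-(r - y) : ℝ) * Complex.I)⁻¹) := by
    intro y
    rw [poisson_eq_cauchy hs]
    ring
  have i1 := integrable_mul_cauchy (integrable_lapMom_line ht hw) hs 1 r
  have i2 := integrable_mul_cauchy (integrable_lapMom_line ht hw) hs (-1) r
  simp only [one_mul, neg_one_mul] at i1 i2
  simp_rw [h1]
  rw [integral_const_mul, integral_add i1 i2, integral_lapMom_mul_cauchy ht hw hs,
    integral_lapMom_mul_cauchy_conj ht hw hs, add_zero, ← mul_assoc, inv_mul_cancel₀, one_mul]
  exact_mod_cast (by positivity : (2 * Real.pi : ℝ) ≠ 0)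

/-- Same splitting as for the Poisson kernel, with the halves subtracted and multiplied by i: on
these one-sided frequencies the Hilbert transform is multiplication by i. -/
lemma conjPoisson_conv_lapMom {t : ℝ} (ht : 0 < t) {w s : ℝ} (hw : 0 ≤ w) (hs : 0 < s)
    (r : ℝ) :
    ∫ y : ℝ, (lineConjPoissonKernel s (r - y) : ℂ) * lapMom 1 t (w + y * Complex.I)
      = Complex.I * lapMom 1 t ((s + w : ℝ) + r * Complex.I) := by
  have h1 : ∀ y : ℝ, (lineConjPoissonKernel s (r - y) : ℂ) * lapMom 1 t (w + y * Complex.I)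
      = (2 * (Real.pi : ℂ))⁻¹ * Complex.I * (lapMom 1 t (w + y * Complex.I) *
          ((s : ℂ) + (r - y : ℝ) * Complex.I)⁻¹ - lapMom 1 t (w + y * Complex.I) *
          ((s : ℂ) + (-(r - y) : ℝ) * Complex.I)⁻¹) := by
    intro y
    rw [conjPoisson_eq_cauchy hs]
    ring
  have i1 := integrable_mul_cauchy (integrable_lapMom_line ht hw) hs 1 r
  have i2 := integrable_mul_cauchy (integrable_lapMom_line ht hw) hs (-1) r
  simp only [one_mul, neg_one_mul] at i1 i2
  simp_rw [h1]
  rw [integral_const_mul, integral_sub i1 i2, integral_lapMom_mul_cauchy ht hw hs,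
    integral_lapMom_mul_cauchy_conj ht hw hs, sub_zero]
  have h4 : (Real.pi : ℂ) ≠ 0 := by exact_mod_cast Real.pi_ne_zero
  field_simp

lemma linePoissonKernel_nonneg {s : ℝ} (hs : 0 ≤ s) (x : ℝ) : 0 ≤ linePoissonKernel s x := by
  unfold linePoissonKernel
  have := Real.pi_pos
  positivity

lemma continuous_linePoissonKernel {s : ℝ} (hs : 0 < s) : Continuous (linePoissonKernel s) := by
  unfold linePoissonKernel
  refine Continuous.div (by fun_prop) (by fun_prop) fun x => ?_
  have := Real.pi_pos
  positivity

lemma continuous_lineConjPoissonKernel {s : ℝ} (hs : 0 < s) :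
    Continuous (lineConjPoissonKernel s) := by
  unfold lineConjPoissonKernel
  refine Continuous.div (by fun_prop) (by fun_prop) fun x => ?_
  have := Real.pi_pos
  positivity

lemma integrable_linePoissonKernel {s : ℝ} (hs : 0 < s) : Integrable (linePoissonKernel s) := by
  have h := (integrable_inv_add_sq (c := s ^ 2) (by positivity)).const_mul (s / Real.pi)
  refine h.congr (Eventually.of_forall fun x => ?_)
  simp only [linePoissonKernel]
  rw [div_mul_eq_mul_div, ← div_eq_mul_inv, div_div, mul_comm Real.pi, add_comm (s ^ 2)]

/-- The Poisson kernel has Fourier transform `exp (-w |k|)`. -/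
lemma integral_cexp_mul_linePoissonKernel {w : ℝ} (hw : 0 < w) (k : ℝ) :
    ∫ y : ℝ, Complex.exp ((k * y : ℝ) * Complex.I) * (linePoissonKernel w y : ℂ)
      = Complex.exp (-(w * |k| : ℝ)) := by
  have hpi : (Real.pi : ℂ) ≠ 0 := by exact_mod_cast Real.pi_ne_zero
  set a : ℝ → ℂ := fun k => (2 * (Real.pi : ℂ))⁻¹ * Complex.exp (-(w * |k| : ℝ)) with ha
  have hsplit : ∀ y : ℝ, ∀ k : ℝ, Complex.exp (-(k * y : ℝ) * Complex.I) * a k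
      = (2 * (Real.pi : ℂ))⁻¹ * Complex.exp (-(k * y : ℝ) * Complex.I - (w * |k| : ℝ)) := by
    intro y k
    simp only [ha]
    rw [mul_left_comm, ← Complex.exp_add, ← sub_eq_add_neg]
  have hpos : ∀ y : ℝ, ∀ k ∈ Ioi (0 : ℝ),
      Complex.exp (-(w + y * Complex.I) * k)
        = Complex.exp (-(k * y : ℝ) * Complex.I - (w * |k| : ℝ)) := by
    intro y k hk
    rw [abs_of_pos hk]
    congr 1
    push_cast
    ring
  have hneg : ∀ y : ℝ, ∀ k ∈ Iic (0 : ℝ),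
      Complex.exp ((w + (-y : ℝ) * Complex.I) * k)
        = Complex.exp (-(k * y : ℝ) * Complex.I - (w * |k| : ℝ)) := by
    intro y k hk
    rw [abs_of_nonpos hk]
    congr 1
    push_cast
    ring
  have iI : ∀ y : ℝ, IntegrableOn
      (fun k : ℝ => Complex.exp (-(k * y : ℝ) * Complex.I - (w * |k| : ℝ))) (Ioi 0) :=
    fun y => (integrableOn_exp_mul_complex_Ioi (a := -(w + y * Complex.I))
      (by simpa using hw) 0).congr_fun (hpos y) measurableSet_Ioi
  have iJ : ∀ y : ℝ, IntegrableOn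
      (fun k : ℝ => Complex.exp (-(k * y : ℝ) * Complex.I - (w * |k| : ℝ))) (Iic 0) :=
    fun y => (integrableOn_exp_mul_complex_Iic (a := w + (-y : ℝ) * Complex.I)
      (by simpa using hw) 0).congr_fun (hneg y) measurableSet_Iic
  have hfull : ∀ y : ℝ, Integrable
      (fun k : ℝ => Complex.exp (-(k * y : ℝ) * Complex.I - (w * |k| : ℝ))) := fun y => by
    rw [← integrableOn_univ, ← Iic_union_Ioi (a := (0 : ℝ))]
    exact (iJ y).union (iI y)
  have hai : Integrable a := by
    refine ((hfull 0).const_mul ((2 * (Real.pi : ℂ))⁻¹)).congr (Eventually.of_forall fun k => ?_)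
    simp [ha]
  have h := fourier_inversion (u := fun y => (linePoissonKernel w y : ℂ)) hai (fun y => ?_)
    (integrable_linePoissonKernel hw).ofReal (k := k) (by fun_prop)
  · rw [h]
    simp only [ha]
    field_simp
  · simp_rw [hsplit]
    rw [integral_const_mul, ← intervalIntegral.integral_Iic_add_Ioi (iJ y) (iI y),
      ← setIntegral_congr_fun measurableSet_Ioi (hpos y),
      ← setIntegral_congr_fun measurableSet_Iic (hneg y),
      integral_exp_mul_complex_Iic (by simpa using hw), integral_exp_neg_mul_Ioi (by simpa using hw),
      poisson_eq_cauchy hw, add_comm]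
    simp

lemma re_mul_cauchy {s : ℝ} (hs : 0 < s) (x : ℝ) :
    linePoissonKernel s x = 1 / Real.pi * (((s : ℂ) + x * Complex.I)⁻¹).re := by
  rw [Complex.inv_re, Complex.normSq_add_mul_I]
  unfold linePoissonKernel
  have := Real.pi_pos
  have h : s ^ 2 + x ^ 2 ≠ 0 := by positivity
  have h' : x ^ 2 + s ^ 2 ≠ 0 := by positivity
  simp
  field_simp
  ring

/-- For real data the Poisson integral is the real part of a single Cauchy transform, so the
frequencies k > 0 suffice. -/
lemma real_mul_cauchy_integral {f : ℝ → ℝ} (hf : Integrable f) {s : ℝ} (hs : 0 < s) (r : ℝ) :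
    ∫ y : ℝ, linePoissonKernel s (r - y) * f y
      = 1 / Real.pi * (∫ k in Ioi (0 : ℝ), Complex.exp (-(s + r * Complex.I) * k) *
          ∫ y : ℝ, Complex.exp ((k * y : ℝ) * Complex.I) * (f y : ℂ)).re := by
  have hf' : Integrable (fun y => (f y : ℂ)) := hf.ofReal
  have h := integral_mul_cauchy hf' hs 1 r
  have i := integrable_mul_cauchy hf' hs 1 r
  simp only [one_mul] at h i
  rw [← h, ← RCLike.re_eq_complex_re, ← integral_re i, ← integral_const_mul]
  refine integral_congr_ae (Eventually.of_forall fun y => ?_)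
  simp only [RCLike.re_eq_complex_re]
  rw [re_mul_cauchy hs]
  rw [Complex.re_ofReal_mul]
  ring

/-- Identifies the real part of the zeroth moment, up to π, as the harmonic extension of the Gauss
kernel to height s. -/
lemma poisson_conv_gauss {t s : ℝ} (ht : 0 < t) (hs : 0 < s) (r : ℝ) :
    ∫ y : ℝ, linePoissonKernel s (r - y) * gauss t y
      = 1 / Real.pi * (lapMom 0 t (s + r * Complex.I)).re := by
  rw [real_mul_cauchy_integral (integrable_gauss ht) hs]
  congr 2
  unfold lapMom
  refine setIntegral_congr_fun measurableSet_Ioi fun k _ => ?_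
  have h := integral_cexp_mul_gauss ht k
  push_cast at h ⊢
  rw [h, ← Complex.exp_add, pow_zero, one_mul]
  congr 1
  ring

/-- The semigroup property of the Poisson kernel. -/
lemma poisson_conv_poisson {s w : ℝ} (hs : 0 < s) (hw : 0 < w) (r : ℝ) :
    ∫ y : ℝ, linePoissonKernel s (r - y) * linePoissonKernel w y = linePoissonKernel (s + w) r := by
  rw [real_mul_cauchy_integral (integrable_linePoissonKernel hw) hs, re_mul_cauchy (by positivity)]
  congr 2
  rw [← integral_exp_neg_mul_Ioi (re_pos_add_mul_I (by positivity) r)]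
  refine setIntegral_congr_fun measurableSet_Ioi fun k hk => ?_
  rw [integral_cexp_mul_linePoissonKernel hw, abs_of_pos hk, ← Complex.exp_add]
  congr 1
  push_cast
  ring

/-! ### Weighted Gaussian bounds -/

/-- The derivative of the Gauss kernel of the line. -/
def gaussDeriv (t x : ℝ) : ℝ := -(x / (2 * t)) * gauss t x

@[fun_prop]
lemma continuous_gaussDeriv (t : ℝ) : Continuous (gaussDeriv t) := by unfold gaussDeriv; fun_prop

lemma hasDerivAt_gauss (t x : ℝ) : HasDerivAt (gauss t) (gaussDeriv t x) x := by
  have h := (((hasDerivAt_pow 2 x).neg.div_const (4 * t)).exp).const_mul ((√(4 * Real.pi * t))⁻¹)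
  refine h.congr_deriv ?_
  unfold gaussDeriv gauss
  simp only [Pi.neg_apply]
  push_cast
  ring

/-- From e^{v/m} ≥ 1 + v/m. It lets a fraction of a Gaussian exponent pay for a polynomial weight.
-/
lemma one_add_mul_exp_neg_le {m : ℝ} (hm : 1 ≤ m) {v : ℝ} (hv : 0 ≤ v) :
    (1 + v) * Real.exp (-(v / m)) ≤ m := by
  rw [Real.exp_neg, ← div_eq_mul_inv, div_le_iff₀ (Real.exp_pos _)]
  have h1 := Real.add_one_le_exp (v / m)
  have h2 : m * (v / m + 1) = v + m := by field_simp
  nlinarith [mul_le_mul_of_nonneg_left h1 (by linarith : 0 ≤ m)]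

/-- Half of the exponent is kept as a Gauss kernel of unit mass at the doubled time; the other half
is left to absorb weights. -/
lemma gauss_eq_mul_gauss_two {t : ℝ} (ht : 0 < t) (u : ℝ) :
    gauss t u = √2 * Real.exp (-(u ^ 2 / t / 8)) * gauss (2 * t) u := by
  unfold gauss
  have h1 : √(4 * Real.pi * (2 * t)) = √2 * √(4 * Real.pi * t) := by
    rw [← Real.sqrt_mul (by norm_num)]; ring_nf
  have h2 : Real.exp (-u ^ 2 / (4 * t))
      = Real.exp (-(u ^ 2 / t / 8)) * Real.exp (-u ^ 2 / (4 * (2 * t))) := by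
    rw [← Real.exp_add]; congr 1; field_simp; ring
  have h3 : √2 ≠ 0 := by positivity
  rw [h1, h2, mul_inv]
  field_simp

lemma sqrt_two_le : √2 ≤ 3 / 2 := by
  rw [Real.sqrt_le_left (by norm_num)]; norm_num

/-- The constant is (3/2) · 8 · t. Its linearity in t is what makes the bound on the reflected
kernel uniform in time. -/
lemma gauss_mul_le {t : ℝ} (ht : 0 < t) (u : ℝ) :
    |gauss t u| * (t + u ^ 2) ≤ (12 * t) * gauss (2 * t) u := by
  have h1 := one_add_mul_exp_neg_le (m := 8) (by norm_num) (v := u ^ 2 / t) (by positivity)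
  have h2 : t + u ^ 2 = t * (1 + u ^ 2 / t) := by field_simp
  rw [abs_of_nonneg (gauss_nonneg _ _), gauss_eq_mul_gauss_two ht, h2]
  have h3 := gauss_nonneg (2 * t) u
  calc √2 * Real.exp (-(u ^ 2 / t / 8)) * gauss (2 * t) u * (t * (1 + u ^ 2 / t))
      = √2 * ((1 + u ^ 2 / t) * Real.exp (-(u ^ 2 / t / 8))) * t * gauss (2 * t) u := by ring
    _ ≤ (3 / 2) * 8 * t * gauss (2 * t) u := by gcongr; exact sqrt_two_le
    _ = _ := by ring

lemma gaussDeriv_mul_le {t : ℝ} (ht : 0 < t) :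
    ∃ C : ℝ, 0 ≤ C ∧ ∀ u : ℝ, |gaussDeriv t u| * (t + u ^ 2) ≤ C * gauss (2 * t) u := by
  refine ⟨(1 + t) * (3 / 2 * (16 * 16)), by positivity, fun u => ?_⟩
  have h1 := one_add_mul_exp_neg_le (m := 16) (by norm_num) (v := u ^ 2 / t) (by positivity)
  have h3 := gauss_nonneg (2 * t) u
  have h2 : t + u ^ 2 = t * (1 + u ^ 2 / t) := by field_simp
  have h4 : |u| / (2 * t) * t ≤ (1 + t) * (1 + u ^ 2 / t) := by
    have : |u| / (2 * t) * t = |u| / 2 := by field_simp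
    rw [this]
    have h5 : |u| ≤ t + u ^ 2 / t := by
      have : t + u ^ 2 / t - |u| = (t ^ 2 + |u| ^ 2 - t * |u|) / t := by
        rw [sq_abs]; field_simp
      have h6 : 0 ≤ (t ^ 2 + |u| ^ 2 - t * |u|) / t := by
        apply div_nonneg _ ht.le
        nlinarith [sq_nonneg (t - |u|), abs_nonneg u]
      linarith
    have h7 : 0 ≤ u ^ 2 / t := by positivity
    nlinarith [mul_nonneg ht.le h7, abs_nonneg u]
  -- The factor u of the derivative costs a second weight 1 + u²/t, so the spare exponential is
  -- split in two.
  have h5 : Real.exp (-(u ^ 2 / t / 8)) = Real.exp (-(u ^ 2 / t / 16)) *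
      Real.exp (-(u ^ 2 / t / 16)) := by
    rw [← Real.exp_add]; congr 1; ring
  unfold gaussDeriv
  rw [abs_mul, abs_neg, abs_div, abs_of_pos (by positivity : 0 < 2 * t),
    abs_of_nonneg (gauss_nonneg t u), gauss_eq_mul_gauss_two ht, h2]
  calc |u| / (2 * t) * (√2 * Real.exp (-(u ^ 2 / t / 8)) * gauss (2 * t) u) *
        (t * (1 + u ^ 2 / t))
      = (|u| / (2 * t) * t) * (√2 * ((1 + u ^ 2 / t) * Real.exp (-(u ^ 2 / t / 8)))) *
          gauss (2 * t) u := by ring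
    _ ≤ ((1 + t) * (1 + u ^ 2 / t)) * (3 / 2 * ((1 + u ^ 2 / t) *
          Real.exp (-(u ^ 2 / t / 8)))) * gauss (2 * t) u := by
        gcongr; exact sqrt_two_le
    _ = (1 + t) * (3 / 2 * (((1 + u ^ 2 / t) * Real.exp (-(u ^ 2 / t / 16))) *
          ((1 + u ^ 2 / t) * Real.exp (-(u ^ 2 / t / 16))))) * gauss (2 * t) u := by
        rw [h5]; ring
    _ ≤ _ := by gcongr

lemma gauss_le_sqrt_inv {t : ℝ} (ht : 0 < t) (u : ℝ) : gauss t u ≤ (√(4 * Real.pi * t))⁻¹ := by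
  unfold gauss
  have h : Real.exp (-u ^ 2 / (4 * t)) ≤ 1 := by
    rw [Real.exp_le_one_iff]
    apply div_nonpos_of_nonpos_of_nonneg _ (by positivity)
    nlinarith [sq_nonneg u]
  calc _ ≤ (√(4 * Real.pi * t))⁻¹ * 1 := by gcongr
    _ = _ := mul_one _

/-- Rational decay of a function with a Gaussian bound. -/
lemma abs_le_of_mul_le_gauss {t C : ℝ} (ht : 0 < t) {φ : ℝ → ℝ} (hC : 0 ≤ C)
    (h : ∀ u : ℝ, |φ u| * (t + u ^ 2) ≤ C * gauss (2 * t) u) (u : ℝ) :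
    |φ u| ≤ C * (√(4 * Real.pi * (2 * t)))⁻¹ * (t + u ^ 2)⁻¹ := by
  rw [← div_eq_mul_inv, le_div_iff₀ (by positivity)]
  exact (h u).trans (mul_le_mul_of_nonneg_left (gauss_le_sqrt_inv (by positivity) u) hC)

lemma integrable_of_mul_le_gauss {t C : ℝ} (ht : 0 < t) {φ : ℝ → ℝ} (hφ : Continuous φ)
    (h : ∀ u : ℝ, |φ u| * (t + u ^ 2) ≤ C * gauss (2 * t) u) : Integrable φ := by
  refine Integrable.mono' ((integrable_gauss (t := 2 * t) (by positivity)).const_mul (C / t))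
    hφ.aestronglyMeasurable (Eventually.of_forall fun u => ?_)
  rw [Real.norm_eq_abs, div_mul_eq_mul_div, le_div_iff₀ ht]
  refine le_trans ?_ (h u)
  gcongr
  nlinarith [sq_nonneg u]

lemma integrable_gaussDeriv {t : ℝ} (ht : 0 < t) : Integrable (gaussDeriv t) := by
  obtain ⟨C, _, h⟩ := gaussDeriv_mul_le ht
  exact integrable_of_mul_le_gauss ht (by fun_prop) h

/-- Differentiation of a Gaussian integral with a bounded weight. -/
lemma hasDerivAt_integral_mul_gauss {t M : ℝ} (ht : 0 < t) {A : ℝ → ℝ} (hA : Continuous A)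
    (hM : ∀ w, 0 < w → |A w| ≤ M) {σ : ℝ} (hσ : σ ^ 2 = 1) (x : ℝ) :
    HasDerivAt (fun x => ∫ w in Ioi (0 : ℝ), A w * gauss t (x + σ * w))
      (∫ w in Ioi (0 : ℝ), A w * gaussDeriv t (x + σ * w)) x := by
  obtain ⟨C, hC, hb⟩ := gaussDeriv_mul_le ht
  have hb' := abs_le_of_mul_le_gauss ht hC hb
  set C' := C * (√(4 * Real.pi * (2 * t)))⁻¹ with hC'
  have hC'0 : 0 ≤ C' := by positivity
  have hσ0 : σ ≠ 0 := by rintro rfl; norm_num at hσ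
  have hM0 : 0 ≤ M := (abs_nonneg _).trans (hM 1 one_pos)
  refine (hasDerivAt_integral_of_dominated_loc_of_deriv_le
    (μ := volume.restrict (Ioi (0 : ℝ))) (s := Metric.ball x 1) (x₀ := x)
    (F := fun x w => A w * gauss t (x + σ * w))
    (F' := fun x w => A w * gaussDeriv t (x + σ * w))
    (bound := fun w => M * (C' * (2 + 2 / t)) * (t + (x + σ * w) ^ 2)⁻¹)
    (Metric.ball_mem_nhds x one_pos) (Eventually.of_forall fun z => (by fun_prop)) ?_
    (by fun_prop) ?_ ?_ ?_).2
  · refine Integrable.bdd_mul (c := M) ?_ hA.aestronglyMeasurable ?_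
    · exact (((integrable_gauss ht).comp_add_left x).comp_mul_left' hσ0).integrableOn
    · filter_upwards [ae_restrict_mem measurableSet_Ioi] with w hw using hM w hw
  -- For |z - x| ≤ 1 the rational weights at z + σw and x + σw are comparable with ratio 2 + 2/t.
  · filter_upwards [ae_restrict_mem measurableSet_Ioi] with w hw z hz
    rw [Metric.mem_ball, Real.dist_eq] at hz
    have hz2 : (z - x) ^ 2 ≤ 1 := by rw [← sq_abs]; nlinarith [abs_nonneg (z - x)]
    rw [norm_mul, Real.norm_eq_abs, Real.norm_eq_abs, mul_assoc]
    refine mul_le_mul (hM w hw) ((hb' _).trans ?_) (abs_nonneg _) hM0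
    rw [mul_assoc C']
    refine mul_le_mul_of_nonneg_left ?_ hC'0
    have p1 : 0 < t + (x + σ * w) ^ 2 := by positivity
    have p2 : 0 < t + (z + σ * w) ^ 2 := by positivity
    rw [← div_eq_mul_inv, le_div_iff₀ p1, inv_mul_le_iff₀ p2]
    have h1 : (t + (z + σ * w) ^ 2) * (2 + 2 / t)
        = 2 * t + 2 + 2 * (z + σ * w) ^ 2 + 2 * (z + σ * w) ^ 2 / t := by field_simp; ring
    have h2 : 0 ≤ 2 * (z + σ * w) ^ 2 / t := by positivity
    rw [h1]
    nlinarith [sq_nonneg ((z + σ * w) + (z - x))]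
  · have h1 := (((integrable_inv_add_sq ht).comp_add_left x).comp_mul_left' hσ0)
    exact (h1.const_mul _).integrableOn
  · refine Eventually.of_forall fun w z _ => ?_
    exact ((hasDerivAt_gauss t (z + σ * w)).comp_add_const z (σ * w)).const_mul (A w)

/-! ### The remainder of the kernel as a one-sided convolution -/

/-- The integral `π⁻¹ ∫₀^∞ Re M₁(s + w + i z₁) φ(z₂ - w) dw`, where `M₁` is the first Laplace
moment. -/
def lapConv (φ : ℝ → ℝ) (t s : ℝ) (z : ℝ × ℝ) : ℝ :=
  1 / Real.pi * ∫ w in Ioi (0 : ℝ),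
    (lapMom 1 t ((s + w : ℝ) + z.1 * Complex.I)).re * φ (z.2 - w)

lemma abs_re_lapMom_le (n : ℕ) {t : ℝ} (ht : 0 < t) (s r : ℝ) {w : ℝ} (hw : 0 ≤ w) :
    |(lapMom n t ((s + w : ℝ) + r * Complex.I)).re| ≤ lapBound n t s :=
  (Complex.abs_re_le_norm _).trans (norm_lapMom_le n ht (by simpa using hw))

lemma continuous_re_lapMom_line (n : ℕ) {t : ℝ} (ht : 0 < t) (s r : ℝ) :
    Continuous (fun w : ℝ => (lapMom n t ((s + w : ℝ) + r * Complex.I)).re) := by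
  have := continuous_lapMom n ht
  fun_prop

lemma integrableOn_re_lapMom_mul (n : ℕ) {t : ℝ} (ht : 0 < t) (s r : ℝ) {φ : ℝ → ℝ}
    (hφ : Integrable φ) :
    IntegrableOn (fun w : ℝ => (lapMom n t ((s + w : ℝ) + r * Complex.I)).re * φ w) (Ioi 0) := by
  refine Integrable.bdd_mul (c := lapBound n t s) hφ.integrableOn
    (continuous_re_lapMom_line n ht s r).aestronglyMeasurable ?_
  filter_upwards [ae_restrict_mem measurableSet_Ioi] with w hw
  exact abs_re_lapMom_le n ht s r (le_of_lt hw)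

/-- From b² ≤ 2w² + 2(b - w)²: decay in w is exchanged for decay in b at the price of a weight in b
- w, which the Gaussian pays for. -/
lemma peetre {t : ℝ} (ht : 0 < t) (a b w : ℝ) :
    (t + (w ^ 2 + a ^ 2))⁻¹ ≤ 2 / t * (t + (b - w) ^ 2) * (t + (a ^ 2 + b ^ 2))⁻¹ := by
  have p1 : 0 < t + (w ^ 2 + a ^ 2) := by positivity
  have p2 : 0 < t + (a ^ 2 + b ^ 2) := by positivity
  rw [← div_eq_mul_inv, le_div_iff₀ p2, inv_mul_le_iff₀ p1]
  have h : (t + (w ^ 2 + a ^ 2)) * (2 / t * (t + (b - w) ^ 2))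
      = 2 * t + 2 * w ^ 2 + 2 * a ^ 2 + 2 * (b - w) ^ 2 +
        2 * (w ^ 2 + a ^ 2) * (b - w) ^ 2 / t := by field_simp; ring
  rw [h]
  have h2 : 0 ≤ 2 * (w ^ 2 + a ^ 2) * (b - w) ^ 2 / t := by positivity
  nlinarith [sq_nonneg (w - (b - w))]

/-- Quadratic decay of `lapConv` on the whole plane. -/
lemma abs_lapConv_le {t C : ℝ} (ht : 0 < t) {φ : ℝ → ℝ}
    (h : ∀ u : ℝ, |φ u| * (t + u ^ 2) ≤ C * gauss (2 * t) u) {s : ℝ} (hs : 0 ≤ s) (z : ℝ × ℝ) :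
    |lapConv φ t s z| ≤ 14 * C / (Real.pi * t) * (t + (z.1 ^ 2 + z.2 ^ 2))⁻¹ := by
  unfold lapConv
  have hpi := Real.pi_pos
  -- The hypothesis at u = 0 already forces the constant to be nonnegative.
  have hC : 0 ≤ C := by
    have h0 := h 0
    have h1 : 0 < gauss (2 * t) 0 := by unfold gauss; positivity
    by_contra hneg
    have := mul_neg_of_neg_of_pos (not_le.1 hneg) h1
    have h2 : 0 ≤ |φ 0| * (t + 0 ^ 2) := by positivity
    linarith
  set b : ℝ → ℝ := fun w =>
    14 * C / t * (t + (z.1 ^ 2 + z.2 ^ 2))⁻¹ * gauss (2 * t) (z.2 - w) with hb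
  have hbi : Integrable b :=
    ((integrable_gauss (t := 2 * t) (by positivity)).comp_sub_left z.2).const_mul _
  have hle : ‖∫ w in Ioi (0 : ℝ), (lapMom 1 t ((s + w : ℝ) + z.1 * Complex.I)).re * φ (z.2 - w)‖
      ≤ ∫ w in Ioi (0 : ℝ), b w := by
    refine norm_integral_le_of_norm_le hbi.integrableOn ?_
    filter_upwards [ae_restrict_mem measurableSet_Ioi] with w hw
    have hw' : (0 : ℝ) < w := hw
    rw [norm_mul, Real.norm_eq_abs, Real.norm_eq_abs]
    have h1 := (Complex.abs_re_le_norm _).trans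
      (norm_lapMom_line_le ht (w := s + w) (by positivity) z.1)
    -- Discarding s makes the estimate uniform in s ≥ 0, as the difference quotients of the Poisson
    -- extension require.
    have h2 : (t + ((s + w) ^ 2 + z.1 ^ 2))⁻¹ ≤ (t + (w ^ 2 + z.1 ^ 2))⁻¹ := by
      gcongr
      linarith
    rw [div_eq_mul_inv] at h1
    calc |(lapMom 1 t ((s + w : ℝ) + z.1 * Complex.I)).re| * |φ (z.2 - w)|
        ≤ (7 * (2 / t * (t + (z.2 - w) ^ 2) * (t + (z.1 ^ 2 + z.2 ^ 2))⁻¹)) * |φ (z.2 - w)| := by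
          gcongr
          exact h1.trans (mul_le_mul_of_nonneg_left (h2.trans (peetre ht _ _ _)) (by norm_num))
      _ = 14 / t * (t + (z.1 ^ 2 + z.2 ^ 2))⁻¹ * (|φ (z.2 - w)| * (t + (z.2 - w) ^ 2)) := by ring
      _ ≤ 14 / t * (t + (z.1 ^ 2 + z.2 ^ 2))⁻¹ * (C * gauss (2 * t) (z.2 - w)) := by
          exact mul_le_mul_of_nonneg_left (h _) (by positivity)
      _ = b w := by simp only [hb]; ring
  have hle2 : ∫ w in Ioi (0 : ℝ), b w ≤ 14 * C / t * (t + (z.1 ^ 2 + z.2 ^ 2))⁻¹ := by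
    refine (setIntegral_le_integral hbi (Eventually.of_forall fun w => ?_)).trans ?_
    · have := gauss_nonneg (2 * t) (z.2 - w)
      simp only [hb, Pi.zero_apply]
      positivity
    · simp only [hb]
      rw [integral_const_mul, integral_sub_left_eq_self (gauss (2 * t)) volume z.2,
        integral_gauss (by positivity), mul_one]
  rw [abs_mul, abs_of_pos (by positivity : 0 < 1 / Real.pi)]
  calc _ ≤ 1 / Real.pi * (14 * C / t * (t + (z.1 ^ 2 + z.2 ^ 2))⁻¹) := by
        gcongr; exact hle.trans hle2
    _ = _ := by field_simp

lemma measurable_lapConv {φ : ℝ → ℝ} (hφ : Continuous φ) {t : ℝ} (ht : 0 < t) (s : ℝ) :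
    Measurable (lapConv φ t s) := by
  unfold lapConv
  have hc := continuous_lapMom 1 ht
  have h : Continuous (fun p : (ℝ × ℝ) × ℝ =>
      (lapMom 1 t ((s + p.2 : ℝ) + p.1.1 * Complex.I)).re * φ (p.1.2 - p.2)) := by fun_prop
  exact (h.stronglyMeasurable.integral_prod_right' (ν := volume.restrict (Ioi 0))).measurable.const_mul _

lemma hasDerivAt_lapConv_snd {t : ℝ} (ht : 0 < t) (s r x : ℝ) :
    HasDerivAt (fun x => lapConv (gauss t) t s (r, x)) (lapConv (gaussDeriv t) t s (r, x)) x := by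
  have h := hasDerivAt_integral_mul_gauss ht (continuous_re_lapMom_line 1 ht s r)
    (fun w hw => abs_re_lapMom_le 1 ht s r hw.le) (σ := -1) (by norm_num) x
  simp only [neg_one_mul, ← sub_eq_add_neg] at h
  exact h.const_mul _

lemma hasDerivAt_re_lapMom_line (n : ℕ) {t : ℝ} (ht : 0 < t) (s r : ℝ) :
    HasDerivAt (fun s : ℝ => (lapMom n t (s + r * Complex.I)).re)
      (-(lapMom (n + 1) t (s + r * Complex.I)).re) s := by
  have h1 : HasDerivAt (fun s : ℂ => lapMom n t (s + r * Complex.I))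
      (-lapMom (n + 1) t (s + r * Complex.I)) (s : ℂ) := by
    have := (hasDerivAt_lapMom n ht (s + r * Complex.I)).comp_add_const (s : ℂ) (r * Complex.I)
    exact this
  simpa using h1.real_of_complex

lemma tendsto_gauss_atTop {t : ℝ} (ht : 0 < t) : Tendsto (gauss t) atTop (𝓝 0) := by
  unfold gauss
  rw [← mul_zero ((√(4 * Real.pi * t))⁻¹)]
  refine Tendsto.const_mul _ (Real.tendsto_exp_atBot.comp ?_)
  have h := (tendsto_pow_atTop (two_ne_zero) (α := ℝ)).const_mul_atTop_of_neg
    (r := -(1 / (4 * t))) (by rw [neg_lt_zero]; positivity)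
  refine h.congr fun x => ?_
  ring

/-- The s-derivative of Re M_1(s + w + i z₁) is also its w-derivative, so an integration by parts
moves it onto the Gauss factor and leaves a boundary term at w = 0. -/
lemma hasDerivAt_lapConv_shift {t : ℝ} (ht : 0 < t) (s : ℝ) (z : ℝ × ℝ) :
    HasDerivAt (fun s => lapConv (gauss t) t s z)
      (lapConv (gaussDeriv t) t s z -
        1 / Real.pi * (lapMom 1 t (s + z.1 * Complex.I)).re * gauss t z.2) s := by
  have hg : Integrable (fun w => gauss t (z.2 - w)) := (integrable_gauss ht).comp_sub_left z.2
  have hg' : Integrable (fun w => gaussDeriv t (z.2 - w)) :=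
    (integrable_gaussDeriv ht).comp_sub_left z.2
  have hdw : ∀ s w : ℝ, HasDerivAt (fun w : ℝ => (lapMom 1 t ((s + w : ℝ) + z.1 * Complex.I)).re)
      (-(lapMom 2 t ((s + w : ℝ) + z.1 * Complex.I)).re) w := fun s w => by
    exact (hasDerivAt_re_lapMom_line 1 ht (s + w) z.1).comp_const_add s w
  have key := (hasDerivAt_integral_of_dominated_loc_of_deriv_le
    (μ := volume.restrict (Ioi (0 : ℝ))) (s := Metric.ball s 1) (x₀ := s)
    (F := fun s w => (lapMom 1 t ((s + w : ℝ) + z.1 * Complex.I)).re * gauss t (z.2 - w))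
    (F' := fun s w => -(lapMom 2 t ((s + w : ℝ) + z.1 * Complex.I)).re * gauss t (z.2 - w))
    (bound := fun w => lapBound 2 t (s - 1) * gauss t (z.2 - w))
    (Metric.ball_mem_nhds s one_pos) (Eventually.of_forall fun x =>
      ((continuous_re_lapMom_line 1 ht x z.1).mul (by fun_prop)).aestronglyMeasurable)
    (integrableOn_re_lapMom_mul 1 ht s z.1 hg)
    ((continuous_re_lapMom_line 2 ht s z.1).neg.mul (by fun_prop)).aestronglyMeasurable
    ?_ (hg.const_mul _).integrableOn ?_).2
  · have hparts := integral_Ioi_mul_deriv_eq_deriv_mul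
      (u := fun w : ℝ => (lapMom 1 t ((s + w : ℝ) + z.1 * Complex.I)).re)
      (v := fun w => gauss t (z.2 - w))
      (u' := fun w : ℝ => -(lapMom 2 t ((s + w : ℝ) + z.1 * Complex.I)).re)
      (v' := fun w => -gaussDeriv t (z.2 - w)) (a := 0)
      (a' := (lapMom 1 t (s + z.1 * Complex.I)).re * gauss t z.2) (b' := 0)
      (fun w _ => hdw s w)
      (fun w _ => (hasDerivAt_gauss t (z.2 - w)).comp_const_sub z.2 w)
      (integrableOn_re_lapMom_mul 1 ht s z.1 hg'.neg)
      ((integrableOn_re_lapMom_mul 2 ht s z.1 hg).neg.congr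
        (Eventually.of_forall fun w => by simp))
      ?_ ?_
    · unfold lapConv
      refine (key.const_mul (1 / Real.pi)).congr_deriv ?_
      have h1 : ∫ w in Ioi (0 : ℝ), -(lapMom 2 t ((s + w : ℝ) + z.1 * Complex.I)).re *
          gauss t (z.2 - w) = (∫ w in Ioi (0 : ℝ), (lapMom 1 t ((s + w : ℝ) + z.1 * Complex.I)).re *
          gaussDeriv t (z.2 - w)) - (lapMom 1 t (s + z.1 * Complex.I)).re * gauss t z.2 := by
        simp only [mul_neg, integral_neg] at hparts
        linarith
      rw [h1]
      ring
    · have hcont : Continuous fun w : ℝ =>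
          (lapMom 1 t ((s + w : ℝ) + z.1 * Complex.I)).re * gauss t (z.2 - w) :=
        (continuous_re_lapMom_line 1 ht s z.1).mul (by fun_prop)
      have := (hcont.tendsto 0).mono_left (nhdsWithin_le_nhds (s := Ioi 0))
      simp only [add_zero, sub_zero] at this
      exact this
    · refine squeeze_zero_norm' (a := fun w => lapBound 1 t s * gauss t (w - z.2)) ?_ ?_
      · filter_upwards [eventually_gt_atTop 0] with w hw
        rw [Pi.mul_apply, norm_mul, ← gauss_neg t (w - z.2), neg_sub,
          Real.norm_of_nonneg (gauss_nonneg _ _)]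
        exact mul_le_mul_of_nonneg_right (abs_re_lapMom_le 1 ht s z.1 hw.le) (gauss_nonneg _ _)
      · rw [← mul_zero (lapBound 1 t s)]
        exact ((tendsto_gauss_atTop ht).comp (tendsto_atTop_add_const_right _ (-z.2)
          tendsto_id)).const_mul _
  · filter_upwards [ae_restrict_mem measurableSet_Ioi] with w hw x hx
    have hw' : (0 : ℝ) < w := hw
    rw [Metric.mem_ball, Real.dist_eq, abs_lt] at hx
    rw [norm_mul, norm_neg, Real.norm_of_nonneg (gauss_nonneg _ _)]
    refine mul_le_mul_of_nonneg_right ?_ (gauss_nonneg _ _)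
    refine (Complex.abs_re_le_norm _).trans (norm_lapMom_le 2 ht ?_)
    simp
    linarith
  · refine Eventually.of_forall fun w x _ => HasDerivAt.mul_const ?_ _
    exact (hasDerivAt_re_lapMom_line 1 ht (x + w) z.1).comp_add_const x w

/-! ### Explicit form of the nonlocal kernel -/

/-- The height may have either sign, the kernel being odd in it. This is the link between the
Newtonian potential and the Poisson kernel. -/
lemma hasDerivAt_E_snd {w : ℝ × ℝ} (hw : w.2 ≠ 0) :
    HasDerivAt (fun s : ℝ => E (w.1, s)) (-(1 / 2) * linePoissonKernel w.2 w.1) w.2 := by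
  have hpos : 0 < w.1 ^ 2 + w.2 ^ 2 := by positivity
  have h1 : HasDerivAt (fun s : ℝ => w.1 ^ 2 + s ^ 2) (2 * w.2) w.2 := by
    simpa using (hasDerivAt_pow 2 w.2).const_add (w.1 ^ 2)
  have h2 := ((h1.sqrt hpos.ne').log (Real.sqrt_pos.2 hpos).ne').const_mul (-(1 / (2 * Real.pi)))
  have h3 : HasDerivAt (fun s : ℝ => E (w.1, s)) _ w.2 := h2
  convert h3 using 1
  unfold linePoissonKernel
  have h4 : √(w.1 ^ 2 + w.2 ^ 2) * √(w.1 ^ 2 + w.2 ^ 2) = w.1 ^ 2 + w.2 ^ 2 :=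
    Real.mul_self_sqrt hpos.le
  have h5 := (Real.sqrt_pos.2 hpos).ne'
  have h6 := Real.pi_ne_zero
  rw [div_div, mul_assoc, h4]
  field_simp

lemma partial2_E {w : ℝ × ℝ} (hw : w.2 ≠ 0) :
    partial2 E w = -(1 / 2) * linePoissonKernel w.2 w.1 :=
  (hasDerivAt_E_snd hw).deriv

lemma linePoissonKernel_neg_left (s x : ℝ) : linePoissonKernel (-s) x = -linePoissonKernel s x := by
  simp [linePoissonKernel, neg_div]

lemma measurable_linePoissonKernel : Measurable (fun w : ℝ × ℝ => linePoissonKernel w.2 w.1) := by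
  unfold linePoissonKernel; fun_prop

lemma gauss_conv_poisson {t s : ℝ} (ht : 0 < t) (hs : 0 < s) (r : ℝ) :
    ∫ y : ℝ, linePoissonKernel s y * gauss t (r - y)
      = 1 / Real.pi * (lapMom 0 t (s + r * Complex.I)).re := by
  rw [← poisson_conv_gauss ht hs, ← integral_sub_left_eq_self _ volume r]
  simp

lemma integrable_poisson_mul_gauss {t s : ℝ} (hs : 0 < s) (r : ℝ) :
    Integrable (fun y : ℝ => linePoissonKernel s y * gauss t (r - y)) := by
  refine (integrable_linePoissonKernel hs).mul_bdd (c := (√(4 * Real.pi * t))⁻¹ * 1) (by fun_prop)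
    (Eventually.of_forall fun y => ?_)
  rw [Real.norm_of_nonneg (gauss_nonneg _ _)]
  by_cases ht : 0 < t
  · exact (gauss_le_sqrt_inv ht _).trans (mul_one _).ge
  -- For t ≤ 0 the normalising factor is the inverse of zero, so the kernel vanishes identically.
  · unfold gauss
    rw [Real.sqrt_eq_zero_of_nonpos (by nlinarith [Real.pi_pos])]
    simp

lemma integral_eq_integral_Ioi_add {f : ℝ → ℝ} (hf : Integrable f) :
    ∫ x, f x = ∫ x in Ioi (0 : ℝ), (f x + f (-x)) := by
  have hn : Integrable (fun x => f (-x)) := hf.comp_neg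
  rw [integral_add hf.integrableOn hn.integrableOn, integral_comp_neg_Ioi, neg_zero, add_comm,
    intervalIntegral.integral_Iic_add_Ioi hf.integrableOn hf.integrableOn]

/-- The velocity of the Gaussian vortex, as a one-dimensional integral. -/
lemma gradConv_eq {t : ℝ} (ht : 0 < t) (z : ℝ × ℝ) :
    gradConv t z = 1 / (2 * Real.pi) * ∫ w in Ioi (0 : ℝ),
      (lapMom 0 t (w + z.1 * Complex.I)).re * (gauss t (z.2 + w) - gauss t (z.2 - w)) := by
  set F : ℝ × ℝ → ℝ := fun w =>
    -(1 / 2) * (linePoissonKernel w.2 w.1 * gauss t (z.1 - w.1) * gauss t (z.2 - w.2)) with hF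
  have hFm : Measurable F := by
    have := measurable_linePoissonKernel
    have h2 := (continuous_gauss t).measurable
    fun_prop
  -- The formula for ∂₂E is available off the null line w₂ = 0.
  have hne : ∀ᵐ w : ℝ × ℝ, w.2 ≠ 0 := by
    have : ∀ᵐ x : ℝ, x ≠ 0 := by simp [ae_iff]
    exact Measure.quasiMeasurePreserving_snd.ae this
  have hgrad : gradConv t z = ∫ w : ℝ × ℝ, F w := by
    unfold gradConv
    refine integral_congr_ae ?_
    filter_upwards [hne] with w hw
    rw [partial2_E hw, heatKernel_eq_gauss_mul ht]
    simp only [hF, Prod.fst_sub, Prod.snd_sub]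
    ring
  have hinner : ∀ b : ℝ, 0 < b → ∫ a : ℝ, linePoissonKernel b a * gauss t (z.1 - a)
      = 1 / Real.pi * (lapMom 0 t (b + z.1 * Complex.I)).re :=
    fun b hb => gauss_conv_poisson ht hb z.1
  have habs : ∀ b : ℝ, b ≠ 0 → ∀ a : ℝ, |linePoissonKernel b a| = linePoissonKernel |b| a := by
    intro b hb a
    rcases abs_cases b with ⟨h, h'⟩ | ⟨h, h'⟩
    · rw [h, abs_of_nonneg (linePoissonKernel_nonneg h' _)]
    · rw [h, linePoissonKernel_neg_left, abs_of_nonpos]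
      have := linePoissonKernel_nonneg (s := -b) (by linarith) a
      rw [linePoissonKernel_neg_left] at this
      linarith
  -- Taking absolute values replaces the height b by |b|; the integral in the first variable is then
  -- a bounded harmonic extension, and the Gaussian in b does the rest.
  have hFi : Integrable F (volume.prod volume) := by
    rw [integrable_prod_iff' hFm.aestronglyMeasurable]
    constructor
    · filter_upwards [show ∀ᵐ x : ℝ, x ≠ 0 by simp [ae_iff]] with b hb
      simp only [hF]
      have h1 := ((integrable_poisson_mul_gauss (t := t) (abs_pos.2 hb) z.1).mul_const
        (gauss t (z.2 - b))).const_mul (1 / 2)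
      refine h1.mono (hFm.comp measurable_prodMk_right).aestronglyMeasurable
        (Eventually.of_forall fun a => le_of_eq ?_)
      simp only [norm_mul, Real.norm_eq_abs, habs b hb,
        abs_of_nonneg (linePoissonKernel_nonneg (abs_nonneg b) a), abs_neg]
    · have h1 : Integrable (fun b : ℝ => 1 / 2 * (1 / Real.pi * lapBound 0 t 0) *
          gauss t (z.2 - b)) := ((integrable_gauss ht).comp_sub_left z.2).const_mul _
      refine Integrable.mono' h1 ?_ ?_
      · exact (hFm.norm.comp measurable_swap).stronglyMeasurable.integral_prod_right'
          |>.aestronglyMeasurable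
      · filter_upwards [show ∀ᵐ x : ℝ, x ≠ 0 by simp [ae_iff]] with b hb
        have h2 : ∀ a : ℝ, ‖F (a, b)‖ = 1 / 2 * gauss t (z.2 - b) *
            (linePoissonKernel |b| a * gauss t (z.1 - a)) := by
          intro a
          simp only [hF, norm_mul, Real.norm_eq_abs, habs b hb, abs_neg,
            abs_of_nonneg (gauss_nonneg _ _)]
          norm_num
          ring
        simp_rw [h2]
        rw [integral_const_mul, hinner _ (abs_pos.2 hb), Real.norm_eq_abs]
        have h3 := abs_re_lapMom_le 0 ht 0 z.1 (abs_nonneg b)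
        rw [zero_add] at h3
        have hpi := Real.pi_pos
        rw [abs_mul, abs_mul, abs_mul, abs_of_nonneg (gauss_nonneg _ _),
          abs_of_pos (by positivity : 0 < 1 / Real.pi), abs_of_pos (by norm_num : (0 : ℝ) < 1 / 2)]
        calc _ ≤ 1 / 2 * gauss t (z.2 - b) * (1 / Real.pi * lapBound 0 t 0) := by
              have := gauss_nonneg t (z.2 - b)
              gcongr
          _ = _ := by ring
  set g : ℝ → ℝ := fun b => ∫ a : ℝ, F (a, b) with hg
  have hgpos : ∀ b : ℝ, 0 < b → g b = -(1 / 2) * gauss t (z.2 - b) *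
      (1 / Real.pi * (lapMom 0 t (b + z.1 * Complex.I)).re) := by
    intro b hb
    rw [← hinner b hb, ← integral_const_mul]
    refine integral_congr_ae (Eventually.of_forall fun a => ?_)
    simp only [hF]
    ring
  have hgneg : ∀ b : ℝ, 0 < b → g (-b) = (1 / 2) * gauss t (z.2 + b) *
      (1 / Real.pi * (lapMom 0 t (b + z.1 * Complex.I)).re) := by
    intro b hb
    rw [← hinner b hb, ← integral_const_mul]
    refine integral_congr_ae (Eventually.of_forall fun a => ?_)
    simp only [hF, linePoissonKernel_neg_left, sub_neg_eq_add]
    ring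
  have hswap : ∫ w : ℝ × ℝ, F w = ∫ b : ℝ, g b := by
    rw [Measure.volume_eq_prod, integral_prod_symm _ hFi]
  -- Folding negative heights onto positive ones turns the oddness of the Poisson kernel into a
  -- difference of two Gauss kernels.
  rw [hgrad, hswap, integral_eq_integral_Ioi_add hFi.integral_prod_right, ← integral_const_mul]
  refine setIntegral_congr_fun measurableSet_Ioi fun b hb => ?_
  have hb' : (0 : ℝ) < b := hb
  change g b + g (-b) = _
  rw [hgpos b hb', hgneg b hb']
  have := Real.pi_ne_zero
  field_simp
  ring

lemma integrable_gauss_diff {t : ℝ} (ht : 0 < t) (x : ℝ) :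
    Integrable (fun w => gauss t (x + w) - gauss t (x - w)) :=
  ((integrable_gauss ht).comp_add_left x).sub ((integrable_gauss ht).comp_sub_left x)

/-- Since M_0' = -M_1, a derivative along the imaginary direction is -i M_1, whose real part is Im
M_1. -/
lemma hasDerivAt_re_lapMom_im {t : ℝ} (ht : 0 < t) (w r : ℝ) :
    HasDerivAt (fun r : ℝ => (lapMom 0 t (w + r * Complex.I)).re)
      (lapMom 1 t (w + r * Complex.I)).im r := by
  have h0 : HasDerivAt (fun r : ℂ => (w : ℂ) + r * Complex.I) (1 * Complex.I) (r : ℂ) :=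
    ((hasDerivAt_id (r : ℂ)).mul_const Complex.I).const_add _
  have h1 := (HasDerivAt.comp (r : ℂ) (hasDerivAt_lapMom 0 ht _) h0).real_of_complex
  simpa using h1

lemma norm_lapMom_im_le {t : ℝ} (ht : 0 < t) {w : ℝ} (hw : 0 ≤ w) (r : ℝ) :
    |(lapMom 1 t (w + r * Complex.I)).im| ≤ 7 / (t + r ^ 2) := by
  refine (Complex.abs_im_le_norm _).trans ((norm_lapMom_line_le ht hw r).trans ?_)
  gcongr
  nlinarith

lemma partial1_gradConv {t : ℝ} (ht : 0 < t) (z : ℝ × ℝ) :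
    partial1 (gradConv t) z = 1 / (2 * Real.pi) * ∫ w in Ioi (0 : ℝ),
      (lapMom 1 t (w + z.1 * Complex.I)).im * (gauss t (z.2 + w) - gauss t (z.2 - w)) := by
  unfold partial1
  have hδ := integrable_gauss_diff ht z.2
  have hc0 := continuous_lapMom 0 ht
  have hc1 := continuous_lapMom 1 ht
  have key := (hasDerivAt_integral_of_dominated_loc_of_deriv_le
    (μ := volume.restrict (Ioi (0 : ℝ))) (s := (univ : Set ℝ)) (x₀ := z.1)
    (F := fun (r w : ℝ) => (lapMom 0 t (w + r * Complex.I)).re * (gauss t (z.2 + w) - gauss t (z.2 - w)))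
    (F' := fun (r w : ℝ) => (lapMom 1 t (w + r * Complex.I)).im *
      (gauss t (z.2 + w) - gauss t (z.2 - w)))
    (bound := fun w => lapBound 1 t 0 * ‖gauss t (z.2 + w) - gauss t (z.2 - w)‖)
    univ_mem (Eventually.of_forall fun x => (by fun_prop)) ?_
    (by fun_prop) ?_ (hδ.norm.const_mul _).integrableOn ?_).2
  · simp_rw [gradConv_eq ht]
    exact (key.const_mul _).deriv
  · have := integrableOn_re_lapMom_mul 0 ht 0 z.1 hδ
    simp only [zero_add] at this
    exact this
  · filter_upwards [ae_restrict_mem measurableSet_Ioi] with w hw x _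
    rw [norm_mul]
    refine mul_le_mul_of_nonneg_right ?_ (norm_nonneg _)
    exact (Complex.abs_im_le_norm _).trans (norm_lapMom_le 1 ht (by simpa using le_of_lt hw))
  · refine Eventually.of_forall fun w x _ => (hasDerivAt_re_lapMom_im ht w x).mul_const _

lemma partial2_gradConv {t : ℝ} (ht : 0 < t) (z : ℝ × ℝ) :
    partial2 (gradConv t) z = -(gauss t z.1 * gauss t z.2) + 1 / (2 * Real.pi) *
      ∫ w in Ioi (0 : ℝ), (lapMom 1 t (w + z.1 * Complex.I)).re *
        (gauss t (z.2 + w) + gauss t (z.2 - w)) := by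
  unfold partial2
  have hz : ∀ n : ℕ, Continuous (fun w : ℝ => (lapMom n t (w + z.1 * Complex.I)).re) := fun n => by
    simpa using continuous_re_lapMom_line n ht 0 z.1
  have hbd : ∀ w : ℝ, 0 < w → |(lapMom 0 t (w + z.1 * Complex.I)).re| ≤ lapBound 0 t 0 :=
    fun w hw => by simpa using abs_re_lapMom_le 0 ht 0 z.1 hw.le
  have d1 := hasDerivAt_integral_mul_gauss ht (hz 0) hbd (σ := 1) (by norm_num) z.2
  have d2 := hasDerivAt_integral_mul_gauss ht (hz 0) hbd (σ := -1) (by norm_num) z.2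
  simp only [one_mul, neg_one_mul, ← sub_eq_add_neg] at d1 d2
  have i0 : ∀ n : ℕ, ∀ φ : ℝ → ℝ, Integrable φ →
      IntegrableOn (fun w : ℝ => (lapMom n t (w + z.1 * Complex.I)).re * φ w) (Ioi 0) :=
    fun n φ hφ => by simpa using integrableOn_re_lapMom_mul n ht 0 z.1 hφ
  have ga : Integrable fun w => gauss t (z.2 + w) := (integrable_gauss ht).comp_add_left z.2
  have gb : Integrable fun w => gauss t (z.2 - w) := (integrable_gauss ht).comp_sub_left z.2
  have ga' : Integrable fun w => gaussDeriv t (z.2 + w) :=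
    (integrable_gaussDeriv ht).comp_add_left z.2
  have gb' : Integrable fun w => gaussDeriv t (z.2 - w) :=
    (integrable_gaussDeriv ht).comp_sub_left z.2
  have hfun : (fun s : ℝ => gradConv t (z.1, s)) = fun s => 1 / (2 * Real.pi) *
      ((∫ w in Ioi (0 : ℝ), (lapMom 0 t (w + z.1 * Complex.I)).re * gauss t (s + w)) -
       ∫ w in Ioi (0 : ℝ), (lapMom 0 t (w + z.1 * Complex.I)).re * gauss t (s - w)) := by
    ext s
    rw [gradConv_eq ht, ← integral_sub (i0 0 _ ((integrable_gauss ht).comp_add_left s))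
      (i0 0 _ ((integrable_gauss ht).comp_sub_left s))]
    simp only [mul_sub]
  have hd := ((d1.sub d2).const_mul (1 / (2 * Real.pi))).deriv
  rw [hfun]
  refine hd.trans ?_
  -- The vertical derivative falls on the Gauss factors; integrating by parts in w moves it to M_0,
  -- and the boundary term is -Γ because π⁻¹ Re M_0(i z₁) is the Gauss kernel.
  have hparts := integral_Ioi_mul_deriv_eq_deriv_mul
      (u := fun w : ℝ => (lapMom 0 t (w + z.1 * Complex.I)).re)
      (v := fun w => gauss t (z.2 + w) + gauss t (z.2 - w))
      (u' := fun w : ℝ => -(lapMom 1 t (w + z.1 * Complex.I)).re)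
      (v' := fun w => gaussDeriv t (z.2 + w) + -gaussDeriv t (z.2 - w)) (a := 0)
      (a' := (lapMom 0 t (z.1 * Complex.I)).re * (gauss t z.2 + gauss t z.2)) (b' := 0)
      (fun w _ => hasDerivAt_re_lapMom_line 0 ht w z.1)
      (fun w _ => ((hasDerivAt_gauss t (z.2 + w)).comp_const_add z.2 w).add
        ((hasDerivAt_gauss t (z.2 - w)).comp_const_sub z.2 w))
      (i0 0 _ (ga'.add gb'.neg))
      ((i0 1 _ (ga.add gb)).neg.congr (Eventually.of_forall fun w => by simp))
      ?_ ?_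
  · rw [← integral_sub (i0 0 _ ga') (i0 0 _ gb')]
    have h1 : ∫ w in Ioi (0 : ℝ), ((lapMom 0 t (w + z.1 * Complex.I)).re * gaussDeriv t (z.2 + w) -
        (lapMom 0 t (w + z.1 * Complex.I)).re * gaussDeriv t (z.2 - w))
        = ∫ w in Ioi (0 : ℝ), (lapMom 0 t (w + z.1 * Complex.I)).re *
          (gaussDeriv t (z.2 + w) + -gaussDeriv t (z.2 - w)) :=
      integral_congr_ae (Eventually.of_forall fun w => by simp only; ring)
    rw [h1, hparts, gauss_eq_re_lapMom ht z.1]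
    simp only [neg_mul, integral_neg]
    have := Real.pi_ne_zero
    field_simp
    ring
  · have hcont : Continuous fun w : ℝ =>
        (lapMom 0 t (w + z.1 * Complex.I)).re * (gauss t (z.2 + w) + gauss t (z.2 - w)) :=
      (hz 0).mul (by fun_prop)
    have := (hcont.tendsto 0).mono_left (nhdsWithin_le_nhds (s := Ioi 0))
    simp only [add_zero, sub_zero, Complex.ofReal_zero, zero_add] at this
    exact this
  · refine squeeze_zero_norm' (a := fun w => lapBound 0 t 0 *
      (gauss t (z.2 + w) + gauss t (w - z.2))) ?_ ?_
    · filter_upwards [eventually_gt_atTop 0] with w hw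
      rw [Pi.mul_apply, norm_mul, ← gauss_neg t (w - z.2), neg_sub,
        Real.norm_of_nonneg (add_nonneg (gauss_nonneg _ _) (gauss_nonneg _ _))]
      exact mul_le_mul_of_nonneg_right (hbd w hw)
        (add_nonneg (gauss_nonneg _ _) (gauss_nonneg _ _))
    · have h1 := (tendsto_gauss_atTop ht).comp (tendsto_atTop_add_const_left _ z.2 tendsto_id)
      have h2 := (tendsto_gauss_atTop ht).comp (tendsto_atTop_add_const_right _ (-z.2) tendsto_id)
      have h3 := (h1.add h2).const_mul (lapBound 0 t 0)
      simp only [add_zero, mul_zero] at h3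
      exact h3

/-- The Hilbert transform of `∂₁ (∂₂E * Γ)` in the first variable. -/
lemma hasHilbertAt_partial1_gradConv {t : ℝ} (ht : 0 < t) (z : ℝ × ℝ) :
    HasHilbertAt (fun r : ℝ => partial1 (gradConv t) (r, z.2)) z.1
      (1 / (2 * Real.pi) * ∫ w in Ioi (0 : ℝ), (lapMom 1 t (w + z.1 * Complex.I)).re *
        (gauss t (z.2 + w) - gauss t (z.2 - w))) := by
  set δ : ℝ → ℝ := fun w => gauss t (z.2 + w) - gauss t (z.2 - w) with hδ
  have hδi : Integrable δ := integrable_gauss_diff ht z.2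
  have hδc : Continuous δ := by fun_prop
  have hZ := continuous_lapMom 1 ht
  have hQb : ∀ s : ℝ, 0 < s → ∀ x : ℝ, |lineConjPoissonKernel s x| ≤ (2 * Real.pi * s)⁻¹ := by
    intro s hs x
    have hpi := Real.pi_pos
    unfold lineConjPoissonKernel
    rw [abs_div, abs_of_pos (by positivity : 0 < Real.pi * (x ^ 2 + s ^ 2)), div_le_iff₀
      (by positivity), inv_mul_eq_div, le_div_iff₀ (by positivity)]
    have : 2 * (|x| * s) ≤ x ^ 2 + s ^ 2 := by
      rw [← sq_abs x]; nlinarith [sq_nonneg (|x| - s)]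
    nlinarith
  -- The bound 7 / (t + y²) on Im M_1 is uniform in w, so the product is controlled by separate
  -- integrable factors.
  have hprod : ∀ s : ℝ, 0 < s → Integrable (fun p : ℝ × ℝ =>
      lineConjPoissonKernel s (z.1 - p.1) * ((lapMom 1 t (p.2 + p.1 * Complex.I)).im * δ p.2))
      (volume.prod (volume.restrict (Ioi 0))) := by
    intro s hs
    have h1 : Integrable (fun p : ℝ × ℝ => ((2 * Real.pi * s)⁻¹ * (7 * (t + p.1 ^ 2)⁻¹)) * δ p.2)
        (volume.prod (volume.restrict (Ioi 0))) :=
      (((integrable_inv_add_sq ht).const_mul 7).const_mul _).mul_prod hδi.integrableOn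
    have hcQ := continuous_lineConjPoissonKernel hs
    refine Integrable.mono' h1.norm (by fun_prop) ?_
    have hmem : ∀ᵐ p ∂((volume : Measure ℝ).prod (volume.restrict (Ioi (0 : ℝ)))),
        p.2 ∈ Ioi (0 : ℝ) :=
      Measure.quasiMeasurePreserving_snd.ae (ae_restrict_mem measurableSet_Ioi)
    filter_upwards [hmem] with p hp
    have hpi := Real.pi_pos
    rw [norm_mul, norm_mul, norm_mul, ← mul_assoc]
    refine mul_le_mul_of_nonneg_right ?_ (norm_nonneg _)
    rw [Real.norm_of_nonneg (by positivity : 0 ≤ (2 * Real.pi * s)⁻¹ * (7 * (t + p.1 ^ 2)⁻¹)),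
      ← div_eq_mul_inv]
    exact mul_le_mul (hQb s hs _) (norm_lapMom_im_le ht (le_of_lt hp) _) (norm_nonneg _)
      (by positivity)
  have hval : ∀ s : ℝ, 0 < s →
      ∫ y : ℝ, lineConjPoissonKernel s (z.1 - y) * partial1 (gradConv t) (y, z.2)
        = 1 / (2 * Real.pi) * ∫ w in Ioi (0 : ℝ),
          (lapMom 1 t ((s + w : ℝ) + z.1 * Complex.I)).re * δ w := by
    intro s hs
    have h1 : ∀ y : ℝ, lineConjPoissonKernel s (z.1 - y) * partial1 (gradConv t) (y, z.2)
        = 1 / (2 * Real.pi) * ∫ w in Ioi (0 : ℝ),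
          lineConjPoissonKernel s (z.1 - y) * ((lapMom 1 t (w + y * Complex.I)).im * δ w) := by
      intro y
      rw [partial1_gradConv ht, integral_const_mul, mul_left_comm]
    simp_rw [h1]
    rw [integral_const_mul, integral_integral_swap (hprod s hs)]
    congr 1
    refine setIntegral_congr_fun measurableSet_Ioi fun w hw => ?_
    have hw' : (0 : ℝ) < w := hw
    simp_rw [← mul_assoc]
    rw [integral_mul_const]
    congr 1
    -- Imaginary parts: Q_s sends Im M_1 on the line of abscissa w to Re M_1 on the line of abscissa
    -- s + w.
    have h2 := conjPoisson_conv_lapMom ht hw'.le hs z.1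
    have h3 : Integrable (fun y : ℝ => (lineConjPoissonKernel s (z.1 - y) : ℂ) *
        lapMom 1 t (w + y * Complex.I)) := by
      refine (integrable_lapMom_line ht hw'.le).bdd_mul (c := (2 * Real.pi * s)⁻¹) ?_ ?_
      · have := continuous_lineConjPoissonKernel hs
        fun_prop
      · exact Eventually.of_forall fun y => by
          rw [Complex.norm_real]; exact hQb s hs _
    have h4 := congrArg Complex.im h2
    rw [← RCLike.im_eq_complex_im, ← integral_im h3] at h4
    simp only [RCLike.im_eq_complex_im, Complex.im_ofReal_mul, Complex.I_mul_im] at h4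
    exact h4
  refine ⟨fun s hs => ?_, ?_⟩
  · have h1 := (hprod s hs).integral_prod_left.const_mul (1 / (2 * Real.pi))
    refine h1.congr (Eventually.of_forall fun y => ?_)
    simp only [partial1_gradConv ht]
    rw [integral_const_mul, mul_left_comm]
  · have hlim : Tendsto (fun s : ℝ => 1 / (2 * Real.pi) * ∫ w in Ioi (0 : ℝ),
        (lapMom 1 t ((s + w : ℝ) + z.1 * Complex.I)).re * δ w) (𝓝[>] 0)
        (𝓝 (1 / (2 * Real.pi) * ∫ w in Ioi (0 : ℝ),
          (lapMom 1 t (w + z.1 * Complex.I)).re * δ w)) := by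
      refine Tendsto.const_mul _ (tendsto_integral_filter_of_dominated_convergence
        (fun w => lapBound 1 t 0 * ‖δ w‖) (Eventually.of_forall fun s => by fun_prop) ?_
        (hδi.norm.const_mul _).integrableOn ?_)
      · filter_upwards [self_mem_nhdsWithin] with s hs
        filter_upwards [ae_restrict_mem measurableSet_Ioi] with w hw
        rw [norm_mul]
        refine mul_le_mul_of_nonneg_right ?_ (norm_nonneg _)
        refine (Complex.abs_re_le_norm _).trans (norm_lapMom_le 1 ht ?_)
        have hs' : (0 : ℝ) < s := hs
        have hw' : (0 : ℝ) < w := hw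
        simp
        linarith
      · refine Eventually.of_forall fun w => Tendsto.mul_const _ ?_
        have hc : Continuous fun s : ℝ => (lapMom 1 t ((s + w : ℝ) + z.1 * Complex.I)).re := by
          fun_prop
        have := (hc.tendsto 0).mono_left (nhdsWithin_le_nhds (s := Ioi 0))
        simpa using this
    refine hlim.congr' ?_
    filter_upwards [self_mem_nhdsWithin] with s hs
    exact (hval s hs).symm

/-- The nonlocal part of the kernel: a Gauss kernel and a quadratically decaying remainder. -/
lemma nonlocalKernel_eq {t : ℝ} (ht : 0 < t) (z : ℝ × ℝ) :
    nonlocalKernel t z = heatKernel t z - lapConv (gauss t) t 0 z := by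
  unfold nonlocalKernel hilbert lapConv
  rw [(hasHilbertAt_partial1_gradConv ht z).2.limUnder_eq, partial2_gradConv ht,
    heatKernel_eq_gauss_mul ht]
  have i0 : ∀ φ : ℝ → ℝ, Integrable φ →
      IntegrableOn (fun w : ℝ => (lapMom 1 t (w + z.1 * Complex.I)).re * φ w) (Ioi 0) :=
    fun φ hφ => by simpa using integrableOn_re_lapMom_mul 1 ht 0 z.1 hφ
  have ga := i0 _ ((integrable_gauss ht).comp_add_left z.2)
  have gb := i0 _ ((integrable_gauss ht).comp_sub_left z.2)
  -- The integrals with g(z₂ + w) cancel between H∂₁ and ∂₂; those with g(z₂ - w) add up.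
  simp only [mul_sub, mul_add, zero_add]
  rw [integral_sub ga gb, integral_add ga gb]
  have := Real.pi_ne_zero
  field_simp
  ring

/-! ### The reflected kernel: decay, Poisson extension, heat flow -/

/-- The part of the kernel `W₀` that depends on `x - y*`. -/
def reflKernel (t : ℝ) (z : ℝ × ℝ) : ℝ := heatKernel t z - 2 * lapConv (gauss t) t 0 z

/-- The Poisson extension to height `s` of the nonlocal kernel in the tangential variable. -/
def poissonExt (t s : ℝ) (z : ℝ × ℝ) : ℝ :=
  1 / Real.pi * (lapMom 0 t (s + z.1 * Complex.I)).re * gauss t z.2 - lapConv (gauss t) t s z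

/-- The term -Γ at the reflected point and the 2Γ contained in the nonlocal part combine to +Γ. -/
lemma kernelW0_eq {t : ℝ} (ht : 0 < t) (x y : ℝ × ℝ) :
    kernelW0 t x y = heatKernel t (x - y) + reflKernel t (x - reflect y) := by
  unfold kernelW0 reflKernel
  rw [nonlocalKernel_eq ht]
  ring

lemma continuous_heatKernel (t : ℝ) : Continuous (heatKernel t) := by
  unfold heatKernel; fun_prop

lemma heatKernel_nonneg {t : ℝ} (ht : 0 < t) (z : ℝ × ℝ) : 0 ≤ heatKernel t z := by
  have := Real.pi_pos
  unfold heatKernel; positivity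

/-- The Gaussian is written as a square and each factor pays for one weight, whence 8² / (4π). The
extra factor t shows that the kernel vanishes off the origin as t ↓ 0. -/
lemma heatKernel_le {t : ℝ} (ht : 0 < t) (z : ℝ × ℝ) :
    heatKernel t z ≤ 16 / Real.pi * t * ((t + (z.1 ^ 2 + z.2 ^ 2))⁻¹) ^ 2 := by
  have hpi := Real.pi_pos
  set q := z.1 ^ 2 + z.2 ^ 2 with hq
  have hq0 : 0 ≤ q := by positivity
  have h1 := one_add_mul_exp_neg_le (m := 8) (by norm_num) (v := q / t) (by positivity)
  have h2 : t + q = t * (1 + q / t) := by field_simp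
  have h3 : Real.exp (-q / (4 * t)) = Real.exp (-(q / t / 8)) ^ 2 := by
    rw [← Real.exp_nat_mul]; congr 1; push_cast; field_simp; ring
  unfold heatKernel
  rw [← hq, h3, inv_pow, ← div_eq_mul_inv, le_div_iff₀ (by positivity), h2]
  calc 1 / (4 * Real.pi * t) * Real.exp (-(q / t / 8)) ^ 2 * (t * (1 + q / t)) ^ 2
      = t / (4 * Real.pi) * ((1 + q / t) * Real.exp (-(q / t / 8))) ^ 2 := by field_simp
    _ ≤ t / (4 * Real.pi) * 8 ^ 2 := by gcongr
    _ = _ := by field_simp; norm_num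

lemma heatKernel_le' {t : ℝ} (ht : 0 < t) (z : ℝ × ℝ) :
    heatKernel t z ≤ 16 / Real.pi * (t + (z.1 ^ 2 + z.2 ^ 2))⁻¹ := by
  refine (heatKernel_le ht z).trans ?_
  have hpi := Real.pi_pos
  rw [mul_assoc]
  refine mul_le_mul_of_nonneg_left ?_ (by positivity)
  have p : 0 < t + (z.1 ^ 2 + z.2 ^ 2) := by positivity
  rw [sq, ← mul_assoc]
  refine mul_le_of_le_one_left (by positivity) ?_
  rw [← div_eq_mul_inv, div_le_one p]
  nlinarith [sq_nonneg z.1, sq_nonneg z.2]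

/-- The reflected kernel decays quadratically, uniformly in time. -/
lemma abs_reflKernel_le {t : ℝ} (ht : 0 < t) (z : ℝ × ℝ) :
    |reflKernel t z| ≤ 352 / Real.pi * (t + (z.1 ^ 2 + z.2 ^ 2))⁻¹ := by
  unfold reflKernel
  have h1 := heatKernel_le' ht z
  have h2 := abs_lapConv_le ht (gauss_mul_le ht) le_rfl z
  have h3 := heatKernel_nonneg ht z
  have hpi := Real.pi_pos
  have h4 : 14 * (12 * t) / (Real.pi * t) = 168 / Real.pi := by field_simp; norm_num
  rw [h4] at h2
  have h5 : 352 / Real.pi * (t + (z.1 ^ 2 + z.2 ^ 2))⁻¹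
      = 16 / Real.pi * (t + (z.1 ^ 2 + z.2 ^ 2))⁻¹
        + 2 * (168 / Real.pi * (t + (z.1 ^ 2 + z.2 ^ 2))⁻¹) := by ring
  rw [abs_le] at h2 ⊢
  constructor <;> linarith [h2.1, h2.2]

lemma measurable_reflKernel {t : ℝ} (ht : 0 < t) : Measurable (reflKernel t) :=
  (continuous_heatKernel t).measurable.sub
    ((measurable_lapConv (continuous_gauss t) ht 0).const_mul 2)

lemma poissonExt_zero {t : ℝ} (ht : 0 < t) (z : ℝ × ℝ) :
    poissonExt t 0 z = heatKernel t z - lapConv (gauss t) t 0 z := by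
  unfold poissonExt
  rw [heatKernel_eq_gauss_mul ht, gauss_eq_re_lapMom ht z.1]
  simp

/-- The boundary term of `hasDerivAt_lapConv_shift` cancels the derivative of the Gaussian part.
What remains is, up to sign, the vertical derivative of `lapConv`: the nonlocal boundary condition
at the level of kernels. -/
lemma hasDerivAt_poissonExt {t : ℝ} (ht : 0 < t) (s : ℝ) (z : ℝ × ℝ) :
    HasDerivAt (fun s => poissonExt t s z) (-lapConv (gaussDeriv t) t s z) s := by
  have h1 := ((hasDerivAt_re_lapMom_line 0 ht s z.1).const_mul (1 / Real.pi)).mul_const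
    (gauss t z.2)
  refine (h1.sub (hasDerivAt_lapConv_shift ht s z)).congr_deriv ?_
  simp only [zero_add]
  ring

/-- After Fubini the kernel P_s acts on g_t and on M_1 separately, and both results are known. -/
lemma poisson_conv_poissonExt {t s : ℝ} (ht : 0 < t) (hs : 0 < s) (r b : ℝ) :
    ∫ y : ℝ, linePoissonKernel s (r - y) * poissonExt t 0 (y, b) = poissonExt t s (r, b) := by
  have hP : Integrable (fun y => linePoissonKernel s (r - y)) :=
    (integrable_linePoissonKernel hs).comp_sub_left r
  have hcP := continuous_linePoissonKernel hs
  have hZ := continuous_lapMom 1 ht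
  have hprod : Integrable (fun p : ℝ × ℝ => linePoissonKernel s (r - p.1) *
      ((lapMom 1 t ((0 + p.2 : ℝ) + p.1 * Complex.I)).re * gauss t (b - p.2)))
      (volume.prod (volume.restrict (Ioi 0))) := by
    have h1 : Integrable (fun p : ℝ × ℝ => linePoissonKernel s (r - p.1) *
        (lapBound 1 t 0 * gauss t (b - p.2))) (volume.prod (volume.restrict (Ioi 0))) :=
      hP.mul_prod (((integrable_gauss ht).comp_sub_left b).const_mul _).integrableOn
    refine Integrable.mono' h1 (by fun_prop) ?_
    have hmem : ∀ᵐ p ∂((volume : Measure ℝ).prod (volume.restrict (Ioi (0 : ℝ)))),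
        p.2 ∈ Ioi (0 : ℝ) :=
      Measure.quasiMeasurePreserving_snd.ae (ae_restrict_mem measurableSet_Ioi)
    filter_upwards [hmem] with p hp
    rw [norm_mul, norm_mul, Real.norm_of_nonneg (linePoissonKernel_nonneg hs.le _),
      Real.norm_of_nonneg (gauss_nonneg _ _)]
    refine mul_le_mul_of_nonneg_left ?_ (linePoissonKernel_nonneg hs.le _)
    exact mul_le_mul_of_nonneg_right (abs_re_lapMom_le 1 ht 0 _ (le_of_lt hp)) (gauss_nonneg _ _)
  have hlap : Integrable (fun y : ℝ => linePoissonKernel s (r - y) *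
      lapConv (gauss t) t 0 (y, b)) := by
    refine (hprod.integral_prod_left.const_mul (1 / Real.pi)).congr
      (Eventually.of_forall fun y => ?_)
    simp only [lapConv]
    rw [integral_const_mul, mul_left_comm]
  have hlapval : ∫ y : ℝ, linePoissonKernel s (r - y) * lapConv (gauss t) t 0 (y, b)
      = lapConv (gauss t) t s (r, b) := by
    have h1 : ∀ y : ℝ, linePoissonKernel s (r - y) * lapConv (gauss t) t 0 (y, b)
        = 1 / Real.pi * ∫ w in Ioi (0 : ℝ), linePoissonKernel s (r - y) *
          ((lapMom 1 t ((0 + w : ℝ) + y * Complex.I)).re * gauss t (b - w)) := by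
      intro y
      rw [integral_const_mul, mul_left_comm]
      rfl
    simp_rw [h1]
    rw [integral_const_mul, integral_integral_swap hprod]
    unfold lapConv
    congr 1
    refine setIntegral_congr_fun measurableSet_Ioi fun w hw => ?_
    have hw' : (0 : ℝ) < w := hw
    simp_rw [← mul_assoc]
    rw [integral_mul_const]
    congr 1
    have h2 := poisson_conv_lapMom ht hw'.le hs r
    have h3 : Integrable (fun y : ℝ => (linePoissonKernel s (r - y) : ℂ) *
        lapMom 1 t (w + y * Complex.I)) := by
      refine hP.ofReal.mul_bdd (c := lapBound 1 t 0) (by fun_prop)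
        (Eventually.of_forall fun y => norm_lapMom_le 1 ht (by simpa using hw'.le))
    have h4 := congrArg Complex.re h2
    rw [← RCLike.re_eq_complex_re, ← integral_re h3] at h4
    simp only [RCLike.re_eq_complex_re, Complex.re_ofReal_mul] at h4
    simpa using h4
  have hg : Integrable (fun y : ℝ => linePoissonKernel s (r - y) * heatKernel t (y, b)) := by
    simp_rw [heatKernel_eq_gauss_mul ht, ← mul_assoc]
    refine Integrable.mul_const ?_ _
    refine hP.mul_bdd (c := (√(4 * Real.pi * t))⁻¹) (by fun_prop)
      (Eventually.of_forall fun y => ?_)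
    rw [Real.norm_of_nonneg (gauss_nonneg _ _)]
    exact gauss_le_sqrt_inv ht _
  simp_rw [poissonExt_zero ht, mul_sub]
  rw [integral_sub hg hlap, hlapval]
  unfold poissonExt
  congr 1
  simp_rw [heatKernel_eq_gauss_mul ht, ← mul_assoc]
  rw [integral_mul_const, poisson_conv_gauss ht hs]

lemma integrable_heatKernel {t : ℝ} (ht : 0 < t) : Integrable (heatKernel t) := by
  have h : Integrable (fun z : ℝ × ℝ => gauss t z.1 * gauss t z.2) :=
    (integrable_gauss ht).mul_prod (integrable_gauss ht)
  exact h.congr (Eventually.of_forall fun z => (heatKernel_eq_gauss_mul ht z).symm)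

lemma integral_heatKernel {t : ℝ} (ht : 0 < t) : ∫ z, heatKernel t z = 1 := by
  simp_rw [heatKernel_eq_gauss_mul ht]
  rw [Measure.volume_eq_prod, integral_prod_mul, integral_gauss ht, mul_one]

lemma heatKernel_conv_heatKernel {t τ : ℝ} (ht : 0 < t) (hτ : 0 < τ) (z : ℝ × ℝ) :
    ∫ y : ℝ × ℝ, heatKernel τ (z - y) * heatKernel t y = heatKernel (t + τ) z := by
  have h1 : ∀ y : ℝ × ℝ, heatKernel τ (z - y) * heatKernel t y
      = (gauss τ (z.1 - y.1) * gauss t y.1) * (gauss τ (z.2 - y.2) * gauss t y.2) := by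
    intro y
    rw [heatKernel_eq_gauss_mul hτ, heatKernel_eq_gauss_mul ht]
    simp only [Prod.fst_sub, Prod.snd_sub]
    ring
  simp_rw [h1]
  rw [Measure.volume_eq_prod, integral_prod_mul (fun a => gauss τ (z.1 - a) * gauss t a)
    (fun a => gauss τ (z.2 - a) * gauss t a), gauss_conv_gauss ht hτ, gauss_conv_gauss ht hτ,
    heatKernel_eq_gauss_mul (by positivity)]

/-- The plane Gaussian factorises: its tangential factor moves the time of M_1, its vertical factor
the time of the Gauss kernel, and both become t + τ. -/
lemma heatKernel_conv_lapConv {t τ : ℝ} (ht : 0 < t) (hτ : 0 < τ) (z : ℝ × ℝ) :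
    Integrable (fun y : ℝ × ℝ => heatKernel τ (z - y) * lapConv (gauss t) t 0 y) ∧
    ∫ y : ℝ × ℝ, heatKernel τ (z - y) * lapConv (gauss t) t 0 y
      = lapConv (gauss (t + τ)) (t + τ) 0 z := by
  have hZ := continuous_lapMom 1 ht
  have hH := continuous_heatKernel τ
  set G : (ℝ × ℝ) × ℝ → ℝ := fun p => heatKernel τ (z - p.1) *
      ((lapMom 1 t ((0 + p.2 : ℝ) + p.1.1 * Complex.I)).re * gauss t (p.1.2 - p.2)) with hG
  have hGc : Continuous G := by fun_prop
  have hHi : Integrable (fun y => heatKernel τ (z - y)) := (integrable_heatKernel hτ).comp_sub_left z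
  have hprod : Integrable G (volume.prod (volume.restrict (Ioi 0))) := by
    rw [integrable_prod_iff hGc.aestronglyMeasurable]
    have hslice : ∀ y : ℝ × ℝ, IntegrableOn (fun w => G (y, w)) (Ioi 0) := fun y => by
      exact Integrable.const_mul (integrableOn_re_lapMom_mul 1 ht 0 y.1
        ((integrable_gauss ht).comp_sub_left y.2)) (heatKernel τ (z - y))
    refine ⟨Eventually.of_forall hslice, ?_⟩
    refine Integrable.mono' (hHi.mul_const (lapBound 1 t 0)) ?_ (Eventually.of_forall fun y => ?_)
    · exact hGc.norm.stronglyMeasurable.integral_prod_right'.aestronglyMeasurable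
    · have hi : Integrable (fun w => heatKernel τ (z - y) * (lapBound 1 t 0 * gauss t (y.2 - w))) :=
        (((integrable_gauss ht).comp_sub_left y.2).const_mul _).const_mul _
      have hb0 : 0 ≤ lapBound 1 t 0 := (abs_nonneg _).trans (abs_re_lapMom_le 1 ht 0 0 le_rfl)
      have hH0 := heatKernel_nonneg hτ (z - y)
      rw [Real.norm_of_nonneg (integral_nonneg fun _ => norm_nonneg _)]
      calc ∫ w in Ioi (0 : ℝ), ‖G (y, w)‖
          ≤ ∫ w in Ioi (0 : ℝ), heatKernel τ (z - y) * (lapBound 1 t 0 * gauss t (y.2 - w)) := by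
            refine setIntegral_mono_on (hslice y).norm hi.integrableOn measurableSet_Ioi
              fun w hw => ?_
            simp only [hG]
            rw [norm_mul, norm_mul, Real.norm_of_nonneg hH0, Real.norm_of_nonneg (gauss_nonneg _ _)]
            refine mul_le_mul_of_nonneg_left ?_ hH0
            exact mul_le_mul_of_nonneg_right (abs_re_lapMom_le 1 ht 0 _ (le_of_lt hw))
              (gauss_nonneg _ _)
        _ ≤ ∫ w, heatKernel τ (z - y) * (lapBound 1 t 0 * gauss t (y.2 - w)) := by
            refine setIntegral_le_integral hi (Eventually.of_forall fun w => ?_)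
            have := gauss_nonneg t (y.2 - w)
            simp only [Pi.zero_apply]
            positivity
        _ = heatKernel τ (z - y) * lapBound 1 t 0 := by
            rw [integral_const_mul, integral_const_mul,
              integral_sub_left_eq_self (gauss t) volume y.2, integral_gauss ht, mul_one]
  have hy : ∀ y : ℝ × ℝ, heatKernel τ (z - y) * lapConv (gauss t) t 0 y
      = 1 / Real.pi * ∫ w in Ioi (0 : ℝ), G (y, w) := by
    intro y
    simp only [hG]
    rw [integral_const_mul, mul_left_comm]
    rfl
  simp_rw [hy]
  refine ⟨hprod.integral_prod_left.const_mul _, ?_⟩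
  rw [integral_const_mul, integral_integral_swap hprod]
  unfold lapConv
  congr 1
  refine setIntegral_congr_fun measurableSet_Ioi fun w hw => ?_
  have hw' : (0 : ℝ) < w := hw
  have h1 : ∀ y : ℝ × ℝ, G (y, w)
      = (gauss τ (z.1 - y.1) * (lapMom 1 t (w + y.1 * Complex.I)).re) *
        (gauss τ (z.2 - y.2) * gauss t (y.2 - w)) := by
    intro y
    simp only [hG]
    rw [heatKernel_eq_gauss_mul hτ]
    simp only [Prod.fst_sub, Prod.snd_sub, zero_add]
    ring
  simp_rw [h1]
  rw [Measure.volume_eq_prod, integral_prod_mul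
    (fun a : ℝ => gauss τ (z.1 - a) * (lapMom 1 t (w + a * Complex.I)).re)
    (fun a : ℝ => gauss τ (z.2 - a) * gauss t (a - w))]
  congr 1
  · have h2 := congrArg Complex.re (gauss_conv_lapMom 1 ht hτ w z.1)
    have h3 : Integrable (fun y : ℝ => (gauss τ (z.1 - y) : ℂ) *
        lapMom 1 t (w + y * Complex.I)) :=
      ((integrable_gauss hτ).comp_sub_left z.1).ofReal.mul_bdd (c := lapBound 1 t 0) (by fun_prop)
        (Eventually.of_forall fun y => norm_lapMom_le 1 ht (by simpa using hw'.le))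
    rw [← RCLike.re_eq_complex_re, ← integral_re h3] at h2
    simp only [RCLike.re_eq_complex_re, Complex.re_ofReal_mul] at h2
    simpa using h2
  · have h2 := gauss_conv_gauss ht hτ (z.2 - w)
    rw [← h2, ← integral_sub_right_eq_self (fun y => gauss τ (z.2 - w - y) * gauss t y) w]
    refine integral_congr_ae (Eventually.of_forall fun a => ?_)
    simp only
    congr 2
    ring

/-- The heat semigroup acts on the reflected kernel by a shift of the time. -/
lemma heatKernel_conv_reflKernel {t τ : ℝ} (ht : 0 < t) (hτ : 0 < τ) (z : ℝ × ℝ) :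
    ∫ y : ℝ × ℝ, heatKernel τ (z - y) * reflKernel t y = reflKernel (t + τ) z := by
  have hHi : Integrable (fun y => heatKernel τ (z - y)) := (integrable_heatKernel hτ).comp_sub_left z
  have h1 : Integrable (fun y => heatKernel τ (z - y) * heatKernel t y) := by
    refine hHi.mul_bdd (c := 16 / Real.pi * t⁻¹)
      (continuous_heatKernel t).aestronglyMeasurable (Eventually.of_forall fun y => ?_)
    rw [Real.norm_of_nonneg (heatKernel_nonneg ht _)]
    refine (heatKernel_le' ht y).trans ?_
    have := Real.pi_pos
    gcongr
    nlinarith [sq_nonneg y.1, sq_nonneg y.2]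
  obtain ⟨h2, h3⟩ := heatKernel_conv_lapConv ht hτ z
  unfold reflKernel
  simp_rw [mul_sub, mul_left_comm _ (2 : ℝ)]
  rw [integral_sub h1 (h2.const_mul 2), integral_const_mul, h3, heatKernel_conv_heatKernel ht hτ]

/-! ### The reflected kernel at small times -/

lemma integrableOn_mul_exp_neg_mul {c : ℝ} (hc : 0 < c) :
    IntegrableOn (fun k : ℝ => k * Real.exp (-c * k)) (Ioi 0) := by
  have h := integrableOn_rpow_mul_exp_neg_mul_rpow (p := 1) (s := 1) (b := c)
    (by norm_num) one_pos hc
  refine h.congr_fun (fun k _ => ?_) measurableSet_Ioi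
  simp

lemma tendsto_mul_exp_neg_mul {c : ℝ} (hc : 0 < c) :
    Tendsto (fun k : ℝ => k * Real.exp (-c * k)) atTop (𝓝 0) := by
  have h := ((Real.tendsto_pow_mul_exp_neg_atTop_nhds_zero 1).comp
    (tendsto_id.const_mul_atTop hc)).const_mul c⁻¹
  rw [mul_zero] at h
  refine h.congr fun k => ?_
  simp only [Function.comp_apply, id, pow_one, neg_mul]
  field_simp

lemma integral_mul_exp_neg_mul_Ioi {ζ : ℂ} (hζ : 0 < ζ.re) :
    ∫ k in Ioi (0 : ℝ), (k : ℂ) * Complex.exp (-ζ * k) = (ζ ^ 2)⁻¹ := by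
  have hζ0 : ζ ≠ 0 := by rintro rfl; simp at hζ
  have hn : ∀ k : ℝ, ‖Complex.exp (-ζ * k)‖ = Real.exp (-ζ.re * k) := fun k => by
    rw [Complex.norm_exp]; simp
  have hi : IntegrableOn (fun k : ℝ => (k : ℂ) * Complex.exp (-ζ * k)) (Ioi 0) := by
    refine Integrable.mono (integrableOn_mul_exp_neg_mul hζ) (by fun_prop)
      (Eventually.of_forall fun k => ?_)
    rw [norm_mul, norm_mul, hn, Complex.norm_real, Real.norm_of_nonneg (Real.exp_pos _).le]
  have hd : ∀ k ∈ Ici (0 : ℝ), HasDerivAt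
      (fun k : ℝ => -((ζ⁻¹ * k + (ζ ^ 2)⁻¹) * Complex.exp (-ζ * k)))
      ((k : ℂ) * Complex.exp (-ζ * k)) k := by
    intro k _
    have h0 : HasDerivAt (fun k : ℝ => (k : ℂ)) 1 k := Complex.ofRealCLM.hasDerivAt
    refine ((((h0.const_mul ζ⁻¹).add_const _).mul (h0.const_mul (-ζ)).cexp).neg).congr_deriv ?_
    field_simp
    ring
  have hl : Tendsto (fun k : ℝ => -((ζ⁻¹ * k + (ζ ^ 2)⁻¹) * Complex.exp (-ζ * k))) atTop (𝓝 0) := by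
    have h1 : Tendsto (fun k : ℝ => Real.exp (-ζ.re * k)) atTop (𝓝 0) :=
      Real.tendsto_exp_atBot.comp (tendsto_id.const_mul_atTop_of_neg (by linarith))
    have h2 := ((tendsto_mul_exp_neg_mul hζ).const_mul ‖ζ⁻¹‖).add (h1.const_mul ‖(ζ ^ 2)⁻¹‖)
    simp only [mul_zero, add_zero] at h2
    refine squeeze_zero_norm' ?_ h2
    filter_upwards [eventually_ge_atTop (0 : ℝ)] with k hk
    rw [norm_neg, norm_mul, hn, ← mul_assoc, ← add_mul]
    refine mul_le_mul_of_nonneg_right ((norm_add_le _ _).trans (le_of_eq ?_)) (Real.exp_pos _).le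
    rw [norm_mul, Complex.norm_real, Real.norm_of_nonneg hk]
  rw [integral_Ioi_of_hasDerivAt_of_tendsto' hd hi hl]
  simp

/-- The first Laplace moment at small times. -/
lemma tendsto_lapMom_one {ζ : ℝ → ℂ} {ζ₀ : ℂ} (h₀ : 0 < ζ₀.re)
    (hζ : Tendsto ζ (𝓝[>] 0) (𝓝 ζ₀)) :
    Tendsto (fun t => lapMom 1 t (ζ t)) (𝓝[>] 0) (𝓝 ((ζ₀ ^ 2)⁻¹)) := by
  rw [← integral_mul_exp_neg_mul_Ioi h₀]
  unfold lapMom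
  -- Keeping the real part above half its limit gives one integrable majorant for all small t.
  have hre : ∀ᶠ t in 𝓝[>] (0 : ℝ), ζ₀.re / 2 < (ζ t).re :=
    ((Complex.continuous_re.tendsto ζ₀).comp hζ).eventually (lt_mem_nhds (by simpa using h₀))
  have hbi := integrableOn_mul_exp_neg_mul (c := ζ₀.re / 2) (by positivity)
  refine tendsto_integral_filter_of_dominated_convergence
    (fun k : ℝ => k * Real.exp (-(ζ₀.re / 2) * k)) (Eventually.of_forall fun t => by fun_prop)
    ?_ hbi ?_
  · filter_upwards [hre, self_mem_nhdsWithin] with t ht ht0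
    filter_upwards [ae_restrict_mem measurableSet_Ioi] with k hk
    have hk' : (0 : ℝ) < k := hk
    have ht' : (0 : ℝ) < t := ht0
    rw [norm_lapMom_integrand 1 t (ζ t) hk', pow_one]
    gcongr
    nlinarith [mul_pos ht' (pow_pos hk' 2)]
  · refine Eventually.of_forall fun k => ?_
    have ht : Tendsto (fun t : ℝ => (t : ℂ)) (𝓝[>] 0) (𝓝 0) := by
      have := (Complex.continuous_ofReal.tendsto 0).mono_left (nhdsWithin_le_nhds (s := Ioi 0))
      simpa using this
    have h1 := ((hζ.neg.mul_const (k : ℂ)).sub (ht.mul_const ((k : ℂ) ^ 2))).cexp.const_mul (k : ℂ)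
    simpa using h1

lemma gauss_scale {t : ℝ} (ht : 0 < t) (u : ℝ) : √t * gauss t (√t * u) = gauss 1 u := by
  unfold gauss
  have h : 0 < √t := Real.sqrt_pos.2 ht
  rw [mul_pow, Real.sq_sqrt ht.le, Real.sqrt_mul (by positivity), mul_inv, mul_one]
  have h2 : -(t * u ^ 2) / (4 * t) = -u ^ 2 / (4 * 1) := by field_simp
  rw [h2]
  field_simp

lemma tendsto_sqrt_nhdsWithin : Tendsto (fun t : ℝ => √t) (𝓝[>] 0) (𝓝 0) := by
  have := (Real.continuous_sqrt.tendsto 0).mono_left (nhdsWithin_le_nhds (s := Ioi 0))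
  simpa using this

/-- The reflected kernel converges pointwise to twice the normal derivative of the Poisson
kernel. -/
lemma tendsto_reflKernel {z : ℝ × ℝ} (h1 : z.1 ≠ 0) (h2 : 0 < z.2) :
    Tendsto (fun t => reflKernel t z) (𝓝[>] 0)
      (𝓝 (-(2 / Real.pi) * ((((z.2 : ℂ) + z.1 * Complex.I) ^ 2)⁻¹).re)) := by
  have hheat : Tendsto (fun t => heatKernel t z) (𝓝[>] 0) (𝓝 0) := by
    have hc : ContinuousAt (fun t : ℝ => 16 / Real.pi * t * ((t + (z.1 ^ 2 + z.2 ^ 2))⁻¹) ^ 2) 0 := by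
      refine ContinuousAt.mul (by fun_prop) (ContinuousAt.pow (ContinuousAt.inv₀ (by fun_prop) ?_) 2)
      positivity
    have h3 := hc.tendsto.mono_left (nhdsWithin_le_nhds (s := Ioi 0))
    simp only [mul_zero, zero_mul] at h3
    refine squeeze_zero' ?_ ?_ h3
    · filter_upwards [self_mem_nhdsWithin] with t ht using heatKernel_nonneg ht z
    · filter_upwards [self_mem_nhdsWithin] with t ht using heatKernel_le ht z
  -- Extending by zero to w ≤ 0 allows the substitution w = z₂ - √t u, which replaces g_t by the
  -- fixed Gaussian g_1.
  set f : ℝ → ℝ → ℝ := fun t w =>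
    (Ioi (0 : ℝ)).indicator (fun w : ℝ => (lapMom 1 t (w + z.1 * Complex.I)).re) w with hf
  have hscale : ∀ t : ℝ, 0 < t → lapConv (gauss t) t 0 z
      = 1 / Real.pi * ∫ u : ℝ, f t (z.2 - √t * u) * gauss 1 u := by
    intro t ht
    have hs : 0 < √t := Real.sqrt_pos.2 ht
    unfold lapConv
    congr 1
    rw [← integral_indicator measurableSet_Ioi]
    have h4 : (Ioi (0 : ℝ)).indicator (fun w : ℝ =>
        (lapMom 1 t ((0 + w : ℝ) + z.1 * Complex.I)).re * gauss t (z.2 - w))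
        = fun w => f t w * gauss t (z.2 - w) := by
      ext w
      by_cases hw : w ∈ Ioi (0 : ℝ)
      · simp [hf, indicator_of_mem hw]
      · simp [hf, indicator_of_notMem hw]
    rw [h4, ← integral_sub_left_eq_self _ volume z.2]
    have h5 := Measure.integral_comp_mul_left
      (fun v => f t (z.2 - v) * gauss t (z.2 - (z.2 - v))) (√t)
    rw [abs_of_pos (by positivity), smul_eq_mul, eq_inv_mul_iff_mul_eq₀ hs.ne'] at h5
    rw [← h5, ← integral_const_mul]
    refine integral_congr_ae (Eventually.of_forall fun u => ?_)
    simp only [sub_sub_cancel]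
    rw [mul_left_comm, gauss_scale ht]
  have hlim : Tendsto (fun t => ∫ u : ℝ, f t (z.2 - √t * u) * gauss 1 u) (𝓝[>] 0)
      (𝓝 (∫ u : ℝ, ((((z.2 : ℂ) + z.1 * Complex.I) ^ 2)⁻¹).re * gauss 1 u)) := by
    -- The majorant 7 / z₁² is where z₁ ≠ 0 is used; it must hold also where w is close to 0.
    refine tendsto_integral_filter_of_dominated_convergence
      (fun u => 7 / z.1 ^ 2 * gauss 1 u) ?_ ?_ ((integrable_gauss one_pos).const_mul _) ?_
    · filter_upwards [self_mem_nhdsWithin] with t ht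
      have ht' : (0 : ℝ) < t := ht
      have hZ := continuous_lapMom 1 ht'
      have hm : Measurable (f t) := by
        refine Measurable.indicator (Continuous.measurable ?_) measurableSet_Ioi
        fun_prop
      exact ((hm.comp (by fun_prop : Measurable fun u : ℝ => z.2 - √t * u)).mul
        (continuous_gauss 1).measurable).aestronglyMeasurable
    · filter_upwards [self_mem_nhdsWithin] with t ht
      have ht' : (0 : ℝ) < t := ht
      refine Eventually.of_forall fun u => ?_
      rw [norm_mul, Real.norm_of_nonneg (gauss_nonneg 1 u)]
      refine mul_le_mul_of_nonneg_right ?_ (gauss_nonneg 1 u)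
      by_cases hw : z.2 - √t * u ∈ Ioi (0 : ℝ)
      · simp only [hf, indicator_of_mem hw]
        refine (Complex.abs_re_le_norm _).trans ((norm_lapMom_line_le ht' (le_of_lt hw) z.1).trans ?_)
        gcongr
        nlinarith [sq_nonneg (z.2 - √t * u)]
      · simp only [hf, indicator_of_notMem hw, norm_zero]
        positivity
    · refine Eventually.of_forall fun u => Tendsto.mul_const _ ?_
      have hw : Tendsto (fun t : ℝ => z.2 - √t * u) (𝓝[>] 0) (𝓝 z.2) := by
        have := (tendsto_sqrt_nhdsWithin.mul_const u).const_sub z.2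
        simpa using this
      have hζ : Tendsto (fun t : ℝ => ((z.2 - √t * u : ℝ) : ℂ) + z.1 * Complex.I) (𝓝[>] 0)
          (𝓝 ((z.2 : ℂ) + z.1 * Complex.I)) :=
        ((Complex.continuous_ofReal.tendsto _).comp hw).add_const _
      have h6 := (Complex.continuous_re.tendsto _).comp
        (tendsto_lapMom_one (by simpa using h2) hζ)
      refine h6.congr' ?_
      filter_upwards [hw.eventually (lt_mem_nhds h2)] with t ht
      simp only [hf, Function.comp_apply]
      rw [indicator_of_mem (show z.2 - √t * u ∈ Ioi (0 : ℝ) from ht)]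
  rw [integral_const_mul, integral_gauss one_pos, mul_one] at hlim
  have h7 := hheat.sub ((hlim.const_mul (1 / Real.pi)).const_mul 2)
  refine (h7.congr' ?_).trans (le_of_eq ?_)
  · filter_upwards [self_mem_nhdsWithin] with t ht
    rw [reflKernel, hscale t ht]
  · congr 1
    ring

/-! ### Integral operators on Lebesgue spaces -/

section Lebesgue

variable {α β : Type*} [MeasurableSpace β] {ν : Measure β} [MeasurableSpace α] {μ : Measure α}

/-- **Schur's test** with weights. -/
lemma lintegral_schur [SFinite μ] [SFinite ν] {p p' : ℝ} (hpp : p.HolderConjugate p')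
    {K : α → β → ℝ≥0∞} (hK : Measurable (Function.uncurry K))
    {u : β → ℝ≥0∞} (hu : Measurable u) (hu0 : ∀ᵐ y ∂ν, u y ≠ 0) (hut : ∀ᵐ y ∂ν, u y ≠ ∞)
    {v : α → ℝ≥0∞} (hv : Measurable v) {A B : ℝ≥0∞}
    (h1 : ∀ᵐ x ∂μ, ∫⁻ y, K x y * u y ^ p' ∂ν ≤ A * v x ^ p')
    (h2 : ∀ᵐ y ∂ν, ∫⁻ x, K x y * v x ^ p ∂μ ≤ B * u y ^ p)
    {f : β → ℝ≥0∞} (hf : AEMeasurable f ν) :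
    ∫⁻ x, (∫⁻ y, K x y * f y ∂ν) ^ p ∂μ ≤ A ^ (p / p') * B * ∫⁻ y, f y ^ p ∂ν := by
  have hp := hpp.pos
  have hp' := hpp.symm.pos
  have hKx : ∀ x, Measurable (K x) := fun x => hK.comp measurable_prodMk_left
  -- Hölder is applied to K^{1/p} (f/u) and K^{1/p'} u; the second factor is controlled by the first
  -- weight condition, the first after Tonelli by the second condition.
  set g : β → ℝ≥0∞ := fun y => f y / u y with hg
  have hgm : AEMeasurable g ν := hf.div hu.aemeasurable
  have hpt : ∀ᵐ x ∂μ, (∫⁻ y, K x y * f y ∂ν) ^ p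
      ≤ A ^ (p / p') * ∫⁻ y, v x ^ p * (K x y * g y ^ p) ∂ν := by
    filter_upwards [h1] with x hx
    have hsplit : ∫⁻ y, K x y * f y ∂ν
        = ∫⁻ y, ((fun y => K x y ^ (1 / p) * g y) * (fun y => K x y ^ (1 / p') * u y)) y ∂ν := by
      refine lintegral_congr_ae ?_
      filter_upwards [hu0, hut] with y hy0 hyt
      simp only [Pi.mul_apply, hg]
      have e1 : K x y ^ (1 / p) * K x y ^ (1 / p') = K x y := by
        rw [← ENNReal.rpow_add_of_nonneg _ _ (by positivity) (by positivity), one_div, one_div,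
          hpp.inv_add_inv_eq_one, ENNReal.rpow_one]
      calc K x y * f y = (K x y ^ (1 / p) * K x y ^ (1 / p')) * (f y / u y * u y) := by
            rw [e1, ENNReal.div_mul_cancel hy0 hyt]
        _ = _ := by ring
    have hH := ENNReal.lintegral_mul_le_Lp_mul_Lq ν hpp
      (f := fun y => K x y ^ (1 / p) * g y) (g := fun y => K x y ^ (1 / p') * u y)
      (((hKx x).pow_const _).aemeasurable.mul hgm)
      (((hKx x).pow_const _).aemeasurable.mul hu.aemeasurable)
    rw [← hsplit] at hH
    have e2 : ∀ y, (K x y ^ (1 / p) * g y) ^ p = K x y * g y ^ p := fun y => by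
      rw [ENNReal.mul_rpow_of_nonneg _ _ hp.le, ← ENNReal.rpow_mul, one_div,
        inv_mul_cancel₀ hp.ne', ENNReal.rpow_one]
    have e3 : ∀ y, (K x y ^ (1 / p') * u y) ^ p' = K x y * u y ^ p' := fun y => by
      rw [ENNReal.mul_rpow_of_nonneg _ _ hp'.le, ← ENNReal.rpow_mul, one_div,
        inv_mul_cancel₀ hp'.ne', ENNReal.rpow_one]
    simp_rw [e2, e3] at hH
    calc (∫⁻ y, K x y * f y ∂ν) ^ p
        ≤ ((∫⁻ y, K x y * g y ^ p ∂ν) ^ (1 / p) * (A * v x ^ p') ^ (1 / p')) ^ p := by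
          gcongr
          exact hH.trans (by gcongr)
      _ = A ^ (p / p') * (v x ^ p * ∫⁻ y, K x y * g y ^ p ∂ν) := by
          rw [ENNReal.mul_rpow_of_nonneg _ _ hp.le, ← ENNReal.rpow_mul, one_div,
            inv_mul_cancel₀ hp.ne', ENNReal.rpow_one, ← ENNReal.rpow_mul,
            ENNReal.mul_rpow_of_nonneg _ _ (by positivity), ← ENNReal.rpow_mul]
          have e4 : p' * (1 / p' * p) = p := by field_simp
          have e5 : 1 / p' * p = p / p' := by ring
          rw [e4, e5]
          ring
      _ = _ := by
          have hm : AEMeasurable (fun y => K x y * g y ^ p) ν :=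
            (hKx x).aemeasurable.mul (hgm.pow_const p)
          rw [lintegral_const_mul'' _ hm]
  have hm : AEMeasurable (Function.uncurry fun x y => v x ^ p * (K x y * g y ^ p)) (μ.prod ν) :=
    ((hv.pow_const p).comp measurable_fst).aemeasurable.mul
      (hK.aemeasurable.mul (hgm.pow_const p).comp_snd)
  calc ∫⁻ x, (∫⁻ y, K x y * f y ∂ν) ^ p ∂μ
      ≤ ∫⁻ x, A ^ (p / p') * ∫⁻ y, v x ^ p * (K x y * g y ^ p) ∂ν ∂μ := lintegral_mono_ae hpt
    _ = A ^ (p / p') * ∫⁻ y, ∫⁻ x, v x ^ p * (K x y * g y ^ p) ∂μ ∂ν := by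
        have hm' : AEMeasurable (fun x => ∫⁻ y, v x ^ p * (K x y * g y ^ p) ∂ν) μ :=
          hm.lintegral_prod_right'
        rw [lintegral_const_mul'' _ hm', lintegral_lintegral_swap hm]
    _ ≤ A ^ (p / p') * ∫⁻ y, B * f y ^ p ∂ν := by
        gcongr 1
        refine lintegral_mono_ae ?_
        filter_upwards [h2, hu0, hut] with y hy hy0 hyt
        have hKy : Measurable fun x => K x y := hK.comp measurable_prodMk_right
        calc ∫⁻ x, v x ^ p * (K x y * g y ^ p) ∂μ
            = (∫⁻ x, K x y * v x ^ p ∂μ) * g y ^ p := by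
              have hm' : Measurable fun x => K x y * v x ^ p := hKy.mul (hv.pow_const p)
              rw [← lintegral_mul_const _ hm']
              refine lintegral_congr fun x => ?_
              ring
          _ ≤ B * u y ^ p * g y ^ p := by gcongr
          _ = B * f y ^ p := by
              rw [mul_assoc, ← ENNReal.mul_rpow_of_nonneg _ _ hp.le]
              simp only [hg]
              rw [ENNReal.mul_div_cancel hy0 hyt]
    _ = _ := by rw [lintegral_const_mul'' _ (hf.pow_const p), mul_assoc]

/-- Finiteness of the `L^q` norm of a dominated integral operator applied to `f`. -/
def DominatedKernel (q : ℝ≥0∞) (μ : Measure α) (ν : Measure β) (K : α → β → ℝ) (f : β → ℝ) :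
    Prop :=
  ∫⁻ x, (∫⁻ y, ‖K x y‖ₑ * ‖f y‖ₑ ∂ν) ^ q.toReal ∂μ ≠ ∞

lemma aestronglyMeasurable_integral_kernel [SFinite μ] [SFinite ν] {k : α → β → ℝ}
    (hk : Measurable (Function.uncurry k)) {f : β → ℝ} (hf : AEStronglyMeasurable f ν) :
    AEStronglyMeasurable (fun x => ∫ y, k x y * f y ∂ν) μ :=
  (hk.aestronglyMeasurable.mul hf.comp_snd).integral_prod_right' (μ := μ)

lemma enorm_integral_kernel_le {k K f : β → ℝ} (h : ∀ᵐ y ∂ν, |k y| ≤ K y) :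
    ‖∫ y, k y * f y ∂ν‖ₑ ≤ ∫⁻ y, ‖K y‖ₑ * ‖f y‖ₑ ∂ν := by
  refine (enorm_integral_le_lintegral_enorm _).trans (lintegral_mono_ae ?_)
  filter_upwards [h] with y hy
  rw [enorm_mul]
  gcongr
  exact enorm_le_iff_norm_le.2 (hy.trans (le_abs_self _))

lemma DominatedKernel.memLp [SFinite μ] [SFinite ν] {q : ℝ≥0∞} (hq0 : q ≠ 0) (hqt : q ≠ ∞)
    {k K : α → β → ℝ} {f : β → ℝ} (hK : DominatedKernel q μ ν K f)
    (hk : Measurable (Function.uncurry k)) (hf : AEStronglyMeasurable f ν)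
    (h : ∀ᵐ x ∂μ, ∀ᵐ y ∂ν, |k x y| ≤ K x y) :
    MemLp (fun x => ∫ y, k x y * f y ∂ν) q μ := by
  refine ⟨aestronglyMeasurable_integral_kernel hk hf, ?_⟩
  rw [eLpNorm_lt_top_iff_lintegral_rpow_enorm_lt_top hq0 hqt]
  refine lt_of_le_of_lt (lintegral_mono_ae ?_) (lt_top_iff_ne_top.2 hK)
  filter_upwards [h] with x hx
  gcongr
  exact enorm_integral_kernel_le hx

/-- Dominated convergence for integral operators in `L^q`. -/
lemma DominatedKernel.tendsto [SFinite μ] [SFinite ν] {ι : Type*} {l : Filter ι}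
    [l.IsCountablyGenerated]
    {q : ℝ≥0∞} (hq0 : q ≠ 0) (hqt : q ≠ ∞)
    {k : ι → α → β → ℝ} {k₀ K : α → β → ℝ} {f : β → ℝ} (hK : DominatedKernel q μ ν K f)
    (hKm : Measurable (Function.uncurry K))
    (hk : ∀ᶠ i in l, Measurable (Function.uncurry (k i)))
    (hk₀ : Measurable (Function.uncurry k₀)) (hf : AEStronglyMeasurable f ν)
    {S : Set α} (hS : ∀ᵐ x ∂μ, x ∈ S)
    (h : ∀ᶠ i in l, ∀ x ∈ S, ∀ᵐ y ∂ν, |k i x y| ≤ K x y)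
    (h₀ : ∀ x ∈ S, ∀ᵐ y ∂ν, |k₀ x y| ≤ K x y)
    (hlim : ∀ x ∈ S, ∀ᵐ y ∂ν, Tendsto (fun i => k i x y) l (𝓝 (k₀ x y))) :
    Tendsto (fun i => eLpNorm (fun x => (∫ y, k i x y * f y ∂ν) - ∫ y, k₀ x y * f y ∂ν) q μ) l
      (𝓝 0) := by
  have hp : 0 < q.toReal := ENNReal.toReal_pos hq0 hqt
  set F : α → ℝ≥0∞ := fun x => ∫⁻ y, ‖K x y‖ₑ * ‖f y‖ₑ ∂ν with hF
  have hFm : AEMeasurable F μ :=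
    (hKm.enorm.aemeasurable.mul hf.enorm.comp_snd).lintegral_prod_right'
  have hFfin : ∀ᵐ x ∂μ, F x < ∞ := by
    have := ae_lt_top' (hFm.pow_const q.toReal) hK
    filter_upwards [this] with x hx
    by_contra hcon
    rw [not_lt, top_le_iff] at hcon
    rw [hcon, ENNReal.top_rpow_of_pos hp] at hx
    exact lt_irrefl _ hx
  have hkx : ∀ {k : α → β → ℝ}, Measurable (Function.uncurry k) → ∀ x,
      AEStronglyMeasurable (fun y => k x y * f y) ν := fun hk x =>
    (hk.comp measurable_prodMk_left).aestronglyMeasurable.mul hf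
  -- The majorising integral is finite at almost every x, so dominated convergence applies to the
  -- inner integral there.
  have hpt : ∀ᵐ x ∂μ, Tendsto (fun i => (∫ y, k i x y * f y ∂ν) - ∫ y, k₀ x y * f y ∂ν) l
      (𝓝 0) := by
    filter_upwards [hFfin, hS] with x hx hxS
    have hbound : Integrable (fun y => ‖K x y‖ * ‖f y‖) ν := by
      refine ⟨(hKm.comp measurable_prodMk_left).norm.aestronglyMeasurable.mul hf.norm, ?_⟩
      rw [HasFiniteIntegral]
      simpa [enorm_mul] using hx
    have := tendsto_integral_filter_of_dominated_convergence (fun y => ‖K x y‖ * ‖f y‖)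
      (F := fun i y => k i x y * f y) (f := fun y => k₀ x y * f y) (l := l) (μ := ν)
      (hk.mono fun i hi => hkx hi x)
      (h.mono fun i hi => by
        filter_upwards [hi x hxS] with y hy
        rw [norm_mul]
        exact mul_le_mul_of_nonneg_right (hy.trans (le_abs_self _)) (norm_nonneg _))
      hbound
      (by filter_upwards [hlim x hxS] with y hy using hy.mul_const _)
    simpa using this.sub_const (∫ y, k₀ x y * f y ∂ν)
  have hmain : Tendsto (fun i => ∫⁻ x, ‖(∫ y, k i x y * f y ∂ν) - ∫ y, k₀ x y * f y ∂ν‖ₑ ^ q.toReal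
      ∂μ) l (𝓝 (∫⁻ _, 0 ∂μ)) := by
    -- The outer integral is dominated by the q-th power of twice the majorising integral.
    refine tendsto_lintegral_filter_of_dominated_convergence'
      (fun x => (2 : ℝ≥0∞) ^ q.toReal * F x ^ q.toReal) ?_ ?_ ?_ ?_
    · filter_upwards [hk] with i hi
      exact ((aestronglyMeasurable_integral_kernel hi hf).sub
        (aestronglyMeasurable_integral_kernel hk₀ hf)).enorm.pow_const _
    · filter_upwards [h] with i hi
      filter_upwards [hS] with x hxS
      rw [← ENNReal.mul_rpow_of_nonneg _ _ hp.le]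
      gcongr
      rw [two_mul]
      exact (enorm_sub_le).trans (add_le_add (enorm_integral_kernel_le (hi x hxS))
        (enorm_integral_kernel_le (h₀ x hxS)))
    · rw [lintegral_const_mul'' _ (hFm.pow_const _)]
      exact ENNReal.mul_ne_top (ENNReal.rpow_ne_top_of_nonneg hp.le (by norm_num)) hK
    · filter_upwards [hpt] with x hx
      have := (hx.enorm).ennrpow_const q.toReal
      simpa [hp] using this
  rw [lintegral_zero] at hmain
  simp_rw [eLpNorm_eq_lintegral_rpow_enorm_toReal hq0 hqt]
  have := hmain.ennrpow_const (1 / q.toReal)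
  simpa [hp] using this

/-- Jensen's inequality, obtained from Hölder against the constant 1. -/
lemma rpow_lintegral_le [IsProbabilityMeasure ν] {p p' : ℝ} (hpp : p.HolderConjugate p')
    {g : β → ℝ≥0∞} (hg : AEMeasurable g ν) : (∫⁻ y, g y ∂ν) ^ p ≤ ∫⁻ y, g y ^ p ∂ν := by
  have h := ENNReal.lintegral_mul_le_Lp_mul_Lq ν hpp hg (aemeasurable_const (b := (1 : ℝ≥0∞)))
  simp only [Pi.mul_apply, mul_one, ENNReal.one_rpow, lintegral_const, measure_univ] at h
  calc (∫⁻ y, g y ∂ν) ^ p ≤ ((∫⁻ y, g y ^ p ∂ν) ^ (1 / p)) ^ p := by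
        gcongr
        exact hpp.nonneg
    _ = _ := by
        rw [← ENNReal.rpow_mul, one_div, inv_mul_cancel₀ hpp.pos.ne', ENNReal.rpow_one]

end Lebesgue

/-! ### Translations and pairing with decaying kernels -/

/-- Translations are continuous in `L^q`. -/
lemma tendsto_eLpNorm_translate {q : ℝ≥0∞} (hq1 : 1 ≤ q) (hqt : q ≠ ∞) {f : ℝ × ℝ → ℝ}
    (hf : MemLp f q volume) :
    Tendsto (fun h : ℝ × ℝ => eLpNorm (fun x => f (h + x) - f x) q volume) (𝓝 0) (𝓝 0) := by
  have : Fact (1 ≤ q) := ⟨hq1⟩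
  have : Fact (q ≠ ∞) := ⟨hqt⟩
  set F : Lp ℝ q (volume : Measure (ℝ × ℝ)) := hf.toLp f with hF
  have hcont : Continuous fun h : ℝ × ℝ => (DomAddAct.mk h +ᵥ F) := by fun_prop
  have h1 : Tendsto (fun h : ℝ × ℝ => ‖(DomAddAct.mk h +ᵥ F) - F‖ₑ) (𝓝 0) (𝓝 0) := by
    have := (hcont.sub (continuous_const (y := F))).enorm.tendsto 0
    simpa using this
  refine h1.congr fun h => ?_
  rw [Lp.enorm_def]
  refine eLpNorm_congr_ae ?_
  have e1 : (DomAddAct.mk h +ᵥ F : Lp ℝ q volume) =ᵐ[volume] fun x => f (h + x) := by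
    rw [hF, DomAddAct.mk_vadd_toLp]
    exact MemLp.coeFn_toLp _
  filter_upwards [Lp.coeFn_sub (DomAddAct.mk h +ᵥ F) F, e1, hf.coeFn_toLp] with x hx1 hx2 hx3
  rw [hx1, Pi.sub_apply, hx2, hF, hx3]

/-- The decay function `(1 + ‖z‖²)^(-1/2)`. -/
def bracket (z : ℝ × ℝ) : ℝ := (1 + ‖z‖ ^ 2) ^ (-(1 / 2 : ℝ))

lemma bracket_nonneg (z : ℝ × ℝ) : 0 ≤ bracket z := by unfold bracket; positivity

lemma measurable_bracket : Measurable bracket := by unfold bracket; fun_prop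

/-- The norm ignores the sign of the second coordinate, so the reflection can be moved to x, and
estimates uniform over all translates cover the reflected kernels. -/
lemma bracket_reflect (x y : ℝ × ℝ) : bracket (x - reflect y) = bracket (reflect x - y) := by
  unfold bracket reflect
  have h : ‖x - (y.1, -y.2)‖ = ‖(x.1, -x.2) - y‖ := by
    simp only [Prod.norm_def, Prod.fst_sub, Prod.snd_sub]
    congr 1
    rw [← norm_neg]
    congr 1
    ring
  rw [h]

/-- The norm of the product space is the maximum norm, so this comparison with the Euclidean length
is only one-sided; no more is needed. -/
lemma norm_sq_le (z : ℝ × ℝ) : ‖z‖ ^ 2 ≤ z.1 ^ 2 + z.2 ^ 2 := by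
  rw [Prod.norm_def, Real.norm_eq_abs, Real.norm_eq_abs]
  rcases max_cases |z.1| |z.2| with ⟨h, _⟩ | ⟨h, _⟩ <;> rw [h, sq_abs] <;>
    nlinarith [sq_nonneg z.1, sq_nonneg z.2]

lemma inv_sqrt_le_bracket {t : ℝ} (ht : 0 < t) (z : ℝ × ℝ) :
    (√(t + (z.1 ^ 2 + z.2 ^ 2)))⁻¹ ≤ √(1 + 1 / t) * bracket z := by
  have h1 := norm_sq_le z
  have h2 : bracket z = (√(1 + ‖z‖ ^ 2))⁻¹ := by
    unfold bracket
    rw [Real.rpow_neg (by positivity), Real.sqrt_eq_rpow]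
  have p1 : 0 < t + (z.1 ^ 2 + z.2 ^ 2) := by positivity
  rw [h2, ← Real.sqrt_inv, ← Real.sqrt_inv, ← Real.sqrt_mul (by positivity)]
  refine Real.sqrt_le_sqrt ?_
  rw [← div_eq_mul_inv, le_div_iff₀ (by positivity), inv_mul_le_iff₀ p1]
  have h3 : (t + (z.1 ^ 2 + z.2 ^ 2)) * (1 + 1 / t)
      = 1 + t + (z.1 ^ 2 + z.2 ^ 2) + (z.1 ^ 2 + z.2 ^ 2) / t := by field_simp; ring
  rw [h3]
  have : 0 ≤ (z.1 ^ 2 + z.2 ^ 2) / t := by positivity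
  linarith

/-- Half of the quadratic decay is given up: one square-root factor is bounded by t^{-1/2}. -/
lemma inv_le_bracket {t : ℝ} (ht : 0 < t) (z : ℝ × ℝ) :
    (t + (z.1 ^ 2 + z.2 ^ 2))⁻¹ ≤ (√t)⁻¹ * √(1 + 1 / t) * bracket z := by
  have p1 : 0 < t + (z.1 ^ 2 + z.2 ^ 2) := by positivity
  have h1 : (t + (z.1 ^ 2 + z.2 ^ 2))⁻¹
      = (√(t + (z.1 ^ 2 + z.2 ^ 2)))⁻¹ * (√(t + (z.1 ^ 2 + z.2 ^ 2)))⁻¹ := by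
    rw [← mul_inv, Real.mul_self_sqrt p1.le]
  rw [h1, mul_assoc]
  refine mul_le_mul ?_ (inv_sqrt_le_bracket ht z) (by positivity) (by positivity)
  have h2 : √t ≤ √(t + (z.1 ^ 2 + z.2 ^ 2)) := Real.sqrt_le_sqrt (by nlinarith [sq_nonneg z.1, sq_nonneg z.2])
  have := Real.sqrt_pos.2 ht
  gcongr

/-- Conjugate exponents of `1 < q < 2`. -/
lemma exists_conjugate {q : ℝ≥0∞} (hq1 : 1 < q) (hq2 : q < 2) :
    ∃ p' : ℝ, q.toReal.HolderConjugate p' ∧ 2 < p' := by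
  have hqt : q ≠ ∞ := (hq2.trans (by norm_num)).ne
  have h1 : 1 < q.toReal := by
    rw [← ENNReal.toReal_one]; exact (ENNReal.toReal_lt_toReal (by norm_num) hqt).2 hq1
  have h2 : q.toReal < 2 := by
    have := (ENNReal.toReal_lt_toReal hqt (by norm_num)).2 hq2
    simpa using this
  refine ⟨q.toReal.conjExponent, Real.HolderConjugate.conjExponent h1, ?_⟩
  rw [Real.conjExponent, lt_div_iff₀ (by linarith)]
  linarith

/-- Integrability at infinity in dimension two; applied with the conjugate exponent of q, it is the
reason for q < 2. -/
lemma lintegral_bracket_lt_top {r : ℝ} (hr : 2 < r) :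
    ∫⁻ z : ℝ × ℝ, ‖bracket z‖ₑ ^ r < ∞ := by
  have h := integrable_rpow_neg_one_add_norm_sq (E := ℝ × ℝ) (μ := volume) (r := r)
    (by simpa using hr)
  have h2 := h.2
  refine lt_of_eq_of_lt ?_ h2
  refine lintegral_congr fun z => ?_
  rw [← Real.enorm_rpow_of_nonneg (bracket_nonneg z) (by linarith)]
  congr 1
  unfold bracket
  rw [← Real.rpow_mul (by positivity)]
  congr 1
  ring

/-- Hölder's inequality against translates of `bracket`. -/
lemma exists_lintegral_bracket_le {q : ℝ≥0∞} (hq1 : 1 < q) (hq2 : q < 2) {s : Set (ℝ × ℝ)}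
    {f : ℝ × ℝ → ℝ} (hf : MemLp f q (volume.restrict s)) :
    ∃ C : ℝ≥0∞, C ≠ ∞ ∧ ∀ x, ∫⁻ y in s, ‖bracket (x - y)‖ₑ * ‖f y‖ₑ ≤ C := by
  obtain ⟨p', hpp, hp'⟩ := exists_conjugate hq1 hq2
  have hqt : q ≠ ∞ := (hq2.trans (by norm_num)).ne
  have hq0 : q ≠ 0 := (zero_lt_one.trans hq1).ne'
  refine ⟨(∫⁻ z : ℝ × ℝ, ‖bracket z‖ₑ ^ p') ^ (1 / p') *
    (∫⁻ y in s, ‖f y‖ₑ ^ q.toReal) ^ (1 / q.toReal), ?_, fun x => ?_⟩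
  · refine ENNReal.mul_ne_top ?_ ?_
    · exact ENNReal.rpow_ne_top_of_nonneg (by have := hpp.symm.nonneg; positivity)
        (lintegral_bracket_lt_top hp').ne
    · refine ENNReal.rpow_ne_top_of_nonneg (by positivity) ?_
      exact ((eLpNorm_lt_top_iff_lintegral_rpow_enorm_lt_top hq0 hqt).1 hf.2).ne
  · have hm : Measurable fun y : ℝ × ℝ => ‖bracket (x - y)‖ₑ :=
      (measurable_bracket.comp (by fun_prop)).enorm
    have h := ENNReal.lintegral_mul_le_Lp_mul_Lq (volume.restrict s) hpp.symm
      (f := fun y => ‖bracket (x - y)‖ₑ) (g := fun y => ‖f y‖ₑ) hm.aemeasurable hf.1.enorm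
    refine h.trans (mul_le_mul_left ?_ _)
    refine ENNReal.rpow_le_rpow ?_ (by have := hpp.symm.nonneg; positivity)
    refine (setLIntegral_le_lintegral _ _).trans (le_of_eq ?_)
    exact lintegral_sub_left_eq_self (fun z => ‖bracket z‖ₑ ^ p') x

lemma integrable_of_le_bracket {s : Set (ℝ × ℝ)} {f : ℝ × ℝ → ℝ}
    (hf : AEStronglyMeasurable f (volume.restrict s)) {C : ℝ≥0∞} (hC : C ≠ ∞) {x : ℝ × ℝ}
    (h : ∫⁻ y in s, ‖bracket (x - y)‖ₑ * ‖f y‖ₑ ≤ C) {k : ℝ × ℝ → ℝ} (hk : Measurable k) {M : ℝ}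
    (hkM : ∀ᵐ y ∂(volume.restrict s), |k y| ≤ M * bracket (x - y)) :
    IntegrableOn (fun y => k y * f y) s ∧ ∫⁻ y in s, ‖k y * f y‖ₑ ≤ ‖M‖ₑ * C := by
  have hle : ∫⁻ y in s, ‖k y * f y‖ₑ ≤ ‖M‖ₑ * C := by
    have hm : Measurable fun y : ℝ × ℝ => ‖bracket (x - y)‖ₑ :=
      (measurable_bracket.comp (by fun_prop)).enorm
    calc ∫⁻ y in s, ‖k y * f y‖ₑ ≤ ∫⁻ y in s, ‖M‖ₑ * (‖bracket (x - y)‖ₑ * ‖f y‖ₑ) := by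
          refine lintegral_mono_ae ?_
          filter_upwards [hkM] with y hy
          have h3 : ‖k y‖ₑ ≤ ‖M * bracket (x - y)‖ₑ :=
            enorm_le_iff_norm_le.2 (hy.trans (le_abs_self _))
          rw [enorm_mul] at h3
          rw [enorm_mul, ← mul_assoc]
          gcongr
      _ = ‖M‖ₑ * ∫⁻ y in s, ‖bracket (x - y)‖ₑ * ‖f y‖ₑ := by
          have hm' : AEMeasurable (fun y => ‖bracket (x - y)‖ₑ * ‖f y‖ₑ) (volume.restrict s) :=
            hm.aemeasurable.mul hf.enorm
          rw [lintegral_const_mul'' _ hm']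
      _ ≤ _ := by gcongr
  refine ⟨⟨hk.aestronglyMeasurable.mul hf, ?_⟩, hle⟩
  exact lt_of_le_of_lt hle (ENNReal.mul_lt_top enorm_lt_top hC.lt_top)

lemma abs_setIntegral_le_of_lintegral {s : Set (ℝ × ℝ)} {g : ℝ × ℝ → ℝ} {C : ℝ≥0∞} (hC : C ≠ ∞)
    (h : ∫⁻ y in s, ‖g y‖ₑ ≤ C) : |∫ y in s, g y| ≤ C.toReal := by
  have h1 := (enorm_integral_le_lintegral_enorm (μ := volume.restrict s) g).trans h
  rw [← ENNReal.ofReal_toReal hC, Real.enorm_eq_ofReal_abs] at h1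
  exact (ENNReal.ofReal_le_ofReal_iff ENNReal.toReal_nonneg).1 h1

/-! ### Schur estimates on the half plane and on its boundary -/

lemma volume_restrict_halfPlane :
    volume.restrict halfPlane = (volume : Measure ℝ).prod (volume.restrict (Ioi (0 : ℝ))) := by
  have h : halfPlane = univ ×ˢ Ioi (0 : ℝ) := by ext x; simp [halfPlane]
  rw [h, Measure.volume_eq_prod, ← Measure.prod_restrict, Measure.restrict_univ]

lemma measurableSet_halfPlane : MeasurableSet halfPlane :=
  measurableSet_lt measurable_const measurable_snd

lemma integral_linePoissonKernel {s : ℝ} (hs : 0 < s) : ∫ x, linePoissonKernel s x = 1 := by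
  have h := integral_cexp_mul_linePoissonKernel hs 0
  simp only [zero_mul, Complex.ofReal_zero, Complex.exp_zero, one_mul, abs_zero, mul_zero,
    neg_zero] at h
  rw [integral_complex_ofReal] at h
  exact_mod_cast h

lemma lintegral_inv_sq_add_sq {c : ℝ} (hc : 0 < c) :
    ∫⁻ a : ℝ, ENNReal.ofReal ((a ^ 2 + c ^ 2)⁻¹) = ENNReal.ofReal (Real.pi / c) := by
  have hpi := Real.pi_pos
  have h1 : ∀ a : ℝ, (a ^ 2 + c ^ 2)⁻¹ = Real.pi / c * linePoissonKernel c a := by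
    intro a
    unfold linePoissonKernel
    have : 0 < a ^ 2 + c ^ 2 := by positivity
    field_simp
  simp_rw [h1]
  rw [← ofReal_integral_eq_lintegral_ofReal ((integrable_linePoissonKernel hc).const_mul _)
    (Eventually.of_forall fun a => by
      have := linePoissonKernel_nonneg hc.le a
      simp only [Pi.zero_apply]
      positivity), integral_const_mul, integral_linePoissonKernel hc, mul_one]

/-- Split at y = a and drop one summand of a + y on each side. The piece near 0 needs α < 1 and the
tail needs α > 0. -/
lemma lintegral_inv_mul_rpow_le {α a : ℝ} (h0 : 0 < α) (h1 : α < 1) (ha : 0 < a) :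
    ∫⁻ y in Ioi (0 : ℝ), ENNReal.ofReal ((a + y)⁻¹ * y ^ (-α))
      ≤ ENNReal.ofReal ((1 / (1 - α) + 1 / α) * a ^ (-α)) := by
  rw [← Ioc_union_Ioi_eq_Ioi ha.le]
  refine (lintegral_union_le _ _ _).trans ?_
  have hA : ∫⁻ y in Ioc 0 a, ENNReal.ofReal ((a + y)⁻¹ * y ^ (-α))
      ≤ ENNReal.ofReal (1 / (1 - α) * a ^ (-α)) := by
    have hi : IntegrableOn (fun y : ℝ => a⁻¹ * y ^ (-α)) (Ioc 0 a) := by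
      have := (intervalIntegral.intervalIntegrable_rpow' (a := 0) (b := a) (r := -α)
        (by linarith)).const_mul a⁻¹
      rwa [intervalIntegrable_iff_integrableOn_Ioc_of_le ha.le] at this
    calc ∫⁻ y in Ioc 0 a, ENNReal.ofReal ((a + y)⁻¹ * y ^ (-α))
        ≤ ∫⁻ y in Ioc 0 a, ENNReal.ofReal (a⁻¹ * y ^ (-α)) := by
          refine setLIntegral_mono' measurableSet_Ioc fun y hy => ENNReal.ofReal_le_ofReal ?_
          have := hy.1
          gcongr
          linarith
      _ = ENNReal.ofReal (∫ y in Ioc 0 a, a⁻¹ * y ^ (-α)) := by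
          rw [ofReal_integral_eq_lintegral_ofReal hi]
          filter_upwards [ae_restrict_mem measurableSet_Ioc] with y hy
          have := hy.1
          simp only [Pi.zero_apply]
          positivity
      _ = _ := by
          rw [← intervalIntegral.integral_of_le ha.le, intervalIntegral.integral_const_mul,
            integral_rpow (Or.inl (by linarith)), Real.zero_rpow (by linarith), sub_zero,
            Real.rpow_add ha, Real.rpow_one]
          congr 1
          have : 1 - α ≠ 0 := by linarith
          have h3 : -α + 1 ≠ 0 := by linarith
          field_simp
          ring
  have hB : ∫⁻ y in Ioi a, ENNReal.ofReal ((a + y)⁻¹ * y ^ (-α))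
      ≤ ENNReal.ofReal (1 / α * a ^ (-α)) := by
    have hi : IntegrableOn (fun y : ℝ => y ^ (-α - 1)) (Ioi a) :=
      integrableOn_Ioi_rpow_of_lt (by linarith) ha
    calc ∫⁻ y in Ioi a, ENNReal.ofReal ((a + y)⁻¹ * y ^ (-α))
        ≤ ∫⁻ y in Ioi a, ENNReal.ofReal (y ^ (-α - 1)) := by
          refine setLIntegral_mono' measurableSet_Ioi fun y hy => ENNReal.ofReal_le_ofReal ?_
          have hy' : 0 < y := ha.trans hy
          rw [Real.rpow_sub_one hy'.ne', div_eq_inv_mul]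
          gcongr
          linarith
      _ = ENNReal.ofReal (∫ y in Ioi a, y ^ (-α - 1)) := by
          rw [ofReal_integral_eq_lintegral_ofReal hi]
          filter_upwards [ae_restrict_mem measurableSet_Ioi] with y hy
          have : 0 < y := ha.trans hy
          simp only [Pi.zero_apply]
          positivity
      _ = _ := by
          rw [integral_Ioi_rpow_of_lt (by linarith) ha]
          congr 1
          have h3 : -α - 1 + 1 = -α := by ring
          rw [h3]
          field_simp
  refine (add_le_add hA hB).trans (le_of_eq ?_)
  have : 0 < 1 - α := by linarith
  rw [← ENNReal.ofReal_add (by positivity) (by positivity)]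
  congr 1
  ring

/-- The kernel `|x - y*|⁻²` is bounded on `L^q` of the half plane. -/
lemma dominatedKernel_reflect {q : ℝ≥0∞} (hq1 : 1 < q) (hq2 : q < 2) (M : ℝ) (hM : 0 ≤ M)
    {f : ℝ × ℝ → ℝ} (hf : MemLp f q (volume.restrict halfPlane)) :
    DominatedKernel q (volume.restrict halfPlane) (volume.restrict halfPlane)
      (fun x y : ℝ × ℝ => M * ((x.1 - y.1) ^ 2 + (x.2 + y.2) ^ 2)⁻¹) f := by
  obtain ⟨p', hpp, hp'⟩ := exists_conjugate hq1 hq2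
  have hqt : q ≠ ∞ := (hq2.trans (by norm_num)).ne
  have hq0 : q ≠ 0 := (zero_lt_one.trans hq1).ne'
  set p := q.toReal with hp
  have hp0 := hpp.pos
  have hp0' := hpp.symm.pos
  -- With the exponent 1/(pp'), the powers w^{p'} and w^p are y₂^{-1/p} and y₂^{-1/p'}; both
  -- exponents lie in (0, 1), so one homogeneous estimate serves both conditions.
  set w : ℝ × ℝ → ℝ≥0∞ := fun y => ENNReal.ofReal (y.2 ^ (-(1 / (p * p')))) with hw
  have hwm : Measurable w := by fun_prop
  have hmem : ∀ᵐ y ∂(volume.restrict halfPlane), 0 < y.2 :=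
    ae_restrict_mem measurableSet_halfPlane
  have hwpow : ∀ y : ℝ × ℝ, 0 < y.2 → ∀ a b : ℝ, 0 < a → 0 < b → p * p' = a * b →
      w y ^ a = ENNReal.ofReal (y.2 ^ (-(1 / b))) := by
    intro y hy a b ha hb hab
    rw [hw, ENNReal.ofReal_rpow_of_nonneg (by positivity) ha.le, ← Real.rpow_mul hy.le]
    congr 2
    rw [hab]
    field_simp
  have hKm : Measurable (Function.uncurry fun x y : ℝ × ℝ =>
      ‖M * ((x.1 - y.1) ^ 2 + (x.2 + y.2) ^ 2)⁻¹‖ₑ) := by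
    simp only [Function.uncurry_def]; fun_prop
  -- one computation serves both hypotheses of Schur's test
  have hcore : ∀ b : ℝ, 1 < b → ∀ x : ℝ × ℝ, 0 < x.2 →
      ∫⁻ y in halfPlane, ENNReal.ofReal (M * ((x.1 - y.1) ^ 2 + (x.2 + y.2) ^ 2)⁻¹) *
        ENNReal.ofReal (y.2 ^ (-(1 / b)))
      ≤ ENNReal.ofReal (M * Real.pi * (1 / (1 - 1 / b) + 1 / (1 / b))) *
        ENNReal.ofReal (x.2 ^ (-(1 / b))) := by
    intro b hb x hx
    have hb1 : 1 / b < 1 := by rw [div_lt_one (by linarith)]; exact hb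
    have hpi := Real.pi_pos
    rw [volume_restrict_halfPlane, lintegral_prod_symm' _ (by fun_prop)]
    calc ∫⁻ c in Ioi (0 : ℝ), ∫⁻ a : ℝ, ENNReal.ofReal (M * ((x.1 - a) ^ 2 + (x.2 + c) ^ 2)⁻¹) *
          ENNReal.ofReal (c ^ (-(1 / b)))
        = ∫⁻ c in Ioi (0 : ℝ), ENNReal.ofReal (M * Real.pi) *
            ENNReal.ofReal ((x.2 + c)⁻¹ * c ^ (-(1 / b))) := by
          refine setLIntegral_congr_fun measurableSet_Ioi fun c hc => ?_
          have hc' : (0 : ℝ) < c := hc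
          simp_rw [ENNReal.ofReal_mul hM]
          rw [lintegral_mul_const _ (by fun_prop), lintegral_const_mul _ (by fun_prop),
            lintegral_sub_left_eq_self (fun a => ENNReal.ofReal ((a ^ 2 + (x.2 + c) ^ 2)⁻¹)) x.1,
            lintegral_inv_sq_add_sq (by positivity), div_eq_mul_inv,
            ENNReal.ofReal_mul hpi.le, ENNReal.ofReal_mul (by positivity)]
          ring
      _ = ENNReal.ofReal (M * Real.pi) *
            ∫⁻ c in Ioi (0 : ℝ), ENNReal.ofReal ((x.2 + c)⁻¹ * c ^ (-(1 / b))) := by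
          rw [lintegral_const_mul _ (by fun_prop)]
      _ ≤ ENNReal.ofReal (M * Real.pi) *
            ENNReal.ofReal ((1 / (1 - 1 / b) + 1 / (1 / b)) * x.2 ^ (-(1 / b))) := by
          gcongr
          exact lintegral_inv_mul_rpow_le (by positivity) hb1 hx
      _ = _ := by
          have : 0 < 1 - 1 / b := by linarith
          rw [← ENNReal.ofReal_mul (by positivity), ← ENNReal.ofReal_mul (by positivity)]
          congr 1
          ring
  have henorm : ∀ x y : ℝ × ℝ, ‖M * ((x.1 - y.1) ^ 2 + (x.2 + y.2) ^ 2)⁻¹‖ₑ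
      = ENNReal.ofReal (M * ((x.1 - y.1) ^ 2 + (x.2 + y.2) ^ 2)⁻¹) := fun x y =>
    Real.enorm_eq_ofReal (by positivity)
  have hS := lintegral_schur (μ := volume.restrict halfPlane) (ν := volume.restrict halfPlane)
    hpp hKm (u := w) hwm
    (by
      filter_upwards [hmem] with y hy
      simp only [hw, ne_eq, ENNReal.ofReal_eq_zero, not_le]
      positivity)
    (Eventually.of_forall fun y => ENNReal.ofReal_ne_top) (v := w) hwm
    (A := ENNReal.ofReal (M * Real.pi * (1 / (1 - 1 / p) + 1 / (1 / p))))
    (B := ENNReal.ofReal (M * Real.pi * (1 / (1 - 1 / p') + 1 / (1 / p'))))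
    (by
      filter_upwards [hmem] with x hx
      rw [hwpow x hx p' p hp0' hp0 (mul_comm _ _)]
      refine le_trans (le_of_eq ?_) (hcore p hpp.lt x hx)
      refine setLIntegral_congr_fun measurableSet_halfPlane fun y hy => ?_
      simp only [henorm]
      rw [hwpow y hy p' p hp0' hp0 (mul_comm _ _)])
    (by
      filter_upwards [hmem] with y hy
      rw [hwpow y hy p p' hp0 hp0' rfl]
      refine le_trans (le_of_eq ?_) (hcore p' hpp.symm.lt y hy)
      refine setLIntegral_congr_fun measurableSet_halfPlane fun x hx => ?_
      simp only [henorm]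
      rw [hwpow x hx p p' hp0 hp0' rfl]
      congr 4
      ring)
    hf.1.enorm
  refine (lt_of_le_of_lt hS ?_).ne
  refine ENNReal.mul_lt_top (ENNReal.mul_lt_top ?_ ENNReal.ofReal_lt_top) ?_
  · exact ENNReal.rpow_lt_top_of_nonneg (by positivity) ENNReal.ofReal_ne_top
  · exact (eLpNorm_lt_top_iff_lintegral_rpow_enorm_lt_top hq0 hqt).1 hf.2

/-- Boundary values: the kernel `(t + |x - y|²)⁻¹` maps `L^q` of the half plane into `L^q` of the
boundary line. -/
lemma dominatedKernel_boundary {q : ℝ≥0∞} (hq1 : 1 < q) (hq2 : q < 2) {t : ℝ} (ht : 0 < t)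
    (M : ℝ) (hM : 0 ≤ M) {f : ℝ × ℝ → ℝ} (hf : MemLp f q (volume.restrict halfPlane)) :
    DominatedKernel q (volume : Measure ℝ) (volume.restrict halfPlane)
      (fun (r : ℝ) (y : ℝ × ℝ) => M * (t + ((r - y.1) ^ 2 + y.2 ^ 2))⁻¹) f := by
  obtain ⟨p', hpp, hp'⟩ := exists_conjugate hq1 hq2
  have hqt : q ≠ ∞ := (hq2.trans (by norm_num)).ne
  have hq0 : q ≠ 0 := (zero_lt_one.trans hq1).ne'
  have hpi := Real.pi_pos
  set p := q.toReal with hp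
  have hp0 := hpp.pos
  have hp0' := hpp.symm.pos
  set d : ℝ → ℝ := fun c => √(t + c ^ 2) with hd
  have hdpos : ∀ c, 0 < d c := fun c => Real.sqrt_pos.2 (by positivity)
  have hdsq : ∀ c, d c ^ 2 = t + c ^ 2 := fun c => Real.sq_sqrt (by positivity)
  have hdm : Measurable d := by fun_prop
  -- Tangential integration of the kernel gives π/d. With weight 1 on the line, the condition in y
  -- forces w^p to be comparable with 1/d, and the condition in r becomes the integrability of
  -- d^{-(1 + p'/p)}.
  set w : ℝ × ℝ → ℝ≥0∞ := fun y => ENNReal.ofReal (d y.2 ^ (-(1 / p))) with hw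
  have hwm : Measurable w := by fun_prop
  have henorm : ∀ (r : ℝ) (y : ℝ × ℝ), ‖M * (t + ((r - y.1) ^ 2 + y.2 ^ 2))⁻¹‖ₑ
      = ENNReal.ofReal M * ENNReal.ofReal (((r - y.1) ^ 2 + d y.2 ^ 2)⁻¹) := fun r y => by
    rw [Real.enorm_eq_ofReal (by positivity), ENNReal.ofReal_mul hM, hdsq]
    congr 3
    ring
  have hKm : Measurable (Function.uncurry fun (r : ℝ) (y : ℝ × ℝ) =>
      ‖M * (t + ((r - y.1) ^ 2 + y.2 ^ 2))⁻¹‖ₑ) := by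
    simp only [Function.uncurry_def]; fun_prop
  have hwpow : ∀ y : ℝ × ℝ, ∀ a : ℝ, 0 < a → w y ^ a = ENNReal.ofReal (d y.2 ^ (-(a / p))) := by
    intro y a ha
    have := hdpos y.2
    rw [hw, ENNReal.ofReal_rpow_of_nonneg (by positivity) ha.le, ← Real.rpow_mul this.le]
    congr 2
    field_simp
  set A : ℝ≥0∞ := ENNReal.ofReal (M * Real.pi) *
    ∫⁻ c in Ioi (0 : ℝ), ENNReal.ofReal (d c ^ (-(1 + p' / p))) with hA
  have hAfin : A ≠ ∞ := by
    refine ENNReal.mul_ne_top ENNReal.ofReal_ne_top ?_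
    -- The exponent 1 + p'/p exceeds the dimension 1 of the normal variable.
    have h1 := integrable_rpow_neg_one_add_norm_sq (E := ℝ) (μ := volume) (r := 1 + p' / p)
      (by simp; positivity)
    have h2 := (h1.comp_mul_left' (R := (√t)⁻¹) (by positivity)).const_mul
      (√t ^ (-(1 + p' / p)))
    have h3 : Integrable (fun c : ℝ => d c ^ (-(1 + p' / p))) := by
      refine h2.congr (Eventually.of_forall fun c => ?_)
      simp only [hd, Real.norm_eq_abs, sq_abs]
      have e : √(t + c ^ 2) = √t * √(1 + ((√t)⁻¹ * c) ^ 2) := by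
        rw [← Real.sqrt_mul ht.le]
        congr 1
        rw [mul_pow, inv_pow, Real.sq_sqrt ht.le]
        field_simp
      rw [e, Real.mul_rpow (by positivity) (by positivity)]
      congr 1
      rw [Real.sqrt_eq_rpow (1 + _), ← Real.rpow_mul (by positivity)]
      congr 1
      ring
    have h4 := h3.integrableOn (s := Ioi 0)
    have h5 := h4.2
    rw [HasFiniteIntegral] at h5
    refine (lt_of_eq_of_lt ?_ h5).ne
    refine lintegral_congr fun c => ?_
    have := hdpos c
    rw [Real.enorm_eq_ofReal (by positivity)]
  have hS := lintegral_schur (μ := (volume : Measure ℝ)) (ν := volume.restrict halfPlane)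
    hpp hKm (u := w) hwm
    (Eventually.of_forall fun y => by
      have := hdpos y.2
      simp only [hw, ne_eq, ENNReal.ofReal_eq_zero, not_le]
      positivity)
    (Eventually.of_forall fun y => ENNReal.ofReal_ne_top) (v := fun _ => 1) measurable_const
    (A := A) (B := ENNReal.ofReal (M * Real.pi))
    (Eventually.of_forall fun r => by
      simp_rw [henorm, ENNReal.one_rpow, mul_one]
      simp_rw [fun y : ℝ × ℝ => hwpow y p' hp0']
      rw [volume_restrict_halfPlane, lintegral_prod_symm' _ (by fun_prop), hA,
        ← lintegral_const_mul _ (by fun_prop)]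
      refine le_of_eq (lintegral_congr fun c => ?_)
      have := hdpos c
      dsimp only
      rw [lintegral_mul_const _ (by fun_prop), lintegral_const_mul _ (by fun_prop),
        lintegral_sub_left_eq_self (fun a => ENNReal.ofReal ((a ^ 2 + d c ^ 2)⁻¹)) r,
        lintegral_inv_sq_add_sq this, ← ENNReal.ofReal_mul hM, ← ENNReal.ofReal_mul (by positivity),
        ← ENNReal.ofReal_mul (by positivity), neg_add, Real.rpow_add this, Real.rpow_neg_one]
      congr 1
      ring)
    (Eventually.of_forall fun y => by
      simp_rw [henorm, ENNReal.one_rpow, mul_one]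
      have := hdpos y.2
      rw [hwpow y p hp0, lintegral_const_mul _ (by fun_prop),
        lintegral_sub_right_eq_self (fun a => ENNReal.ofReal ((a ^ 2 + d y.2 ^ 2)⁻¹)) y.1,
        lintegral_inv_sq_add_sq this, div_self hp0.ne', Real.rpow_neg_one,
        ← ENNReal.ofReal_mul hM, ← ENNReal.ofReal_mul (by positivity)]
      refine le_of_eq ?_
      congr 1
      ring)
    hf.1.enorm
  refine (lt_of_le_of_lt hS ?_).ne
  refine ENNReal.mul_lt_top (ENNReal.mul_lt_top ?_ ENNReal.ofReal_lt_top) ?_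
  · exact ENNReal.rpow_lt_top_of_nonneg (by positivity) hAfin
  · exact (eLpNorm_lt_top_iff_lintegral_rpow_enorm_lt_top hq0 hqt).1 hf.2

lemma heatKernel_le_bracket {t : ℝ} (ht : 0 < t) (z : ℝ × ℝ) :
    |heatKernel t z| ≤ 16 / Real.pi * ((√t)⁻¹ * √(1 + 1 / t)) * bracket z := by
  have hpi := Real.pi_pos
  rw [abs_of_nonneg (heatKernel_nonneg ht z), mul_assoc]
  refine (heatKernel_le' ht z).trans ?_
  gcongr
  exact inv_le_bracket ht z

/-! ### The Gauss kernels as an approximate identity -/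

/-- The Gaussian law with density `heatKernel 1`. -/
def gaussLaw : Measure (ℝ × ℝ) :=
  volume.withDensity fun u => ENNReal.ofReal (heatKernel 1 u)

lemma measurable_heatKernel (t : ℝ) : Measurable (heatKernel t) :=
  (continuous_heatKernel t).measurable

instance isProbabilityMeasure_gaussLaw : IsProbabilityMeasure gaussLaw := by
  refine ⟨?_⟩
  rw [gaussLaw, withDensity_apply _ MeasurableSet.univ, Measure.restrict_univ,
    ← ofReal_integral_eq_lintegral_ofReal (integrable_heatKernel one_pos)
      (Eventually.of_forall fun u => heatKernel_nonneg one_pos u),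
    integral_heatKernel one_pos, ENNReal.ofReal_one]

lemma integral_gaussLaw (f : ℝ × ℝ → ℝ) :
    ∫ u, f u ∂gaussLaw = ∫ u, heatKernel 1 u * f u := by
  rw [gaussLaw, integral_withDensity_eq_integral_toReal_smul
    (measurable_heatKernel 1).ennreal_ofReal (Eventually.of_forall fun _ => ENNReal.ofReal_lt_top)]
  refine integral_congr_ae (Eventually.of_forall fun u => ?_)
  simp [ENNReal.toReal_ofReal (heatKernel_nonneg one_pos u)]

lemma integrable_gaussLaw_iff (f : ℝ × ℝ → ℝ) :
    Integrable f gaussLaw ↔ Integrable fun u => heatKernel 1 u * f u := by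
  rw [gaussLaw, integrable_withDensity_iff_integrable_smul'
    (measurable_heatKernel 1).ennreal_ofReal (Eventually.of_forall fun _ => ENNReal.ofReal_lt_top)]
  refine integrable_congr (Eventually.of_forall fun u => ?_)
  simp [ENNReal.toReal_ofReal (heatKernel_nonneg one_pos u)]

lemma heatKernel_smul {t : ℝ} (ht : 0 < t) (u : ℝ × ℝ) :
    t * heatKernel t (√t • u) = heatKernel 1 u := by
  have h : (√t) ^ 2 = t := Real.sq_sqrt ht.le
  simp only [heatKernel, Prod.smul_fst, Prod.smul_snd, smul_eq_mul, mul_pow, h]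
  rw [← mul_assoc]
  congr 1
  · field_simp
  · congr 1
    field_simp

/-- The substitution y = x - √t u puts all times under one fixed probability law, leaving t only in
the translation. -/
lemma integral_heatKernel_scale {t : ℝ} (ht : 0 < t) (f : ℝ × ℝ → ℝ) (x : ℝ × ℝ) :
    ∫ y, heatKernel t (x - y) * f y = ∫ u, heatKernel 1 u * f (-√t • u + x) := by
  have h1 := integral_sub_left_eq_self (fun z => heatKernel t z * f (x - z)) volume x
  simp only [sub_sub_cancel] at h1
  rw [h1]
  have h2 := Measure.integral_comp_smul (volume : Measure (ℝ × ℝ))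
    (fun z => heatKernel t z * f (x - z)) (√t)
  have h3 : Module.finrank ℝ (ℝ × ℝ) = 2 := by simp
  rw [h3, Real.sq_sqrt ht.le, abs_of_pos (by positivity), smul_eq_mul, eq_inv_mul_iff_mul_eq₀ ht.ne',
    ← integral_const_mul] at h2
  rw [← h2]
  refine integral_congr_ae (Eventually.of_forall fun u => ?_)
  simp only
  rw [← mul_assoc, heatKernel_smul ht]
  congr 2
  rw [neg_smul, neg_add_eq_sub]

/-- The Gauss kernels are an approximate identity in `L^q`. -/
lemma tendsto_heatKernel_conv {q : ℝ≥0∞} (hq1 : 1 < q) (hq2 : q < 2) {f : ℝ × ℝ → ℝ}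
    (hf : MemLp f q volume) :
    Tendsto (fun t => eLpNorm (fun x => (∫ y, heatKernel t (x - y) * f y) - f x) q volume)
      (𝓝[>] 0) (𝓝 0) := by
  obtain ⟨p', hpp, hp'⟩ := exists_conjugate hq1 hq2
  have hqt : q ≠ ∞ := (hq2.trans (by norm_num)).ne
  have hq0 : q ≠ 0 := (zero_lt_one.trans hq1).ne'
  have hp : 0 < q.toReal := hpp.pos
  -- A measurable representative is needed so that the translation modulus G below is measurable.
  wlog hfm : Measurable f generalizing f
  · have hae := hf.1.ae_eq_mk
    have h := this ((memLp_congr_ae hae).1 hf) hf.1.stronglyMeasurable_mk.measurable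
    refine h.congr fun t => eLpNorm_congr_ae ?_
    filter_upwards [hae] with x hx
    rw [hx]
    congr 1
    refine integral_congr_ae ?_
    filter_upwards [hae] with y hy
    rw [hy]
  set G : ℝ × ℝ → ℝ≥0∞ := fun h => ∫⁻ x, ‖f (h + x) - f x‖ₑ ^ q.toReal with hG
  have hGm : Measurable G := by
    refine Measurable.lintegral_prod_right' (f := fun z : (ℝ × ℝ) × (ℝ × ℝ) =>
      ‖f (z.1 + z.2) - f z.2‖ₑ ^ q.toReal) ?_
    fun_prop
  have hGe : ∀ h, G h = eLpNorm (fun x => f (h + x) - f x) q volume ^ q.toReal := fun h => by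
    rw [eLpNorm_eq_lintegral_rpow_enorm_toReal hq0 hqt, ← ENNReal.rpow_mul, one_div,
      inv_mul_cancel₀ hp.ne', ENNReal.rpow_one]
  have hG0 : Tendsto G (𝓝 0) (𝓝 0) := by
    have := (tendsto_eLpNorm_translate hq1.le hqt hf).ennrpow_const q.toReal
    simpa [hp, ← hGe] using this
  set N := eLpNorm f q volume with hN
  have hGb : ∀ h, G h ≤ (N + N) ^ q.toReal := fun h => by
    rw [hGe]
    gcongr
    have htr : MemLp (fun x => f (h + x)) q volume :=
      hf.comp_measurePreserving (measurePreserving_add_left volume h)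
    refine (eLpNorm_sub_le htr.1 hf.1 hq1.le).trans (le_of_eq ?_)
    congr 1
    exact eLpNorm_comp_measurePreserving hf.1 (measurePreserving_add_left volume h)
  obtain ⟨C, hC, hCle⟩ := exists_lintegral_bracket_le hq1 hq2 (s := univ) (f := f)
    (by rwa [Measure.restrict_univ])
  have hint : ∀ {t : ℝ}, 0 < t → ∀ x, Integrable (fun u => f (-√t • u + x)) gaussLaw := by
    intro t ht x
    have h1 := (integrable_of_le_bracket (s := univ) (by rw [Measure.restrict_univ]; exact hf.1) hC
      (hCle x) (k := fun y => heatKernel t (x - y)) ((measurable_heatKernel t).comp (by fun_prop))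
      (Eventually.of_forall fun y => heatKernel_le_bracket ht (x - y))).1
    rw [integrableOn_univ] at h1
    have h2 := h1.comp_sub_left x
    have h3 := (h2.comp_smul (R := √t) (by positivity)).const_mul t
    rw [integrable_gaussLaw_iff]
    refine h3.congr (Eventually.of_forall fun u => ?_)
    simp only [sub_sub_cancel]
    rw [← mul_assoc, heatKernel_smul ht, neg_smul, neg_add_eq_sub]
  -- Jensen under the Gaussian law followed by Tonelli bounds the error by an average of translation
  -- moduli.
  have hle : ∀ t : ℝ, 0 < t →
      ∫⁻ x, ‖(∫ y, heatKernel t (x - y) * f y) - f x‖ₑ ^ q.toReal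
        ≤ ∫⁻ u, G (-√t • u) ∂gaussLaw := by
    intro t ht
    have h1 : ∀ x, (∫ y, heatKernel t (x - y) * f y) - f x
        = ∫ u, (f (-√t • u + x) - f x) ∂gaussLaw := fun x => by
      rw [integral_heatKernel_scale ht, ← integral_gaussLaw,
        integral_sub (hint ht x) (integrable_const _)]
      simp
    have hm : Measurable fun z : (ℝ × ℝ) × (ℝ × ℝ) =>
        ‖f (-√t • z.2 + z.1) - f z.1‖ₑ ^ q.toReal := by fun_prop
    calc ∫⁻ x, ‖(∫ y, heatKernel t (x - y) * f y) - f x‖ₑ ^ q.toReal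
        ≤ ∫⁻ x, ∫⁻ u, ‖f (-√t • u + x) - f x‖ₑ ^ q.toReal ∂gaussLaw := by
          refine lintegral_mono fun x => ?_
          rw [h1]
          refine le_trans ?_ (rpow_lintegral_le hpp (by fun_prop))
          gcongr
          exact enorm_integral_le_lintegral_enorm _
      _ = _ := lintegral_lintegral_swap hm.aemeasurable
  have hlim : Tendsto (fun t : ℝ => ∫⁻ u, G (-√t • u) ∂gaussLaw) (𝓝[>] 0)
      (𝓝 (∫⁻ _, 0 ∂gaussLaw)) := by
    refine tendsto_lintegral_filter_of_dominated_convergence (fun _ => (N + N) ^ q.toReal) ?_ ?_ ?_ ?_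
    · exact Eventually.of_forall fun t => hGm.comp (by fun_prop)
    · exact Eventually.of_forall fun t => Eventually.of_forall fun u => hGb _
    · rw [lintegral_const, measure_univ, mul_one]
      exact ENNReal.rpow_ne_top_of_nonneg hp.le (ENNReal.add_ne_top.2 ⟨hf.2.ne, hf.2.ne⟩)
    · refine Eventually.of_forall fun u => hG0.comp ?_
      have : Continuous fun t : ℝ => -√t • u := by fun_prop
      have := this.tendsto 0
      rw [Real.sqrt_zero, neg_zero, zero_smul] at this
      exact this.mono_left nhdsWithin_le_nhds
  rw [lintegral_zero] at hlim
  have h0 : Tendsto (fun t : ℝ => ∫⁻ x, ‖(∫ y, heatKernel t (x - y) * f y) - f x‖ₑ ^ q.toReal)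
      (𝓝[>] 0) (𝓝 0) :=
    tendsto_of_tendsto_of_tendsto_of_le_of_le' tendsto_const_nhds hlim
      (Eventually.of_forall fun _ => zero_le)
      (eventually_mem_nhdsWithin.mono fun t ht => hle t ht)
  simp_rw [eLpNorm_eq_lintegral_rpow_enorm_toReal hq0 hqt]
  have := h0.ennrpow_const (1 / q.toReal)
  simpa [hp] using this

/-- Convolution with the Gauss kernel maps `L^q` into `L^q`. -/
lemma memLp_heatKernel_conv {q : ℝ≥0∞} (hq1 : 1 < q) (hq2 : q < 2) {t : ℝ} (ht : 0 < t)
    {f : ℝ × ℝ → ℝ} (hf : MemLp f q volume) :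
    MemLp (fun x => ∫ y, heatKernel t (x - y) * f y) q volume := by
  obtain ⟨p', hpp, hp'⟩ := exists_conjugate hq1 hq2
  have hqt : q ≠ ∞ := (hq2.trans (by norm_num)).ne
  have hq0 : q ≠ 0 := (zero_lt_one.trans hq1).ne'
  have hk : Measurable (Function.uncurry fun x y : ℝ × ℝ => heatKernel t (x - y)) :=
    (measurable_heatKernel t).comp (by fun_prop)
  have h1 : ∫⁻ z, ‖heatKernel t z‖ₑ ≤ 1 := by
    simp_rw [Real.enorm_eq_ofReal (heatKernel_nonneg ht _)]
    rw [← ofReal_integral_eq_lintegral_ofReal (integrable_heatKernel ht)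
      (Eventually.of_forall fun u => heatKernel_nonneg ht u), integral_heatKernel ht,
      ENNReal.ofReal_one]
  -- Schur's test with unit weights, the kernel having mass 1 in each variable.
  have hD : DominatedKernel q volume volume (fun x y : ℝ × ℝ => heatKernel t (x - y)) f := by
    refine (lt_of_le_of_lt (lintegral_schur hpp (μ := volume) (ν := volume)
      (K := fun x y : ℝ × ℝ => ‖heatKernel t (x - y)‖ₑ) hk.enorm
      (u := fun _ => 1) measurable_const (by simp) (by simp) (v := fun _ => 1) measurable_const
      (A := 1) (B := 1) ?_ ?_ hf.1.enorm) ?_).ne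
    · refine Eventually.of_forall fun x => ?_
      simp only [ENNReal.one_rpow, mul_one]
      exact (lintegral_sub_left_eq_self (fun z => ‖heatKernel t z‖ₑ) x).le.trans h1
    · refine Eventually.of_forall fun y => ?_
      simp only [ENNReal.one_rpow, mul_one]
      exact (lintegral_sub_right_eq_self (fun z => ‖heatKernel t z‖ₑ) y).le.trans h1
    · rw [ENNReal.one_rpow, one_mul, one_mul]
      exact (eLpNorm_lt_top_iff_lintegral_rpow_enorm_lt_top hq0 hqt).1 hf.2
  exact hD.memLp hq0 hqt hk hf.1 (Eventually.of_forall fun x => Eventually.of_forall fun y => by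
    rw [abs_of_nonneg (heatKernel_nonneg ht _)])

/-! ### Consequences of the vanishing tangential trace -/

lemma ae_pos_snd : ∀ᵐ y ∂(volume.restrict halfPlane), 0 < y.2 :=
  ae_restrict_mem measurableSet_halfPlane

/-- The source and its image of opposite sign each contribute half of a Poisson kernel, so the
tangential velocity on the boundary is a Poisson integral of the vorticity. -/
lemma partial2_greenD {y : ℝ × ℝ} (hy : 0 < y.2) (r : ℝ) :
    partial2 (fun z => greenD z y) (r, 0) = linePoissonKernel y.2 (r - y.1) := by
  have h1 := hasDerivAt_E_snd (w := (r - y.1, 0 - y.2)) (by simpa using hy.ne')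
  have h2 := hasDerivAt_E_snd (w := (r - y.1, 0 + y.2)) (by simpa using hy.ne')
  have h3 : HasDerivAt (fun s : ℝ => greenD (r, s) y) _ 0 :=
    (h1.comp_sub_const (0 : ℝ) y.2).sub (h2.comp_add_const (0 : ℝ) y.2) |>.congr_of_eventuallyEq
      (Eventually.of_forall fun s => by
        simp [greenD, reflect, Prod.sub_def])
  unfold partial2
  rw [h3.deriv]
  simp only [zero_sub, zero_add, linePoissonKernel_neg_left]
  ring

/-- The Poisson kernel decays only to first order in |z|, so here the decay of `bracket` cannot be
improved. -/
lemma linePoissonKernel_le_bracket {s : ℝ} (hs : 0 < s) {z : ℝ × ℝ} (hz : s ≤ z.2) :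
    |linePoissonKernel z.2 z.1| ≤ √2 / Real.pi * √(1 + 1 / s ^ 2) * bracket z := by
  have hpi := Real.pi_pos
  have hz0 : 0 < z.2 := hs.trans_le hz
  have hb := inv_sqrt_le_bracket (t := s ^ 2) (by positivity) z
  rw [abs_of_nonneg (linePoissonKernel_nonneg hz0.le _), mul_assoc]
  refine le_trans ?_ (mul_le_mul_of_nonneg_left hb (by positivity))
  have h1 : √(s ^ 2 + (z.1 ^ 2 + z.2 ^ 2)) ≤ √2 * √(z.1 ^ 2 + z.2 ^ 2) := by
    rw [← Real.sqrt_mul (by norm_num)]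
    refine Real.sqrt_le_sqrt ?_
    nlinarith [sq_nonneg z.1]
  have h2 : z.2 ≤ √(z.1 ^ 2 + z.2 ^ 2) := Real.le_sqrt_of_sq_le (by nlinarith [sq_nonneg z.1])
  have h3 : √(z.1 ^ 2 + z.2 ^ 2) * √(z.1 ^ 2 + z.2 ^ 2) = z.1 ^ 2 + z.2 ^ 2 :=
    Real.mul_self_sqrt (by positivity)
  have h4 : 0 < √(z.1 ^ 2 + z.2 ^ 2) := Real.sqrt_pos.2 (by positivity)
  have h5 : 0 < √(s ^ 2 + (z.1 ^ 2 + z.2 ^ 2)) := Real.sqrt_pos.2 (by positivity)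
  unfold linePoissonKernel
  have h6 : z.2 / (Real.pi * (z.1 ^ 2 + z.2 ^ 2))
      = z.2 / (Real.pi * (√(z.1 ^ 2 + z.2 ^ 2) * √(z.1 ^ 2 + z.2 ^ 2))) := by rw [h3]
  rw [h6, ← div_eq_mul_inv, div_div √2, div_le_div_iff₀ (by positivity) (by positivity)]
  calc z.2 * (Real.pi * √(s ^ 2 + (z.1 ^ 2 + z.2 ^ 2)))
      ≤ √(z.1 ^ 2 + z.2 ^ 2) * (Real.pi * (√2 * √(z.1 ^ 2 + z.2 ^ 2))) := by gcongr
    _ = _ := by ring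

lemma integrableOn_linePoissonKernel_mul {q : ℝ≥0∞} (hq1 : 1 < q) (hq2 : q < 2)
    {ω₀ : ℝ × ℝ → ℝ} (hω₀ : MemLp ω₀ q (volume.restrict halfPlane)) {s : ℝ} (hs : 0 < s) (r : ℝ) :
    IntegrableOn (fun y => linePoissonKernel (s + y.2) (r - y.1) * ω₀ y) halfPlane := by
  obtain ⟨C, hC, hCle⟩ := exists_lintegral_bracket_le hq1 hq2 hω₀
  have hmP' : Measurable fun y : ℝ × ℝ => linePoissonKernel (s + y.2) (r - y.1) :=
    measurable_linePoissonKernel.comp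
      (f := fun y : ℝ × ℝ => ((r - y.1, s + y.2) : ℝ × ℝ)) (by fun_prop)
  refine (integrable_of_le_bracket hω₀.1 hC (hCle (reflect (r, s))) hmP'
    (M := √2 / Real.pi * √(1 + 1 / s ^ 2)) ?_).1
  filter_upwards [ae_pos_snd] with y hy
  have h := linePoissonKernel_le_bracket hs (z := (r, s) - reflect y)
    (by simp [reflect, hy.le])
  rw [bracket_reflect] at h
  simpa [reflect] using h

/-- The extension of the trace of the velocity by means of the Poisson kernel. -/
lemma integral_linePoissonKernel_eq_zero {q : ℝ≥0∞} (hq1 : 1 < q) (hq2 : q < 2)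
    {ω₀ : ℝ × ℝ → ℝ} (hω₀ : MemLp ω₀ q (volume.restrict halfPlane))
    (htrace : ∀ᵐ x₁ : ℝ, (biotSavart ω₀ (x₁, 0)).1 = 0) {s : ℝ} (hs : 0 < s) (r : ℝ) :
    ∫ y in halfPlane, linePoissonKernel (s + y.2) (r - y.1) * ω₀ y = 0 := by
  have hint := integrableOn_linePoissonKernel_mul hq1 hq2 hω₀ hs r
  have hmP : Measurable fun z : ℝ × (ℝ × ℝ) => linePoissonKernel z.2.2 (z.1 - z.2.1) :=
    measurable_linePoissonKernel.comp
      (f := fun z : ℝ × (ℝ × ℝ) => ((z.1 - z.2.1, z.2.2) : ℝ × ℝ)) (by fun_prop)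
  have hcont : Continuous fun x => linePoissonKernel s (r - x) :=
    (continuous_linePoissonKernel hs).comp (by fun_prop)
  have hkey : ∀ y : ℝ × ℝ, 0 < y.2 →
      ∫ x : ℝ, linePoissonKernel s (r - x) * linePoissonKernel y.2 (x - y.1)
        = linePoissonKernel (s + y.2) (r - y.1) := fun y hy => by
    rw [← poisson_conv_poisson hs hy,
      ← integral_sub_right_eq_self (fun x => linePoissonKernel s (r - y.1 - x) * _) y.1]
    refine integral_congr_ae (Eventually.of_forall fun x => ?_)
    simp only
    congr 2
    ring
  have hkint : ∀ y : ℝ × ℝ, 0 < y.2 →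
      Integrable fun x : ℝ => linePoissonKernel s (r - x) * linePoissonKernel y.2 (x - y.1) :=
    fun y hy => by
    -- A nonintegrable function has integral 0 by convention, and the value just computed is
    -- positive.
    refine Integrable.of_integral_ne_zero ?_
    rw [hkey y hy]
    unfold linePoissonKernel
    positivity
  have hprod : Integrable (Function.uncurry fun (x : ℝ) (y : ℝ × ℝ) =>
      linePoissonKernel s (r - x) * (linePoissonKernel y.2 (x - y.1) * ω₀ y))
      (volume.prod (volume.restrict halfPlane)) := by
    -- The kernels are positive, so integrating first along the line gives P_{s+y₂}(r - y₁) |ω₀(y)|,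
    -- which is integrable since s > 0; no bound near the boundary is needed.
    rw [integrable_prod_iff']
    · constructor
      · filter_upwards [ae_pos_snd] with y hy
        simpa [Function.uncurry, mul_assoc] using (hkint y hy).mul_const (ω₀ y)
      · refine hint.norm.congr ?_
        filter_upwards [ae_pos_snd] with y hy
        have h : ∀ x, ‖linePoissonKernel s (r - x) * (linePoissonKernel y.2 (x - y.1) * ω₀ y)‖
            = linePoissonKernel s (r - x) * linePoissonKernel y.2 (x - y.1) * ‖ω₀ y‖ := fun x => by
          rw [norm_mul, norm_mul, Real.norm_of_nonneg (linePoissonKernel_nonneg hs.le _),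
            Real.norm_of_nonneg (linePoissonKernel_nonneg hy.le _), mul_assoc]
        simp only [Function.uncurry, h]
        rw [integral_mul_const, hkey y hy, norm_mul, Real.norm_of_nonneg
          (linePoissonKernel_nonneg (by positivity) _)]
    · have h1 : AEStronglyMeasurable (fun z : ℝ × (ℝ × ℝ) => ω₀ z.2)
          ((volume : Measure ℝ).prod (volume.restrict halfPlane)) := hω₀.1.comp_snd
      exact (hcont.measurable.comp measurable_fst).aestronglyMeasurable.mul
        (hmP.aestronglyMeasurable.mul h1)
  have hswap := integral_integral_swap hprod
  -- In this order the inner integral is a multiple of the tangential trace, which vanishes almost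
  -- everywhere.
  have h1 : ∫ x : ℝ, ∫ y in halfPlane,
      linePoissonKernel s (r - x) * (linePoissonKernel y.2 (x - y.1) * ω₀ y) = 0 := by
    rw [← integral_zero ℝ ℝ (μ := volume)]
    refine integral_congr_ae ?_
    filter_upwards [htrace] with x hx
    rw [integral_const_mul]
    refine mul_eq_zero_of_right _ ?_
    rw [← hx]
    refine setIntegral_congr_fun measurableSet_halfPlane fun y hy => ?_
    rw [partial2_greenD hy]
  rw [h1] at hswap
  rw [hswap]
  refine setIntegral_congr_fun measurableSet_halfPlane fun y hy => ?_
  simp_rw [← mul_assoc]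
  rw [integral_mul_const, hkey y hy]

lemma re_inv_sq (a b : ℝ) :
    ((((a : ℂ) + b * Complex.I) ^ 2)⁻¹).re = (a ^ 2 - b ^ 2) / (a ^ 2 + b ^ 2) ^ 2 := by
  rw [Complex.inv_re, map_pow, Complex.normSq_add_mul_I, sq ((a : ℂ) + b * Complex.I)]
  simp
  ring

lemma abs_re_inv_sq_le (a b : ℝ) :
    |((((a : ℂ) + b * Complex.I) ^ 2)⁻¹).re| ≤ (a ^ 2 + b ^ 2)⁻¹ := by
  refine (Complex.abs_re_le_norm _).trans (le_of_eq ?_)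
  rw [norm_inv, norm_pow, Complex.sq_norm, Complex.normSq_add_mul_I]

lemma hasDerivAt_linePoissonKernel {s : ℝ} (hs : 0 < s) (r : ℝ) :
    HasDerivAt (fun s => linePoissonKernel s r)
      (-(1 / Real.pi) * ((((s : ℂ) + r * Complex.I) ^ 2)⁻¹).re) s := by
  have hpi := Real.pi_pos
  have h1 : HasDerivAt (fun s : ℝ => Real.pi * (r ^ 2 + s ^ 2)) (Real.pi * (2 * s)) s := by
    simpa using ((hasDerivAt_pow 2 s).const_add (r ^ 2)).const_mul Real.pi
  have h2 := (hasDerivAt_id s).div h1 (by positivity)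
  refine h2.congr_deriv ?_
  have : 0 < r ^ 2 + s ^ 2 := by positivity
  rw [re_inv_sq]
  simp only [id]
  field_simp
  ring

/-- The integral is, up to the factor -π, the s-derivative of the vanishing Poisson extension of the
trace. It is also, up to a constant, the small-time limit of the reflected part of T₀. -/
lemma integral_re_inv_sq_eq_zero {q : ℝ≥0∞} (hq1 : 1 < q) (hq2 : q < 2)
    {ω₀ : ℝ × ℝ → ℝ} (hω₀ : MemLp ω₀ q (volume.restrict halfPlane))
    (htrace : ∀ᵐ x₁ : ℝ, (biotSavart ω₀ (x₁, 0)).1 = 0) {s : ℝ} (hs : 0 < s) (r : ℝ) :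
    ∫ y in halfPlane, (((((s + y.2 : ℝ) : ℂ) + (r - y.1 : ℝ) * Complex.I) ^ 2)⁻¹).re * ω₀ y
      = 0 := by
  obtain ⟨C, hC, hCle⟩ := exists_lintegral_bracket_le hq1 hq2 hω₀
  have hpi := Real.pi_pos
  set M : ℝ := 8 / Real.pi * ((√(s ^ 2))⁻¹ * √(1 + 1 / s ^ 2)) with hM
  have hbint : IntegrableOn (fun y => (M * bracket (reflect (r, s) - y)) * ω₀ y) halfPlane := by
    refine (integrable_of_le_bracket hω₀.1 hC (hCle (reflect (r, s))) (M := M) ?_ ?_).1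
    · exact (measurable_bracket.comp (by fun_prop)).const_mul _
    · refine Eventually.of_forall fun y => ?_
      rw [abs_of_nonneg (mul_nonneg (by positivity) (bracket_nonneg _))]
  have hder := hasDerivAt_integral_of_dominated_loc_of_deriv_le (μ := volume.restrict halfPlane)
    (F := fun σ y => linePoissonKernel (σ + y.2) (r - y.1) * ω₀ y) (x₀ := s)
    (F' := fun σ y => (-(1 / Real.pi) *
      (((((σ + y.2 : ℝ) : ℂ) + (r - y.1 : ℝ) * Complex.I) ^ 2)⁻¹).re) * ω₀ y)
    (s := Ioi (s / 2)) (Ioi_mem_nhds (by linarith))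
    (bound := fun y => ‖(M * bracket (reflect (r, s) - y)) * ω₀ y‖) ?_
    (integrableOn_linePoissonKernel_mul hq1 hq2 hω₀ hs r) ?_ ?_ hbint.norm ?_
  · have h0 : (fun σ => ∫ y in halfPlane, linePoissonKernel (σ + y.2) (r - y.1) * ω₀ y)
        =ᶠ[𝓝 s] fun _ => 0 := by
      filter_upwards [Ioi_mem_nhds hs] with σ hσ
      exact integral_linePoissonKernel_eq_zero hq1 hq2 hω₀ htrace hσ r
    have h1 := hder.2.unique ((hasDerivAt_const s (0 : ℝ)).congr_of_eventuallyEq h0)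
    simp_rw [mul_assoc] at h1
    rw [integral_const_mul] at h1
    rcases mul_eq_zero.1 h1 with h | h
    · have : (1 / Real.pi) ≠ 0 := by positivity
      exact absurd (neg_eq_zero.1 h) this
    · exact h
  · filter_upwards [Ioi_mem_nhds hs] with σ hσ
    exact (integrableOn_linePoissonKernel_mul hq1 hq2 hω₀ hσ r).1
  · refine AEStronglyMeasurable.mul (Measurable.aestronglyMeasurable ?_) hω₀.1
    fun_prop
  · filter_upwards [ae_pos_snd] with y hy σ hσ
    have hσ' : s / 2 < σ := hσ
    have hσ0 : 0 < σ := by linarith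
    rw [norm_mul _ (ω₀ y), norm_mul _ (ω₀ y)]
    gcongr
    rw [Real.norm_of_nonneg (mul_nonneg (by positivity) (bracket_nonneg _)), norm_mul, norm_neg,
      Real.norm_of_nonneg (by positivity : 0 ≤ 1 / Real.pi), Real.norm_eq_abs, ← bracket_reflect]
    have hb := inv_le_bracket (t := s ^ 2) (by positivity) ((r, s) - reflect y)
    -- For σ > s/2 one has (σ + y₂)² ≥ (s + y₂)²/4, and 8 leaves room for the additional s².
    have h1 : ((σ + y.2) ^ 2 + (r - y.1) ^ 2)⁻¹
        ≤ 8 * (s ^ 2 + (((r, s) - reflect y).1 ^ 2 + ((r, s) - reflect y).2 ^ 2))⁻¹ := by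
      simp only [reflect, Prod.mk_sub_mk, sub_neg_eq_add]
      rw [← div_eq_mul_inv, inv_eq_one_div, div_le_div_iff₀ (by positivity) (by positivity)]
      nlinarith [sq_nonneg (r - y.1), mul_pos hs hy, mul_pos (hs.trans (by linarith : s < 2 * σ)) hy]
    calc 1 / Real.pi * |_| ≤ 1 / Real.pi * (8 * ((√(s ^ 2))⁻¹ * √(1 + 1 / s ^ 2) *
          bracket ((r, s) - reflect y))) := by
          gcongr
          refine (abs_re_inv_sq_le _ _).trans (h1.trans ?_)
          gcongr
      _ = _ := by rw [hM]; ring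
  · filter_upwards [ae_pos_snd] with y hy σ hσ
    have hσ' : s / 2 < σ := hσ
    exact ((hasDerivAt_linePoissonKernel (by linarith : 0 < σ + y.2) (r - y.1)).comp_add_const
      σ y.2).mul_const (ω₀ y)

/-! ### The operator T₀ on L^q and its initial values -/

lemma reflKernel_le_bracket {t : ℝ} (ht : 0 < t) (z : ℝ × ℝ) :
    |reflKernel t z| ≤ 352 / Real.pi * ((√t)⁻¹ * √(1 + 1 / t)) * bracket z := by
  have hpi := Real.pi_pos
  rw [mul_assoc]
  refine (abs_reflKernel_le ht z).trans ?_
  gcongr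
  exact inv_le_bracket ht z

lemma measurable_reflect : Measurable reflect := by unfold reflect; fun_prop

section

variable {q : ℝ≥0∞} {ω₀ : ℝ × ℝ → ℝ}

lemma heatKernel_mul_bound (hq1 : 1 < q) (hq2 : q < 2)
    (hω₀ : MemLp ω₀ q (volume.restrict halfPlane)) {t : ℝ} (ht : 0 < t) :
    ∃ C : ℝ≥0∞, C ≠ ∞ ∧ ∀ x, IntegrableOn (fun y => heatKernel t (x - y) * ω₀ y) halfPlane ∧
      ∫⁻ y in halfPlane, ‖heatKernel t (x - y) * ω₀ y‖ₑ ≤ C := by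
  obtain ⟨C, hC, hCle⟩ := exists_lintegral_bracket_le hq1 hq2 hω₀
  exact ⟨_, ENNReal.mul_ne_top enorm_ne_top hC, fun x =>
    integrable_of_le_bracket hω₀.1 hC (hCle x) ((measurable_heatKernel t).comp (by fun_prop))
    (Eventually.of_forall fun y => heatKernel_le_bracket ht (x - y))⟩

lemma reflKernel_mul_bound (hq1 : 1 < q) (hq2 : q < 2)
    (hω₀ : MemLp ω₀ q (volume.restrict halfPlane)) {t : ℝ} (ht : 0 < t) :
    ∃ C : ℝ≥0∞, C ≠ ∞ ∧ ∀ x,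
      IntegrableOn (fun y => reflKernel t (x - reflect y) * ω₀ y) halfPlane ∧
      ∫⁻ y in halfPlane, ‖reflKernel t (x - reflect y) * ω₀ y‖ₑ ≤ C := by
  obtain ⟨C, hC, hCle⟩ := exists_lintegral_bracket_le hq1 hq2 hω₀
  refine ⟨_, ENNReal.mul_ne_top enorm_ne_top hC, fun x =>
    integrable_of_le_bracket hω₀.1 hC (hCle (reflect x))
    ((measurable_reflKernel ht).comp (measurable_const.sub measurable_reflect))
    (M := 352 / Real.pi * ((√t)⁻¹ * √(1 + 1 / t)))
    (Eventually.of_forall fun y => ?_)⟩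
  rw [← bracket_reflect]
  exact reflKernel_le_bracket ht _

lemma kernelW0_mul_bound (hq1 : 1 < q) (hq2 : q < 2)
    (hω₀ : MemLp ω₀ q (volume.restrict halfPlane)) {t : ℝ} (ht : 0 < t) :
    ∃ C : ℝ≥0∞, C ≠ ∞ ∧ ∀ x, IntegrableOn (fun y => kernelW0 t x y * ω₀ y) halfPlane ∧
      ∫⁻ y in halfPlane, ‖kernelW0 t x y * ω₀ y‖ₑ ≤ C := by
  obtain ⟨C₁, hC₁, h₁⟩ := heatKernel_mul_bound hq1 hq2 hω₀ ht
  obtain ⟨C₂, hC₂, h₂⟩ := reflKernel_mul_bound hq1 hq2 hω₀ ht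
  have he : ∀ x y, kernelW0 t x y * ω₀ y
      = heatKernel t (x - y) * ω₀ y + reflKernel t (x - reflect y) * ω₀ y := fun x y => by
    rw [kernelW0_eq ht, add_mul]
  refine ⟨C₁ + C₂, ENNReal.add_ne_top.2 ⟨hC₁, hC₂⟩, fun x => ⟨?_, ?_⟩⟩
  · simp_rw [he]
    exact (h₁ x).1.add (h₂ x).1
  · simp_rw [he]
    calc _ ≤ ∫⁻ y in halfPlane, (‖heatKernel t (x - y) * ω₀ y‖ₑ
            + ‖reflKernel t (x - reflect y) * ω₀ y‖ₑ) := by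
          gcongr
          exact enorm_add_le _ _
      _ = _ := lintegral_add_left' (h₁ x).1.1.enorm _
      _ ≤ _ := add_le_add (h₁ x).2 (h₂ x).2

/-- Extending ω₀ by zero makes the Gauss part a convolution on the plane, where translations act. -/
lemma T0_eq (hq1 : 1 < q) (hq2 : q < 2) (hω₀ : MemLp ω₀ q (volume.restrict halfPlane)) {t : ℝ}
    (ht : 0 < t) (x : ℝ × ℝ) :
    T0 ω₀ t x = (∫ y, heatKernel t (x - y) * halfPlane.indicator ω₀ y)
      + ∫ y in halfPlane, reflKernel t (x - reflect y) * ω₀ y := by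
  obtain ⟨C₁, hC₁, h₁⟩ := heatKernel_mul_bound hq1 hq2 hω₀ ht
  obtain ⟨C₂, hC₂, h₂⟩ := reflKernel_mul_bound hq1 hq2 hω₀ ht
  unfold T0
  simp_rw [kernelW0_eq ht, add_mul]
  rw [integral_add (h₁ x).1 (h₂ x).1, ← integral_indicator measurableSet_halfPlane]
  congr 2
  ext y
  by_cases hy : y ∈ halfPlane <;> simp [hy]

lemma measurable_kernelW0 {t : ℝ} (ht : 0 < t) :
    Measurable (Function.uncurry fun x y => kernelW0 t x y) := by
  simp_rw [kernelW0_eq ht]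
  exact ((measurable_heatKernel t).comp (f := fun z : (ℝ × ℝ) × (ℝ × ℝ) => z.1 - z.2)
    (by fun_prop)).add ((measurable_reflKernel ht).comp
    (measurable_fst.sub (measurable_reflect.comp measurable_snd)))

lemma measurable_reflKernel_uncurry {t : ℝ} (ht : 0 < t) :
    Measurable (Function.uncurry fun x y : ℝ × ℝ => reflKernel t (x - reflect y)) :=
  (measurable_reflKernel ht).comp (measurable_fst.sub (measurable_reflect.comp measurable_snd))

lemma inv_reflect_le {t : ℝ} (ht : 0 ≤ t) {x y : ℝ × ℝ} (hx : 0 < x.2) (hy : 0 < y.2) :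
    (t + ((x - reflect y).1 ^ 2 + (x - reflect y).2 ^ 2))⁻¹
      ≤ ((x.1 - y.1) ^ 2 + (x.2 + y.2) ^ 2)⁻¹ := by
  simp only [reflect, Prod.fst_sub, Prod.snd_sub, sub_neg_eq_add]
  exact inv_anti₀ (by positivity) (by linarith)

lemma memLp_indicator_halfPlane (hω₀ : MemLp ω₀ q (volume.restrict halfPlane)) :
    MemLp (halfPlane.indicator ω₀) q volume :=
  (memLp_indicator_iff_restrict measurableSet_halfPlane).2 hω₀

lemma memLp_T0 (hq1 : 1 < q) (hq2 : q < 2) (hω₀ : MemLp ω₀ q (volume.restrict halfPlane)) {t : ℝ}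
    (ht : 0 < t) : MemLp (T0 ω₀ t) q (volume.restrict halfPlane) := by
  have hqt : q ≠ ∞ := (hq2.trans (by norm_num)).ne
  have hq0 : q ≠ 0 := (zero_lt_one.trans hq1).ne'
  have hpi := Real.pi_pos
  have h1 := (memLp_heatKernel_conv hq1 hq2 ht (memLp_indicator_halfPlane hω₀)).restrict halfPlane
  have h2 : MemLp (fun x => ∫ y in halfPlane, reflKernel t (x - reflect y) * ω₀ y) q
      (volume.restrict halfPlane) := by
    refine (dominatedKernel_reflect hq1 hq2 (352 / Real.pi) (by positivity) hω₀).memLp hq0 hqt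
      (measurable_reflKernel_uncurry ht) hω₀.1 ?_
    filter_upwards [ae_pos_snd] with x hx
    filter_upwards [ae_pos_snd] with y hy
    refine (abs_reflKernel_le ht _).trans ?_
    exact mul_le_mul_of_nonneg_left (inv_reflect_le ht.le hx hy) (by positivity)
  exact (h1.add h2).ae_eq (Eventually.of_forall fun x => (T0_eq hq1 hq2 hω₀ ht x).symm)

/-- The initial condition. -/
lemma tendsto_T0 (hq1 : 1 < q) (hq2 : q < 2) (hω₀ : MemLp ω₀ q (volume.restrict halfPlane))
    (htrace : ∀ᵐ x₁ : ℝ, (biotSavart ω₀ (x₁, 0)).1 = 0) :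
    Tendsto (fun t : ℝ => eLpNorm (fun x => T0 ω₀ t x - ω₀ x) q (volume.restrict halfPlane))
      (𝓝[>] 0) (𝓝 0) := by
  have hqt : q ≠ ∞ := (hq2.trans (by norm_num)).ne
  have hq0 : q ≠ 0 := (zero_lt_one.trans hq1).ne'
  have hpi := Real.pi_pos
  set f := halfPlane.indicator ω₀ with hf
  have hfm : MemLp f q volume := memLp_indicator_halfPlane hω₀
  -- The pointwise limit of the reflected kernel, that is, twice the normal derivative of the
  -- Poisson kernel at height x₂ + y₂.
  set k₀ : ℝ × ℝ → ℝ × ℝ → ℝ := fun x y => -(2 / Real.pi) *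
    (((((x.2 + y.2 : ℝ) : ℂ) + (x.1 - y.1 : ℝ) * Complex.I) ^ 2)⁻¹).re with hk₀
  have h1 := tendsto_heatKernel_conv hq1 hq2 hfm
  have h2 := (dominatedKernel_reflect hq1 hq2 (352 / Real.pi) (by positivity) hω₀).tendsto hq0 hqt
    (l := 𝓝[>] (0 : ℝ)) (k := fun t x y => reflKernel t (x - reflect y)) (k₀ := k₀)
    (by simp only [Function.uncurry_def]; fun_prop)
    (eventually_mem_nhdsWithin.mono fun t ht => measurable_reflKernel_uncurry ht)
    (by simp only [Function.uncurry_def, hk₀]; fun_prop) hω₀.1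
    (S := halfPlane) (ae_restrict_mem measurableSet_halfPlane)
    (by
      filter_upwards [self_mem_nhdsWithin] with t ht x hx
      filter_upwards [ae_pos_snd] with y hy
      have ht' : (0 : ℝ) < t := ht
      refine (abs_reflKernel_le ht' _).trans ?_
      exact mul_le_mul_of_nonneg_left (inv_reflect_le ht'.le hx hy) (by positivity))
    (by
      intro x hx
      refine Eventually.of_forall fun y => ?_
      rw [hk₀, abs_mul, abs_neg, abs_of_pos (by positivity : 0 < 2 / Real.pi)]
      refine mul_le_mul (by gcongr; norm_num) ((abs_re_inv_sq_le _ _).trans (le_of_eq ?_))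
        (abs_nonneg _) (by positivity)
      rw [add_comm])
    (by
      intro x hx
      -- The pointwise limit was shown for nonzero tangential distance; the exceptional y form a
      -- null line.
      have hne : ∀ᵐ y : ℝ × ℝ ∂(volume.restrict halfPlane), y.1 ≠ x.1 := by
        refine ae_restrict_of_ae ?_
        rw [Measure.volume_eq_prod]
        have h : ∀ᵐ a : ℝ, a ≠ x.1 := by simp [ae_iff, measure_singleton]
        exact Measure.quasiMeasurePreserving_fst.ae h
      filter_upwards [hne, ae_pos_snd] with y hy1 hy2
      have hx' : 0 < x.2 := hx
      have := tendsto_reflKernel (z := x - reflect y)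
        (by simpa [reflect, sub_eq_zero] using hy1.symm) (by simp [reflect]; linarith)
      simpa [reflect, hk₀] using this)
  -- The trace condition enters here: the limiting operator annihilates ω₀, so only the approximate
  -- identity survives.
  have hk0 : ∀ x ∈ halfPlane, ∫ y in halfPlane, k₀ x y * ω₀ y = 0 := fun x hx => by
    have := integral_re_inv_sq_eq_zero hq1 hq2 hω₀ htrace hx x.1
    simp_rw [hk₀, mul_assoc]
    rw [integral_const_mul]
    exact mul_eq_zero_of_right _ this
  have hsum := h1.add h2
  rw [add_zero] at hsum
  refine tendsto_of_tendsto_of_tendsto_of_le_of_le' tendsto_const_nhds hsum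
    (Eventually.of_forall fun _ => zero_le) ?_
  filter_upwards [self_mem_nhdsWithin] with t ht
  have ht' : (0 : ℝ) < t := ht
  have he : (fun x => T0 ω₀ t x - ω₀ x) =ᵐ[volume.restrict halfPlane]
      (fun x => (∫ y, heatKernel t (x - y) * f y) - f x) + fun x =>
        (∫ y in halfPlane, reflKernel t (x - reflect y) * ω₀ y)
          - ∫ y in halfPlane, k₀ x y * ω₀ y := by
    filter_upwards [ae_restrict_mem measurableSet_halfPlane] with x hx
    rw [Pi.add_apply, hk0 x hx, T0_eq hq1 hq2 hω₀ ht', hf, indicator_of_mem hx]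
    ring
  rw [eLpNorm_congr_ae he]
  refine (eLpNorm_add_le ?_ ?_ hq1.le).trans (add_le_add ?_ le_rfl)
  · exact (((memLp_heatKernel_conv hq1 hq2 ht' hfm).sub hfm).restrict halfPlane).1
  · refine (aestronglyMeasurable_integral_kernel (measurable_reflKernel_uncurry ht') hω₀.1).sub
      (aestronglyMeasurable_integral_kernel ?_ hω₀.1)
    simp only [Function.uncurry_def, hk₀]; fun_prop
  · exact eLpNorm_mono_measure _ Measure.restrict_le_self

end

/-! ### Smoothness of exponential integrals -/

section ExpFamily

variable {α V : Type} [MeasurableSpace α] [NormedAddCommGroup V] [NormedSpace ℝ V]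

/-- The integrals `∫ exp(φ y p) T(y) dy` converge, locally uniformly in `p ∈ U` and with a margin
that makes up for powers of `‖φ y‖`. -/
def ExpIntegrable {G : Type} [NormedAddCommGroup G] (μ : Measure α) (φ : α → V →L[ℝ] ℝ) (U : Set V)
    (T : α → G) : Prop :=
  AEStronglyMeasurable T μ ∧
    ∀ p ∈ U, ∃ ε > 0, Integrable (fun y => Real.exp (φ y p + ε * ‖φ y‖) * ‖T y‖) μ

variable {μ : Measure α} {φ : α → V →L[ℝ] ℝ} {U : Set V}
  {G G' : Type} [NormedAddCommGroup G] [NormedAddCommGroup G'] {T : α → G}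

lemma norm_mul_exp_le {ε a : ℝ} (hε : 0 < ε) (n : ℝ) :
    n * Real.exp (a + ε / 2 * n) ≤ 2 / ε * Real.exp (a + ε * n) := by
  have h1 : ε / 2 * n ≤ Real.exp (ε / 2 * n) := by
    linarith [Real.add_one_le_exp (ε / 2 * n)]
  have h2 : Real.exp (a + ε * n) = Real.exp (a + ε / 2 * n) * Real.exp (ε / 2 * n) := by
    rw [← Real.exp_add]; congr 1; ring
  rw [h2]
  calc n * Real.exp (a + ε / 2 * n) = 2 / ε * (Real.exp (a + ε / 2 * n) * (ε / 2 * n)) := by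
        field_simp
    _ ≤ _ := by gcongr

/-- Half of the margin ε pays for a factor ‖φ y‖. Any positive margin suffices, so the class is
stable under repeated differentiation. -/
lemma ExpIntegrable.of_norm_le (hφ : AEStronglyMeasurable φ μ) (hT : ExpIntegrable μ φ U T)
    {T' : α → G'} (hT' : AEStronglyMeasurable T' μ) {c : ℝ} (hc : 0 ≤ c)
    (h : ∀ y, ‖T' y‖ ≤ c * (‖φ y‖ * ‖T y‖)) : ExpIntegrable μ φ U T' := by
  refine ⟨hT', fun p hp => ?_⟩
  obtain ⟨ε, hε, hi⟩ := hT.2 p hp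
  refine ⟨ε / 2, by positivity, (hi.const_mul (c * (2 / ε))).mono' ?_
    (Eventually.of_forall fun y => ?_)⟩
  · have h1 : AEStronglyMeasurable (fun y => φ y p) μ :=
      (ContinuousLinearMap.apply ℝ ℝ p).continuous.comp_aestronglyMeasurable hφ
    exact (Real.continuous_exp.comp_aestronglyMeasurable
      (h1.add (hφ.norm.const_mul _))).mul hT'.norm
  · rw [Real.norm_of_nonneg (by positivity)]
    calc Real.exp (φ y p + ε / 2 * ‖φ y‖) * ‖T' y‖
        ≤ Real.exp (φ y p + ε / 2 * ‖φ y‖) * (c * (‖φ y‖ * ‖T y‖)) := by gcongr; exact h y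
      _ = c * (‖φ y‖ * Real.exp (φ y p + ε / 2 * ‖φ y‖)) * ‖T y‖ := by ring
      _ ≤ c * (2 / ε * Real.exp (φ y p + ε * ‖φ y‖)) * ‖T y‖ :=
          mul_le_mul_of_nonneg_right (mul_le_mul_of_nonneg_left (norm_mul_exp_le hε _) hc)
            (norm_nonneg _)
      _ = _ := by ring

variable [NormedSpace ℝ G] [NormedSpace ℝ G']

lemma ExpIntegrable.smulRight (hφ : AEStronglyMeasurable φ μ) (hT : ExpIntegrable μ φ U T) :
    ExpIntegrable μ φ U fun y => (φ y).smulRight (T y) := by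
  refine hT.of_norm_le hφ ?_ (c := 1) zero_le_one fun y => ?_
  · exact (ContinuousLinearMap.smulRightL ℝ V G).continuous₂.comp_aestronglyMeasurable
      (hφ.prodMk hT.1)
  · rw [one_mul, ContinuousLinearMap.norm_smulRight_apply]

lemma ExpIntegrable.integrable (hφ : AEStronglyMeasurable φ μ) (hT : ExpIntegrable μ φ U T) {p : V}
    (hp : p ∈ U) : Integrable (fun y => Real.exp (φ y p) • T y) μ := by
  obtain ⟨ε, hε, hi⟩ := hT.2 p hp
  have h1 : AEStronglyMeasurable (fun y => φ y p) μ :=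
    (ContinuousLinearMap.apply ℝ ℝ p).continuous.comp_aestronglyMeasurable hφ
  refine hi.mono' ((Real.continuous_exp.comp_aestronglyMeasurable h1).smul hT.1)
    (Eventually.of_forall fun y => ?_)
  rw [norm_smul, Real.norm_of_nonneg (Real.exp_pos _).le]
  gcongr
  have : 0 ≤ ε * ‖φ y‖ := by positivity
  linarith

lemma ExpIntegrable.hasFDerivAt (hφ : AEStronglyMeasurable φ μ) (hT : ExpIntegrable μ φ U T)
    (hU : IsOpen U) {p : V} (hp : p ∈ U) :
    HasFDerivAt (fun p => ∫ y, Real.exp (φ y p) • T y ∂μ)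
      (∫ y, Real.exp (φ y p) • (φ y).smulRight (T y) ∂μ) p := by
  obtain ⟨ε, hε, hi⟩ := hT.2 p hp
  have hT' := hT.smulRight hφ
  -- On a ball of radius ε/2 the exponent grows by at most ε/2 ‖φ y‖; the other half of the margin
  -- absorbs the factor ‖φ y‖ of the derivative.
  refine hasFDerivAt_integral_of_dominated_of_fderiv_le (s := Metric.ball p (ε / 2))
    (bound := fun y => 2 / ε * (Real.exp (φ y p + ε * ‖φ y‖) * ‖T y‖))
    (F' := fun p y => Real.exp (φ y p) • (φ y).smulRight (T y))
    (Metric.ball_mem_nhds p (by positivity)) ?_ (hT.integrable hφ hp) (hT'.integrable hφ hp).1 ?_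
    (hi.const_mul _) ?_
  · filter_upwards [hU.mem_nhds hp] with p' hp'
    exact (hT.integrable hφ hp').1
  · refine Eventually.of_forall fun y p' hp' => ?_
    rw [norm_smul, ContinuousLinearMap.norm_smulRight_apply,
      Real.norm_of_nonneg (Real.exp_pos _).le]
    have h1 : φ y p' ≤ φ y p + ε / 2 * ‖φ y‖ := by
      have h2 : φ y (p' - p) ≤ ‖φ y‖ * ‖p' - p‖ :=
        (le_abs_self _).trans ((φ y).le_opNorm _)
      have h3 : ‖p' - p‖ ≤ ε / 2 := by
        rw [← dist_eq_norm]; exact (Metric.mem_ball.1 hp').le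
      rw [map_sub] at h2
      nlinarith [norm_nonneg (φ y)]
    calc Real.exp (φ y p') * (‖φ y‖ * ‖T y‖)
        ≤ Real.exp (φ y p + ε / 2 * ‖φ y‖) * (‖φ y‖ * ‖T y‖) := by gcongr
      _ = ‖φ y‖ * Real.exp (φ y p + ε / 2 * ‖φ y‖) * ‖T y‖ := by ring
      _ ≤ 2 / ε * Real.exp (φ y p + ε * ‖φ y‖) * ‖T y‖ :=
          mul_le_mul_of_nonneg_right (norm_mul_exp_le hε _) (norm_nonneg _)
      _ = _ := by ring
  · refine Eventually.of_forall fun y p' _ => ?_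
    have h := ((φ y).hasFDerivAt (x := p')).exp.smul_const (T y)
    refine h.congr_fderiv ?_
    ext v
    simp [mul_smul]

/-- Integrals of exponential families are smooth in the parameter. -/
lemma ExpIntegrable.contDiffOn (hφ : AEStronglyMeasurable φ μ) (hU : IsOpen U) (n : ℕ) :
    ∀ {G : Type} [NormedAddCommGroup G] [NormedSpace ℝ G] {T : α → G}, ExpIntegrable μ φ U T →
      ContDiffOn ℝ n (fun p => ∫ y, Real.exp (φ y p) • T y ∂μ) U := by
  -- The derivative is an integral of the same form with values in V →L[ℝ] G, so the target space
  -- has to vary in the induction.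
  induction n with
  | zero =>
    intro G _ _ T hT
    exact contDiffOn_zero.2 fun p hp =>
      (hT.hasFDerivAt hφ hU hp).continuousAt.continuousWithinAt
  | succ n ih =>
    intro G _ _ T hT
    push_cast
    rw [contDiffOn_succ_iff_fderiv_of_isOpen hU]
    refine ⟨fun p hp => (hT.hasFDerivAt hφ hU hp).differentiableAt.differentiableWithinAt,
      fun h => by simp at h, ?_⟩
    refine (ih (hT.smulRight hφ)).congr fun p hp => ?_
    exact (hT.hasFDerivAt hφ hU hp).fderiv

lemma ExpIntegrable.apply_mul (hφ : AEStronglyMeasurable φ μ) {T : α → ℝ}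
    (hT : ExpIntegrable μ φ U T) (v : V) : ExpIntegrable μ φ U fun y => φ y v * T y := by
  refine hT.of_norm_le hφ ?_ (c := ‖v‖) (norm_nonneg _) fun y => ?_
  · exact ((ContinuousLinearMap.apply ℝ ℝ v).continuous.comp_aestronglyMeasurable hφ).mul hT.1
  · rw [norm_mul]
    calc ‖φ y v‖ * ‖T y‖ ≤ (‖φ y‖ * ‖v‖) * ‖T y‖ := by gcongr; exact (φ y).le_opNorm v
      _ = _ := by ring

/-- The derivative of an exponential integral along a curve of parameters. -/
lemma ExpIntegrable.hasDerivAt_comp (hφ : AEStronglyMeasurable φ μ) {T : α → ℝ}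
    (hT : ExpIntegrable μ φ U T) (hU : IsOpen U) {p : ℝ → V} {v : V} {s : ℝ} (hp : p s ∈ U)
    (hv : HasDerivAt p v s) :
    HasDerivAt (fun s => ∫ y, Real.exp (φ y (p s)) * T y ∂μ)
      (∫ y, Real.exp (φ y (p s)) * (φ y v * T y) ∂μ) s := by
  have h := (hT.hasFDerivAt hφ hU hp).comp_hasDerivAt s hv
  refine h.congr_deriv ?_
  rw [ContinuousLinearMap.integral_apply ((hT.smulRight hφ).integrable hφ hp)]
  rfl

end ExpFamily

/-! ### Gaussian integrals as solutions of the heat equation -/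

/-- The exponent of the Gauss kernel as a linear functional of the parameters
`(1 / 4t, x₁ / 2t, x₂ / 2t)`. -/
def gaussExponent (y : ℝ × ℝ) : (ℝ × ℝ × ℝ) →L[ℝ] ℝ :=
  -(y.1 ^ 2 + y.2 ^ 2) • ContinuousLinearMap.fst ℝ ℝ (ℝ × ℝ)
    + y.1 • (ContinuousLinearMap.fst ℝ ℝ ℝ).comp (ContinuousLinearMap.snd ℝ ℝ (ℝ × ℝ))
    + y.2 • (ContinuousLinearMap.snd ℝ ℝ ℝ).comp (ContinuousLinearMap.snd ℝ ℝ (ℝ × ℝ))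

lemma gaussExponent_apply (y : ℝ × ℝ) (p : ℝ × ℝ × ℝ) :
    gaussExponent y p = -(y.1 ^ 2 + y.2 ^ 2) * p.1 + y.1 * p.2.1 + y.2 * p.2.2 := rfl

lemma aestronglyMeasurable_gaussExponent {μ : Measure (ℝ × ℝ)} :
    AEStronglyMeasurable gaussExponent μ := by
  have : Continuous gaussExponent := by unfold gaussExponent; fun_prop
  exact this.aestronglyMeasurable

lemma norm_gaussExponent_le (y : ℝ × ℝ) :
    ‖gaussExponent y‖ ≤ y.1 ^ 2 + y.2 ^ 2 + |y.1| + |y.2| := by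
  refine ContinuousLinearMap.opNorm_le_bound _ (by positivity) fun p => ?_
  rw [gaussExponent_apply, Real.norm_eq_abs]
  have h1 : |p.1| ≤ ‖p‖ := norm_fst_le p
  have h2 : |p.2.1| ≤ ‖p‖ := (norm_fst_le p.2).trans (norm_snd_le p)
  have h3 : |p.2.2| ≤ ‖p‖ := (norm_snd_le p.2).trans (norm_snd_le p)
  calc |-(y.1 ^ 2 + y.2 ^ 2) * p.1 + y.1 * p.2.1 + y.2 * p.2.2|
      ≤ |-(y.1 ^ 2 + y.2 ^ 2) * p.1| + |y.1 * p.2.1| + |y.2 * p.2.2| := abs_add_three _ _ _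
    _ = (y.1 ^ 2 + y.2 ^ 2) * |p.1| + |y.1| * |p.2.1| + |y.2| * |p.2.2| := by
        rw [abs_mul, abs_mul, abs_mul, abs_neg, abs_of_nonneg (by positivity : 0 ≤ y.1 ^ 2 + y.2 ^ 2)]
    _ ≤ (y.1 ^ 2 + y.2 ^ 2) * ‖p‖ + |y.1| * ‖p‖ + |y.2| * ‖p‖ := by gcongr
    _ = _ := by ring

/-- The half space of admissible parameters. -/
def gaussParams : Set (ℝ × ℝ × ℝ) := {p | 0 < p.1}

lemma isOpen_gaussParams : IsOpen gaussParams := isOpen_lt continuous_const continuous_fst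

lemma integrable_exp_neg_mul_sq_add_sq {c : ℝ} (hc : 0 < c) :
    Integrable fun y : ℝ × ℝ => Real.exp (-(c * (y.1 ^ 2 + y.2 ^ 2))) := by
  have hpi := Real.pi_pos
  refine ((integrable_heatKernel (t := 1 / (4 * c)) (by positivity)).const_mul
    (Real.pi / c)).congr (Eventually.of_forall fun y => ?_)
  simp only [heatKernel]
  rw [← mul_assoc]
  convert one_mul _ using 2
  · field_simp
  · field_simp

lemma expIntegrable_of_bounded {f : ℝ × ℝ → ℝ} (hf : AEStronglyMeasurable f volume) {K : ℝ}
    (hK : ∀ y, |f y| ≤ K) : ExpIntegrable volume gaussExponent gaussParams f := by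
  refine ⟨hf, fun p hp => ?_⟩
  have hp' : 0 < p.1 := hp
  -- Of the Gaussian rate 2ε, the margin uses ε; half of the remainder absorbs the linear terms by
  -- completing squares and ε/2 is left for integrability.
  set ε := p.1 / 2 with hε
  have hε0 : 0 < ε := by positivity
  refine ⟨ε, hε0, ?_⟩
  set c := ((|p.2.1| + ε) ^ 2 + (|p.2.2| + ε) ^ 2) / (2 * ε) with hc
  have hK0 : 0 ≤ K := (abs_nonneg _).trans (hK 0)
  refine ((integrable_exp_neg_mul_sq_add_sq (c := ε / 2) (by positivity)).const_mul
    (Real.exp c * K)).mono' ?_ (Eventually.of_forall fun y => ?_)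
  · have h1 : AEStronglyMeasurable (fun y => gaussExponent y p) volume :=
      (ContinuousLinearMap.apply ℝ ℝ p).continuous.comp_aestronglyMeasurable
        aestronglyMeasurable_gaussExponent
    exact (Real.continuous_exp.comp_aestronglyMeasurable
      (h1.add (aestronglyMeasurable_gaussExponent.norm.const_mul _))).mul hf.norm
  · rw [Real.norm_of_nonneg (by positivity)]
    have hq : ∀ a b : ℝ, (|a| + ε) * |b| ≤ ε / 2 * b ^ 2 + (|a| + ε) ^ 2 / (2 * ε) := fun a b => by
      have h : 0 ≤ (ε * |b| - (|a| + ε)) ^ 2 / (2 * ε) := by positivity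
      have e : (ε * |b| - (|a| + ε)) ^ 2 / (2 * ε)
          = ε / 2 * |b| ^ 2 + (|a| + ε) ^ 2 / (2 * ε) - (|a| + ε) * |b| := by field_simp; ring
      rw [e, sq_abs] at h
      linarith
    have h0 : gaussExponent y p + ε * ‖gaussExponent y‖ ≤ c + -(ε / 2 * (y.1 ^ 2 + y.2 ^ 2)) := by
      have h1 := norm_gaussExponent_le y
      have h2 := hq p.2.1 y.1
      have h3 := hq p.2.2 y.2
      have h4 : y.1 * p.2.1 ≤ |p.2.1| * |y.1| := by
        rw [mul_comm, ← abs_mul]; exact le_abs_self _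
      have h5 : y.2 * p.2.2 ≤ |p.2.2| * |y.2| := by
        rw [mul_comm, ← abs_mul]; exact le_abs_self _
      have h6 : p.1 = 2 * ε := by rw [hε]; ring
      have h7 := mul_le_mul_of_nonneg_left h1 hε0.le
      rw [gaussExponent_apply, h6]
      have h8 : c = (|p.2.1| + ε) ^ 2 / (2 * ε) + (|p.2.2| + ε) ^ 2 / (2 * ε) := by
        rw [hc]; ring
      rw [h8]
      nlinarith
    calc Real.exp (gaussExponent y p + ε * ‖gaussExponent y‖) * ‖f y‖
        ≤ Real.exp (c + -(ε / 2 * (y.1 ^ 2 + y.2 ^ 2))) * K := by gcongr; exact hK y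
      _ = _ := by rw [Real.exp_add]; ring

/-- The parameters of the Gauss kernel. -/
def gaussParam (t : ℝ) (x : ℝ × ℝ) : ℝ × ℝ × ℝ := (1 / (4 * t), x.1 / (2 * t), x.2 / (2 * t))

/-- The Gaussian integral `∫ Γ(x - y, t) T(y) dy`. -/
def caloric (T : ℝ × ℝ → ℝ) (t : ℝ) (x : ℝ × ℝ) : ℝ :=
  heatKernel t x * ∫ y, Real.exp (gaussExponent y (gaussParam t x)) * T y

lemma integral_heatKernel_eq_caloric {t : ℝ} (ht : 0 < t) (T : ℝ × ℝ → ℝ) (x : ℝ × ℝ) :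
    ∫ y, heatKernel t (x - y) * T y = caloric T t x := by
  unfold caloric
  rw [← integral_const_mul]
  refine integral_congr_ae (Eventually.of_forall fun y => ?_)
  simp only [heatKernel, gaussExponent_apply, gaussParam]
  rw [← mul_assoc, mul_assoc (1 / (4 * Real.pi * t)) (Real.exp _) (Real.exp _), ← Real.exp_add]
  congr 3
  simp only [Prod.fst_sub, Prod.snd_sub]
  field_simp
  ring

lemma gaussParam_mem {t : ℝ} (ht : 0 < t) (x : ℝ × ℝ) : gaussParam t x ∈ gaussParams := by
  simp only [gaussParam, gaussParams, mem_ofPred_eq]; positivity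

lemma contDiffOn_caloric {T : ℝ × ℝ → ℝ} (hT : ExpIntegrable volume gaussExponent gaussParams T)
    (n : ℕ) :
    ContDiffOn ℝ n (fun p : ℝ × (ℝ × ℝ) => caloric T p.1 p.2) (Ioi (0 : ℝ) ×ˢ univ) := by
  have hne : ∀ p ∈ Ioi (0 : ℝ) ×ˢ (univ : Set (ℝ × ℝ)), p.1 ≠ 0 := fun p hp => hp.1.ne'
  have hpi := Real.pi_ne_zero
  have h1 : ContDiffOn ℝ n (fun p : ℝ × (ℝ × ℝ) => heatKernel p.1 p.2) (Ioi (0 : ℝ) ×ˢ univ) := by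
    unfold heatKernel
    refine ContDiffOn.mul (ContDiffOn.div (by fun_prop) (by fun_prop) ?_)
      (ContDiffOn.exp (ContDiffOn.div (by fun_prop) (by fun_prop) ?_))
    · intro p hp; have := hne p hp; positivity
    · intro p hp; have := hne p hp; positivity
  have h2 : ContDiffOn ℝ n (fun p : ℝ × (ℝ × ℝ) => gaussParam p.1 p.2) (Ioi (0 : ℝ) ×ˢ univ) := by
    unfold gaussParam
    refine ContDiffOn.prodMk (ContDiffOn.div (by fun_prop) (by fun_prop) ?_)
      (ContDiffOn.prodMk (ContDiffOn.div (by fun_prop) (by fun_prop) ?_)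
      (ContDiffOn.div (by fun_prop) (by fun_prop) ?_)) <;>
    · intro p hp; have := hne p hp; positivity
  have h3 := ExpIntegrable.contDiffOn aestronglyMeasurable_gaussExponent isOpen_gaussParams n hT
  exact h1.mul (h3.comp h2 fun p hp => gaussParam_mem hp.1 _)

lemma hasDerivAt_heatKernel_fst {t : ℝ} (ht : 0 < t) (r b : ℝ) :
    HasDerivAt (fun r => heatKernel t (r, b)) (-(r / (2 * t)) * heatKernel t (r, b)) r := by
  have h1 : HasDerivAt (fun r : ℝ => -(r ^ 2 + b ^ 2) / (4 * t)) (-(2 * r) / (4 * t)) r := by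
    simpa using ((((hasDerivAt_pow 2 r).add_const (b ^ 2)).neg).div_const (4 * t))
  refine (h1.exp.const_mul (1 / (4 * Real.pi * t))).congr_deriv ?_
  simp only [heatKernel]
  field_simp
  ring

lemma hasDerivAt_heatKernel_snd {t : ℝ} (ht : 0 < t) (r b : ℝ) :
    HasDerivAt (fun b => heatKernel t (r, b)) (-(b / (2 * t)) * heatKernel t (r, b)) b := by
  have h := hasDerivAt_heatKernel_fst ht b r
  have e : ∀ x y, heatKernel t (x, y) = heatKernel t (y, x) := fun x y => by
    simp only [heatKernel, add_comm]
  rw [e]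
  exact h.congr_of_eventuallyEq (Eventually.of_forall fun b => e _ _)

lemma hasDerivAt_heatKernel_time {t : ℝ} (ht : 0 < t) (x : ℝ × ℝ) :
    HasDerivAt (fun τ => heatKernel τ x)
      ((-(1 / t) + (x.1 ^ 2 + x.2 ^ 2) / (4 * t ^ 2)) * heatKernel t x) t := by
  have hpi := Real.pi_pos
  have h1 : HasDerivAt (fun τ : ℝ => 4 * Real.pi * τ) (4 * Real.pi) t := by
    simpa using (hasDerivAt_id t).const_mul (4 * Real.pi)
  have h2 : HasDerivAt (fun τ : ℝ => 4 * τ) 4 t := by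
    simpa using (hasDerivAt_id t).const_mul (4 : ℝ)
  have h3 := ((hasDerivAt_const t (1 : ℝ)).div h1 (by positivity)).mul
    (((hasDerivAt_const t (-(x.1 ^ 2 + x.2 ^ 2))).div h2 (by positivity)).exp)
  refine h3.congr_deriv ?_
  simp only [heatKernel, Pi.div_apply]
  field_simp
  ring

section

variable {T : ℝ × ℝ → ℝ}

lemma expIntegrable_fst_mul (hT : ExpIntegrable volume gaussExponent gaussParams T) (c : ℝ) :
    ExpIntegrable volume gaussExponent gaussParams fun y => y.1 / c * T y := by
  have := hT.apply_mul aestronglyMeasurable_gaussExponent (0, 1 / c, 0)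
  simpa [gaussExponent_apply, div_eq_mul_inv] using this

lemma expIntegrable_snd_mul (hT : ExpIntegrable volume gaussExponent gaussParams T) (c : ℝ) :
    ExpIntegrable volume gaussExponent gaussParams fun y => y.2 / c * T y := by
  have := hT.apply_mul aestronglyMeasurable_gaussExponent (0, 0, 1 / c)
  simpa [gaussExponent_apply, div_eq_mul_inv] using this

lemma hasDerivAt_caloric_fst (hT : ExpIntegrable volume gaussExponent gaussParams T) {t : ℝ}
    (ht : 0 < t) (r b : ℝ) :
    HasDerivAt (fun r => caloric T t (r, b))
      (-(r / (2 * t)) * caloric T t (r, b) + caloric (fun y => y.1 / (2 * t) * T y) t (r, b)) r := by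
  have hp : HasDerivAt (fun r => gaussParam t (r, b)) (0, 1 / (2 * t), 0) r := by
    unfold gaussParam
    exact (hasDerivAt_const r (1 / (4 * t))).prodMk (((hasDerivAt_id r).div_const (2 * t)).prodMk
      (hasDerivAt_const r (b / (2 * t))))
  have h := (hasDerivAt_heatKernel_fst ht r b).mul
    (hT.hasDerivAt_comp aestronglyMeasurable_gaussExponent isOpen_gaussParams
      (gaussParam_mem ht (r, b)) hp)
  refine h.congr_deriv ?_
  simp only [caloric, gaussExponent_apply, mul_zero, zero_add, add_zero, mul_one_div]
  ring

lemma hasDerivAt_caloric_snd (hT : ExpIntegrable volume gaussExponent gaussParams T) {t : ℝ}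
    (ht : 0 < t) (r b : ℝ) :
    HasDerivAt (fun b => caloric T t (r, b))
      (-(b / (2 * t)) * caloric T t (r, b) + caloric (fun y => y.2 / (2 * t) * T y) t (r, b)) b := by
  have hp : HasDerivAt (fun b => gaussParam t (r, b)) (0, 0, 1 / (2 * t)) b := by
    unfold gaussParam
    exact (hasDerivAt_const b (1 / (4 * t))).prodMk ((hasDerivAt_const b (r / (2 * t))).prodMk
      ((hasDerivAt_id b).div_const (2 * t)))
  have h := (hasDerivAt_heatKernel_snd ht r b).mul
    (hT.hasDerivAt_comp aestronglyMeasurable_gaussExponent isOpen_gaussParams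
      (gaussParam_mem ht (r, b)) hp)
  refine h.congr_deriv ?_
  simp only [caloric, gaussExponent_apply, mul_zero, zero_add, mul_one_div]
  ring

lemma integral_add_sub_sub {A B C D : ℝ × ℝ → ℝ} (hA : Integrable A) (hB : Integrable B)
    (hC : Integrable C) (hD : Integrable D) (a b : ℝ) :
    (∫ y, A y) + (∫ y, B y) - a * (∫ y, C y) - b * (∫ y, D y)
      = ∫ y, (A y + B y - a * C y - b * D y) := by
  have h1 : Integrable fun y => A y + B y := hA.add hB
  have h2 : Integrable fun y => A y + B y - a * C y := h1.sub (hC.const_mul a)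
  rw [integral_sub h2 (hD.const_mul b), integral_sub h1 (hC.const_mul a), integral_add hA hB,
    integral_const_mul, integral_const_mul]

lemma hasDerivAt_caloric_time (hT : ExpIntegrable volume gaussExponent gaussParams T) {t : ℝ}
    (ht : 0 < t) (x : ℝ × ℝ) :
    HasDerivAt (fun τ => caloric T τ x)
      ((-(1 / t) + (x.1 ^ 2 + x.2 ^ 2) / (4 * t ^ 2)) * caloric T t x
        + (caloric (fun y => y.1 / (2 * t) * (y.1 / (2 * t) * T y)) t x
          + caloric (fun y => y.2 / (2 * t) * (y.2 / (2 * t) * T y)) t x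
          - x.1 / t * caloric (fun y => y.1 / (2 * t) * T y) t x
          - x.2 / t * caloric (fun y => y.2 / (2 * t) * T y) t x)) t := by
  have hinv : ∀ a c : ℝ, c ≠ 0 → HasDerivAt (fun τ : ℝ => a / (c * τ)) (-(a / (c * t ^ 2))) t :=
    fun a c hc => by
    have h2 : HasDerivAt (fun τ : ℝ => c * τ) c t := by
      simpa using (hasDerivAt_id t).const_mul c
    refine ((hasDerivAt_const t a).div h2 (by positivity)).congr_deriv ?_
    field_simp
    ring
  have hp : HasDerivAt (fun τ => gaussParam τ x)
      (-(1 / (4 * t ^ 2)), -(x.1 / (2 * t ^ 2)), -(x.2 / (2 * t ^ 2))) t := by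
    unfold gaussParam
    exact (hinv _ _ (by norm_num)).prodMk ((hinv _ _ (by norm_num)).prodMk
      (hinv _ _ (by norm_num)))
  have h := (hasDerivAt_heatKernel_time ht x).mul
    (hT.hasDerivAt_comp aestronglyMeasurable_gaussExponent isOpen_gaussParams
      (gaussParam_mem ht x) hp)
  refine h.congr_deriv ?_
  have i1 := expIntegrable_fst_mul hT (2 * t)
  have i2 := expIntegrable_snd_mul hT (2 * t)
  have hi := fun {T : ℝ × ℝ → ℝ} (hT : ExpIntegrable volume gaussExponent gaussParams T) =>
    hT.integrable aestronglyMeasurable_gaussExponent (gaussParam_mem ht x)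
  simp only [smul_eq_mul] at hi
  unfold caloric
  rw [← mul_assoc (_ + _) (heatKernel t x)]
  congr 1
  have e2 : ∀ H A B X C Y D : ℝ, H * A + H * B - X * (H * C) - Y * (H * D)
      = H * (A + B - X * C - Y * D) := by intros; ring
  rw [e2]
  congr 1
  -- The time derivative of the exponent is |y|²/4t² - x·y/2t², which is exactly this combination of
  -- four weights.
  refine Eq.trans ?_ (integral_add_sub_sub (hi (expIntegrable_fst_mul i1 (2 * t)))
    (hi (expIntegrable_snd_mul i2 (2 * t))) (hi i1) (hi i2) (x.1 / t) (x.2 / t)).symm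
  refine integral_congr_ae (Eventually.of_forall fun y => ?_)
  have hv := gaussExponent_apply y
    (-(1 / (4 * t ^ 2)), -(x.1 / (2 * t ^ 2)), -(x.2 / (2 * t ^ 2)))
  simp only [hv]
  field_simp
  ring

/-- Gaussian integrals solve the heat equation. -/
lemma caloric_heat (hT : ExpIntegrable volume gaussExponent gaussParams T) {t : ℝ} (ht : 0 < t)
    (x : ℝ × ℝ) :
    deriv (fun τ => caloric T τ x) t
      = partial1 (partial1 (caloric T t)) x + partial2 (partial2 (caloric T t)) x := by
  have i1 := expIntegrable_fst_mul hT (2 * t)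
  have i2 := expIntegrable_snd_mul hT (2 * t)
  have p1 : partial1 (caloric T t) = fun x => -(x.1 / (2 * t)) * caloric T t x
      + caloric (fun y => y.1 / (2 * t) * T y) t x := by
    ext x
    exact (hasDerivAt_caloric_fst hT ht x.1 x.2).deriv
  have p2 : partial2 (caloric T t) = fun x => -(x.2 / (2 * t)) * caloric T t x
      + caloric (fun y => y.2 / (2 * t) * T y) t x := by
    ext x
    exact (hasDerivAt_caloric_snd hT ht x.1 x.2).deriv
  rw [p1, p2, (hasDerivAt_caloric_time hT ht x).deriv]
  unfold partial1 partial2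
  have hl : ∀ r : ℝ, HasDerivAt (fun r : ℝ => -(r / (2 * t))) (-(1 / (2 * t))) r := fun r =>
    ((hasDerivAt_id r).div_const (2 * t)).neg
  have d1 := ((hl x.1).mul (hasDerivAt_caloric_fst hT ht x.1 x.2)).add
    (hasDerivAt_caloric_fst i1 ht x.1 x.2)
  have d2 := ((hl x.2).mul (hasDerivAt_caloric_snd hT ht x.1 x.2)).add
    (hasDerivAt_caloric_snd i2 ht x.1 x.2)
  have e1 := d1.deriv
  have e2 := d2.deriv
  simp only [Prod.mk.eta] at e1 e2
  refine Eq.trans ?_ (congrArg₂ (· + ·) e1.symm e2.symm)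
  field_simp
  ring

end

/-! ### T₀ as free heat flow on the whole plane -/

/-- Fubini's theorem for integral operators whose range consists of bounded functions. -/
lemma integral_mul_integral_kernel {α β : Type*} [MeasurableSpace α] [MeasurableSpace β]
    {μ : Measure α} {ν : Measure β} [SFinite μ] [SFinite ν] {a : α → ℝ} (ha : Integrable a μ)
    {k : α → β → ℝ} (hk : Measurable (Function.uncurry k)) {f : β → ℝ}
    (hf : AEStronglyMeasurable f ν) {C : ℝ≥0∞} (hC : C ≠ ∞)
    (h : ∀ x, ∫⁻ y, ‖k x y * f y‖ₑ ∂ν ≤ C) :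
    ∫ x, a x * ∫ y, k x y * f y ∂ν ∂μ = ∫ y, (∫ x, a x * k x y ∂μ) * f y ∂ν := by
  have hm : AEStronglyMeasurable (Function.uncurry fun x y => a x * (k x y * f y)) (μ.prod ν) :=
    ha.1.comp_fst.mul (hk.aestronglyMeasurable.mul hf.comp_snd)
  have hint : Integrable (Function.uncurry fun x y => a x * (k x y * f y)) (μ.prod ν) := by
    refine ⟨hm, ?_⟩
    rw [HasFiniteIntegral, lintegral_prod _ hm.enorm]
    calc ∫⁻ x, ∫⁻ y, ‖a x * (k x y * f y)‖ₑ ∂ν ∂μ ≤ ∫⁻ x, ‖a x‖ₑ * C ∂μ := by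
          refine lintegral_mono fun x => ?_
          simp_rw [enorm_mul (a x)]
          have hmx : AEMeasurable (fun y => ‖k x y * f y‖ₑ) ν :=
            ((hk.comp measurable_prodMk_left).aestronglyMeasurable.mul hf).enorm
          rw [lintegral_const_mul'' _ hmx]
          gcongr
          exact h x
      _ = (∫⁻ x, ‖a x‖ₑ ∂μ) * C := lintegral_mul_const'' _ ha.1.enorm
      _ < ∞ := ENNReal.mul_lt_top ha.2 hC.lt_top
  simp_rw [← integral_const_mul]
  rw [integral_integral_swap hint]
  simp_rw [← mul_assoc, integral_mul_const]

lemma integrable_heatKernel_mul {τ : ℝ} (hτ : 0 < τ) (x : ℝ × ℝ) {g : ℝ × ℝ → ℝ}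
    (hg : AEStronglyMeasurable g volume) {K : ℝ} (hK : ∀ y, |g y| ≤ K) :
    Integrable fun w => heatKernel τ (x - w) * g w :=
  ((integrable_heatKernel hτ).comp_sub_left x).mul_bdd hg (Eventually.of_forall hK)

/-- Both parts of the kernel are functions of x minus a point independent of x, and each satisfies
the semigroup law on the whole plane; no boundary is involved. -/
lemma heatKernel_conv_kernelW0 {t τ : ℝ} (ht : 0 < t) (hτ : 0 < τ) (x y : ℝ × ℝ) :
    ∫ w, heatKernel τ (x - w) * kernelW0 t w y = kernelW0 (t + τ) x y := by
  have hpi := Real.pi_pos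
  have h1 : Integrable fun w => heatKernel τ (x - w) * heatKernel t (w - y) := by
    refine integrable_heatKernel_mul hτ x (K := 16 / Real.pi * t⁻¹)
      ((measurable_heatKernel t).comp (by fun_prop)).aestronglyMeasurable fun w => ?_
    rw [abs_of_nonneg (heatKernel_nonneg ht _)]
    refine (heatKernel_le' ht _).trans ?_
    refine mul_le_mul_of_nonneg_left (inv_anti₀ ht ?_) (by positivity)
    nlinarith [sq_nonneg (w - y).1, sq_nonneg (w - y).2]
  have h2 : Integrable fun w => heatKernel τ (x - w) * reflKernel t (w - reflect y) := by
    refine integrable_heatKernel_mul hτ x (K := 352 / Real.pi * t⁻¹)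
      ((measurable_reflKernel ht).comp (by fun_prop)).aestronglyMeasurable fun w => ?_
    refine (abs_reflKernel_le ht _).trans ?_
    refine mul_le_mul_of_nonneg_left (inv_anti₀ ht ?_) (by positivity)
    nlinarith [sq_nonneg (w - reflect y).1, sq_nonneg (w - reflect y).2]
  simp_rw [kernelW0_eq ht, mul_add]
  rw [integral_add h1 h2, kernelW0_eq (by positivity), ← heatKernel_conv_heatKernel ht hτ,
    ← heatKernel_conv_reflKernel ht hτ,
    ← integral_sub_right_eq_self (fun w => heatKernel τ (x - y - w) * heatKernel t w) y,
    ← integral_sub_right_eq_self (fun w => heatKernel τ (x - reflect y - w) * reflKernel t w)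
      (reflect y)]
  simp only [sub_sub_sub_cancel_right]

section

variable {q : ℝ≥0∞} {ω₀ : ℝ × ℝ → ℝ}

lemma aestronglyMeasurable_T0 (hω₀ : MemLp ω₀ q (volume.restrict halfPlane)) {t : ℝ}
    (ht : 0 < t) : AEStronglyMeasurable (T0 ω₀ t) volume :=
  aestronglyMeasurable_integral_kernel (measurable_kernelW0 ht) hω₀.1

lemma exists_abs_T0_le (hq1 : 1 < q) (hq2 : q < 2)
    (hω₀ : MemLp ω₀ q (volume.restrict halfPlane)) {t : ℝ} (ht : 0 < t) :
    ∃ K : ℝ, ∀ x, |T0 ω₀ t x| ≤ K := by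
  obtain ⟨C, hC, h⟩ := kernelW0_mul_bound hq1 hq2 hω₀ ht
  exact ⟨C.toReal, fun x => abs_setIntegral_le_of_lintegral hC (h x).2⟩

/-- Given by its formula on both sides of the boundary, T₀(t)ω₀ evolves by plain Gaussian
convolution. This yields regularity up to the boundary and the heat equation together. -/
lemma T0_add (hq1 : 1 < q) (hq2 : q < 2) (hω₀ : MemLp ω₀ q (volume.restrict halfPlane))
    {t τ : ℝ} (ht : 0 < t) (hτ : 0 < τ) (x : ℝ × ℝ) :
    T0 ω₀ (t + τ) x = caloric (T0 ω₀ t) τ x := by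
  obtain ⟨C, hC, h⟩ := kernelW0_mul_bound hq1 hq2 hω₀ ht
  rw [← integral_heatKernel_eq_caloric hτ]
  unfold T0
  rw [integral_mul_integral_kernel ((integrable_heatKernel hτ).comp_sub_left x)
    (measurable_kernelW0 ht) hω₀.1 hC fun w => (h w).2]
  simp_rw [heatKernel_conv_kernelW0 ht hτ]

lemma expIntegrable_T0 (hq1 : 1 < q) (hq2 : q < 2)
    (hω₀ : MemLp ω₀ q (volume.restrict halfPlane)) {t : ℝ} (ht : 0 < t) :
    ExpIntegrable volume gaussExponent gaussParams (T0 ω₀ t) := by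
  obtain ⟨K, hK⟩ := exists_abs_T0_le hq1 hq2 hω₀ ht
  exact expIntegrable_of_bounded (aestronglyMeasurable_T0 hω₀ ht) hK

/-- Near a given time the flow is restarted from half that time, where it is bounded. -/
lemma contDiffOn_T0 (hq1 : 1 < q) (hq2 : q < 2) (hω₀ : MemLp ω₀ q (volume.restrict halfPlane))
    (n : ℕ) :
    ContDiffOn ℝ n (fun p : ℝ × (ℝ × ℝ) => T0 ω₀ p.1 p.2) (Ioi (0 : ℝ) ×ˢ univ) := by
  intro p hp
  have hp0 : 0 < p.1 := hp.1
  have h1 := contDiffOn_caloric (expIntegrable_T0 hq1 hq2 hω₀ (half_pos hp0)) n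
  have h2 : ContDiffOn ℝ n (fun p' : ℝ × (ℝ × ℝ) => caloric (T0 ω₀ (p.1 / 2)) (p'.1 - p.1 / 2) p'.2)
      (Ioi (p.1 / 2) ×ˢ univ) :=
    h1.comp (f := fun p' : ℝ × (ℝ × ℝ) => (p'.1 - p.1 / 2, p'.2)) (by fun_prop) fun p' hp' =>
      ⟨mem_Ioi.2 (sub_pos.2 hp'.1), mem_univ _⟩
  have h3 := h2.congr (f₁ := fun p' : ℝ × (ℝ × ℝ) => T0 ω₀ p'.1 p'.2) fun p' hp' => by
    rw [← T0_add hq1 hq2 hω₀ (half_pos hp0) (sub_pos.2 hp'.1), add_sub_cancel]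
  exact (h3.contDiffAt ((isOpen_Ioi.prod isOpen_univ).mem_nhds
    ⟨half_lt_self hp0, mem_univ _⟩)).contDiffWithinAt

lemma T0_heat (hq1 : 1 < q) (hq2 : q < 2) (hω₀ : MemLp ω₀ q (volume.restrict halfPlane)) {t : ℝ}
    (ht : 0 < t) (x : ℝ × ℝ) :
    deriv (fun τ => T0 ω₀ τ x) t
      = partial1 (partial1 (T0 ω₀ t)) x + partial2 (partial2 (T0 ω₀ t)) x := by
  have h0 := half_pos ht
  have h1 : T0 ω₀ t = caloric (T0 ω₀ (t / 2)) (t / 2) := by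
    ext x
    rw [← T0_add hq1 hq2 hω₀ h0 h0, add_halves]
  have h2 : (fun τ => T0 ω₀ τ x) =ᶠ[𝓝 t] fun τ => caloric (T0 ω₀ (t / 2)) (τ - t / 2) x := by
    filter_upwards [Ioi_mem_nhds (half_lt_self ht)] with τ hτ
    rw [← T0_add hq1 hq2 hω₀ h0 (sub_pos.2 hτ), add_sub_cancel]
  rw [h2.deriv_eq, deriv_comp_sub_const (f := fun τ => caloric (T0 ω₀ (t / 2)) τ x), h1, sub_half,
    caloric_heat (expIntegrable_T0 hq1 hq2 hω₀ h0) h0]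

end

/-! ### The nonlocal boundary condition -/

lemma inv_shift_le {t : ℝ} (ht : 0 < t) (a b : ℝ) {s : ℝ} (hs : |s| ≤ 1) :
    (t + (a ^ 2 + (s + b) ^ 2))⁻¹ ≤ (2 + 2 / t) * (t + (a ^ 2 + b ^ 2))⁻¹ := by
  have h1 : s ^ 2 ≤ 1 := (sq_le_one_iff_abs_le_one s).2 hs
  rw [← div_eq_mul_inv, inv_eq_one_div, div_le_div_iff₀ (by positivity) (by positivity)]
  have h2 : (2 + 2 / t) * (t + (a ^ 2 + (s + b) ^ 2))
      = 2 * (t + (a ^ 2 + (s + b) ^ 2)) + 2 + 2 / t * (a ^ 2 + (s + b) ^ 2) := by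
    field_simp
    ring
  have h3 : 0 ≤ 2 / t * (a ^ 2 + (s + b) ^ 2) := by positivity
  rw [h2]
  nlinarith [sq_nonneg (2 * s + b), sq_nonneg a]

lemma abs_mul_heatKernel_le {t : ℝ} (ht : 0 < t) (a b : ℝ) :
    |-(b / (2 * t)) * heatKernel t (a, b)|
      ≤ 8 / Real.pi * (1 + 1 / t) * (t + (a ^ 2 + b ^ 2))⁻¹ := by
  have hpi := Real.pi_pos
  have p : 0 < t + (a ^ 2 + b ^ 2) := by positivity
  set X := (t + (a ^ 2 + b ^ 2))⁻¹ with hX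
  have hX0 : 0 < X := inv_pos.2 p
  have h1 : |b| * X ≤ 1 + 1 / t := by
    rw [hX, ← div_eq_mul_inv, div_le_iff₀ p]
    have h2 : (1 + 1 / t) * (t + (a ^ 2 + b ^ 2))
        = t + 1 + (a ^ 2 + b ^ 2) + (a ^ 2 + b ^ 2) / t := by field_simp; ring
    have h3 : 0 ≤ (a ^ 2 + b ^ 2) / t := by positivity
    rw [h2]
    nlinarith [sq_nonneg (|b| - 1), sq_abs b, sq_nonneg a, abs_nonneg b]
  rw [abs_mul, abs_neg, abs_div, abs_of_pos (by positivity : 0 < 2 * t),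
    abs_of_nonneg (heatKernel_nonneg ht _)]
  calc |b| / (2 * t) * heatKernel t (a, b)
      ≤ |b| / (2 * t) * (16 / Real.pi * t * X ^ 2) := by
        gcongr
        exact heatKernel_le ht (a, b)
    _ = 8 / Real.pi * (|b| * X) * X := by field_simp; ring
    _ ≤ _ := by gcongr

/-- A boundary point is equidistant from y and y*, so the first two Gauss kernels cancel and twice
the nonlocal part remains. -/
lemma kernelW0_boundary {t : ℝ} (ht : 0 < t) (r : ℝ) (y : ℝ × ℝ) :
    kernelW0 t (r, 0) y = 2 * poissonExt t 0 (r - y.1, y.2) := by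
  rw [kernelW0_eq ht, poissonExt_zero ht, reflKernel]
  have h1 : ((r, 0) : ℝ × ℝ) - reflect y = (r - y.1, y.2) := by simp [reflect]
  have h2 : heatKernel t ((r, 0) - y) = heatKernel t (r - y.1, y.2) := by
    simp [heatKernel]
  rw [h1, h2]
  ring

lemma abs_poissonExt_zero_le {t : ℝ} (ht : 0 < t) (z : ℝ × ℝ) :
    |poissonExt t 0 z| ≤ 184 / Real.pi * (t + (z.1 ^ 2 + z.2 ^ 2))⁻¹ := by
  have h1 := heatKernel_le' ht z
  have h2 := abs_reflKernel_le ht z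
  have h3 := heatKernel_nonneg ht z
  have h4 : poissonExt t 0 z = (heatKernel t z + reflKernel t z) / 2 := by
    rw [poissonExt_zero ht, reflKernel]; ring
  have h5 : 184 / Real.pi * (t + (z.1 ^ 2 + z.2 ^ 2))⁻¹
      = (16 / Real.pi * (t + (z.1 ^ 2 + z.2 ^ 2))⁻¹
        + 352 / Real.pi * (t + (z.1 ^ 2 + z.2 ^ 2))⁻¹) / 2 := by ring
  rw [h4, h5]
  rw [abs_le] at h2 ⊢
  constructor <;> linarith [h2.1, h2.2]

lemma measurable_poissonExt {t : ℝ} (ht : 0 < t) (s : ℝ) : Measurable (poissonExt t s) := by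
  have hc := continuous_lapMom 0 ht
  have h : Continuous fun z : ℝ × ℝ =>
    1 / Real.pi * (lapMom 0 t (s + z.1 * Complex.I)).re * gauss t z.2 := by fun_prop
  exact h.measurable.sub (measurable_lapConv (continuous_gauss t) ht s)

lemma measurable_boundary {F : ℝ × ℝ → ℝ} (hF : Measurable F) :
    Measurable (Function.uncurry fun (r : ℝ) (y : ℝ × ℝ) => F (r - y.1, y.2)) :=
  hF.comp (f := fun z : ℝ × (ℝ × ℝ) => ((z.1 - z.2.1, z.2.2) : ℝ × ℝ)) (by fun_prop)

section

variable {q : ℝ≥0∞} {ω₀ : ℝ × ℝ → ℝ}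

/-- The normal derivative at the boundary. -/
lemma hasDerivAt_T0_boundary (hq1 : 1 < q) (hq2 : q < 2)
    (hω₀ : MemLp ω₀ q (volume.restrict halfPlane)) {t : ℝ} (ht : 0 < t) (r : ℝ) :
    HasDerivAt (fun s => T0 ω₀ t (r, s))
      (∫ y in halfPlane, -2 * lapConv (gaussDeriv t) t 0 (r - y.1, y.2) * ω₀ y) 0 := by
  obtain ⟨C, hC, hCle⟩ := exists_lintegral_bracket_le hq1 hq2 hω₀
  obtain ⟨c, hc0, hc⟩ := gaussDeriv_mul_le ht
  have hpi := Real.pi_pos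
  set K' : ℝ → ℝ × ℝ → ℝ := fun σ y =>
    -((σ - y.2) / (2 * t)) * heatKernel t (r - y.1, σ - y.2) +
      (-((σ + y.2) / (2 * t)) * heatKernel t (r - y.1, σ + y.2) -
        2 * lapConv (gaussDeriv t) t 0 (r - y.1, σ + y.2)) with hK'
  -- At height 0 the normal derivatives of the Gauss kernels centred at y and at y* are opposite, so
  -- only `lapConv` contributes.
  have hK'0 : ∀ y, K' 0 y = -2 * lapConv (gaussDeriv t) t 0 (r - y.1, y.2) := fun y => by
    have h : heatKernel t (r - y.1, 0 - y.2) = heatKernel t (r - y.1, y.2) := by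
      simp [heatKernel]
    simp only [hK', h, zero_add]
    ring
  set A := 8 / Real.pi * (1 + 1 / t) with hA
  set B := 14 * c / (Real.pi * t) with hB
  set M := (2 * A + 2 * B) * (2 + 2 / t) * ((√t)⁻¹ * √(1 + 1 / t)) with hM
  have hbint : IntegrableOn (fun y => (M * bracket ((r, 0) - y)) * ω₀ y) halfPlane := by
    refine (integrable_of_le_bracket hω₀.1 hC (hCle (r, 0)) (M := M) ?_ ?_).1
    · exact (measurable_bracket.comp (by fun_prop)).const_mul _
    · refine Eventually.of_forall fun y => ?_
      rw [abs_of_nonneg (mul_nonneg (by positivity) (bracket_nonneg _))]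
  obtain ⟨C₁, hC₁, h₁⟩ := kernelW0_mul_bound hq1 hq2 hω₀ ht
  have hwint : ∀ σ, IntegrableOn (fun y => kernelW0 t (r, σ) y * ω₀ y) halfPlane :=
    fun σ => (h₁ (r, σ)).1
  have hmeas : Measurable fun y : ℝ × ℝ => -2 * lapConv (gaussDeriv t) t 0 (r - y.1, y.2) :=
    ((measurable_boundary (measurable_lapConv (continuous_gaussDeriv t) ht 0)).comp
      measurable_prodMk_left).const_mul (-2)
  have hder := hasDerivAt_integral_of_dominated_loc_of_deriv_le (μ := volume.restrict halfPlane)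
    (F := fun σ y => kernelW0 t (r, σ) y * ω₀ y) (x₀ := 0)
    (F' := fun σ y => K' σ y * ω₀ y)
    (s := Metric.ball 0 1) (Metric.ball_mem_nhds _ one_pos)
    (bound := fun y => ‖(M * bracket ((r, 0) - y)) * ω₀ y‖)
    (Eventually.of_forall fun σ => (hwint σ).1) (hwint 0) ?_ ?_ hbint.norm ?_
  · have h := hder.2
    simp only [hK'0] at h
    exact h
  · simp only [hK'0]
    exact hmeas.aestronglyMeasurable.mul hω₀.1
  · refine Eventually.of_forall fun y σ hσ => ?_
    have hσ' : |σ| ≤ 1 := by simpa using (Metric.mem_ball.1 hσ).le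
    rw [norm_mul _ (ω₀ y), norm_mul _ (ω₀ y)]
    refine mul_le_mul_of_nonneg_right ?_ (norm_nonneg _)
    rw [Real.norm_of_nonneg (mul_nonneg (by positivity) (bracket_nonneg _)), Real.norm_eq_abs]
    set X := (t + ((r - y.1) ^ 2 + y.2 ^ 2))⁻¹ with hX
    have x1 : (t + ((r - y.1) ^ 2 + (σ - y.2) ^ 2))⁻¹ ≤ (2 + 2 / t) * X := by
      have := inv_shift_le ht (r - y.1) (-y.2) hσ'
      rwa [neg_sq, ← sub_eq_add_neg] at this
    have x2 : (t + ((r - y.1) ^ 2 + (σ + y.2) ^ 2))⁻¹ ≤ (2 + 2 / t) * X :=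
      inv_shift_le ht (r - y.1) y.2 hσ'
    have b1 := (abs_mul_heatKernel_le ht (r - y.1) (σ - y.2)).trans
      (mul_le_mul_of_nonneg_left x1 (by positivity))
    have b2 := (abs_mul_heatKernel_le ht (r - y.1) (σ + y.2)).trans
      (mul_le_mul_of_nonneg_left x2 (by positivity))
    have b3 := (abs_lapConv_le ht hc le_rfl (r - y.1, σ + y.2)).trans
      (mul_le_mul_of_nonneg_left x2 (by positivity))
    have hXb : X ≤ (√t)⁻¹ * √(1 + 1 / t) * bracket ((r, 0) - y) := by
      have := inv_le_bracket ht ((r, 0) - y)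
      simpa [hX] using this
    calc |K' σ y| ≤ (2 * A + 2 * B) * (2 + 2 / t) * X := by
          rw [← hA] at b1 b2
          rw [← hB] at b3
          rw [abs_le] at b1 b2 b3 ⊢
          simp only [hK']
          constructor <;> linarith [b1.1, b1.2, b2.1, b2.2, b3.1, b3.2]
      _ ≤ (2 * A + 2 * B) * (2 + 2 / t) * ((√t)⁻¹ * √(1 + 1 / t) * bracket ((r, 0) - y)) := by
          gcongr
      _ = _ := by rw [hM]; ring
  · refine Eventually.of_forall fun y σ _ => ?_
    have d1 := (hasDerivAt_heatKernel_snd ht (r - y.1) (σ - y.2)).comp_sub_const σ y.2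
    have d2 := (hasDerivAt_heatKernel_snd ht (r - y.1) (σ + y.2)).comp_add_const σ y.2
    have d3 := (hasDerivAt_lapConv_snd ht 0 (r - y.1) (σ + y.2)).comp_add_const σ y.2
    refine ((d1.add (d2.sub (d3.const_mul 2))).congr_of_eventuallyEq
      (Eventually.of_forall fun σ => ?_)).mul_const (ω₀ y)
    simp [kernelW0_eq ht, reflKernel, reflect, Prod.sub_def]

lemma T0_boundary {t : ℝ} (ht : 0 < t) (r : ℝ) :
    T0 ω₀ t (r, 0) = ∫ y in halfPlane, 2 * poissonExt t 0 (r - y.1, y.2) * ω₀ y := by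
  unfold T0
  simp_rw [kernelW0_boundary ht]

/-- The Poisson semigroup passes under the integral in y and acts on the translated kernel, where
its effect is known in closed form. -/
lemma poissonSemigroup_T0 (hq1 : 1 < q) (hq2 : q < 2)
    (hω₀ : MemLp ω₀ q (volume.restrict halfPlane)) {t : ℝ} (ht : 0 < t) {s : ℝ} (hs : 0 < s)
    (r : ℝ) :
    poissonSemigroup s (fun r => T0 ω₀ t (r, 0)) r
      = ∫ y in halfPlane, 2 * poissonExt t s (r - y.1, y.2) * ω₀ y := by
  obtain ⟨C, hC, h⟩ := kernelW0_mul_bound hq1 hq2 hω₀ ht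
  have hm : Measurable (Function.uncurry fun (x : ℝ) (y : ℝ × ℝ) =>
      2 * poissonExt t 0 (x - y.1, y.2)) :=
    (measurable_boundary (measurable_poissonExt ht 0)).const_mul 2
  have hb : ∀ x : ℝ, ∫⁻ y in halfPlane, ‖2 * poissonExt t 0 (x - y.1, y.2) * ω₀ y‖ₑ ≤ C :=
    fun x => by
      simp_rw [← kernelW0_boundary ht]
      exact (h (x, 0)).2
  have hconv : ∀ y : ℝ × ℝ, ∫ x, linePoissonKernel s (r - x) * (2 * poissonExt t 0 (x - y.1, y.2))
      = 2 * poissonExt t s (r - y.1, y.2) := fun y => by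
    rw [← poisson_conv_poissonExt ht hs, ← integral_const_mul]
    have e := integral_sub_right_eq_self
      (fun x => 2 * (linePoissonKernel s (r - y.1 - x) * poissonExt t 0 (x, y.2))) (μ := volume) y.1
    rw [← e]
    refine integral_congr_ae (Eventually.of_forall fun x => ?_)
    simp only [sub_sub_sub_cancel_right]
    ring
  unfold poissonSemigroup
  simp_rw [T0_boundary ht]
  have hF := integral_mul_integral_kernel ((integrable_linePoissonKernel hs).comp_sub_left r)
    hm hω₀.1 hC hb
  rw [hF]
  simp_rw [hconv]

/-- The mean value inequality, with the bound on the s-derivative that is uniform in s ≥ 0. -/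
lemma abs_poissonExt_sub_le {t c : ℝ} (ht : 0 < t)
    (hc : ∀ u : ℝ, |gaussDeriv t u| * (t + u ^ 2) ≤ c * gauss (2 * t) u) {s : ℝ} (hs : 0 ≤ s)
    (z : ℝ × ℝ) :
    |poissonExt t s z - poissonExt t 0 z|
      ≤ 14 * c / (Real.pi * t) * (t + (z.1 ^ 2 + z.2 ^ 2))⁻¹ * s := by
  have h := norm_image_sub_le_of_norm_deriv_le_segment' (a := 0) (b := s)
    (f := fun s => poissonExt t s z) (f' := fun s => -lapConv (gaussDeriv t) t s z)
    (C := 14 * c / (Real.pi * t) * (t + (z.1 ^ 2 + z.2 ^ 2))⁻¹)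
    (fun σ _ => (hasDerivAt_poissonExt ht σ z).hasDerivWithinAt)
    (fun σ hσ => by
      rw [norm_neg, Real.norm_eq_abs]
      exact abs_lapConv_le ht hc hσ.1 z) s (right_mem_Icc.2 hs)
  simpa using h

/-- The boundary condition. -/
lemma isPoissonGenerator_T0 (hq1 : 1 < q) (hq2 : q < 2)
    (hω₀ : MemLp ω₀ q (volume.restrict halfPlane)) {t : ℝ} (ht : 0 < t) :
    IsPoissonGenerator q (fun r => T0 ω₀ t (r, 0))
      (fun r => derivWithin (fun s => T0 ω₀ t (r, s)) (Ici 0) 0) := by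
  have hqt : q ≠ ∞ := (hq2.trans (by norm_num)).ne
  have hq0 : q ≠ 0 := (zero_lt_one.trans hq1).ne'
  have hpi := Real.pi_pos
  obtain ⟨c, hc0, hc⟩ := gaussDeriv_mul_le ht
  have hh : (fun r => derivWithin (fun s => T0 ω₀ t (r, s)) (Ici 0) 0)
      = fun r => ∫ y in halfPlane, -2 * lapConv (gaussDeriv t) t 0 (r - y.1, y.2) * ω₀ y := by
    ext r
    exact (hasDerivAt_T0_boundary hq1 hq2 hω₀ ht r).hasDerivWithinAt.derivWithin
      (uniqueDiffOn_Ici 0 0 self_mem_Ici)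
  have hlm : Measurable (Function.uncurry fun (r : ℝ) (y : ℝ × ℝ) =>
      -2 * lapConv (gaussDeriv t) t 0 (r - y.1, y.2)) :=
    (measurable_boundary (measurable_lapConv (continuous_gaussDeriv t) ht 0)).const_mul (-2)
  have hpm : ∀ s, Measurable (Function.uncurry fun (r : ℝ) (y : ℝ × ℝ) =>
      2 * poissonExt t s (r - y.1, y.2)) := fun s =>
    (measurable_boundary (measurable_poissonExt ht s)).const_mul 2
  set B := 14 * c / (Real.pi * t) with hB
  -- One majorant serves the difference quotients, their limit and the normal derivative.
  have hD := dominatedKernel_boundary hq1 hq2 ht (2 * B) (by positivity) hω₀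
  have hlb : ∀ (r : ℝ) (y : ℝ × ℝ), |-2 * lapConv (gaussDeriv t) t 0 (r - y.1, y.2)|
      ≤ 2 * B * (t + ((r - y.1) ^ 2 + y.2 ^ 2))⁻¹ := fun r y => by
    rw [abs_mul, abs_neg, abs_two, mul_assoc]
    gcongr
    exact abs_lapConv_le ht hc le_rfl (r - y.1, y.2)
  refine ⟨?_, ?_, ?_⟩
  · simp_rw [T0_boundary ht]
    refine (dominatedKernel_boundary hq1 hq2 ht (2 * (184 / Real.pi)) (by positivity) hω₀).memLp
      hq0 hqt (hpm 0) hω₀.1 (Eventually.of_forall fun r => Eventually.of_forall fun y => ?_)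
    rw [abs_mul, abs_two, mul_assoc]
    gcongr
    exact abs_poissonExt_zero_le ht (r - y.1, y.2)
  · rw [hh]
    exact hD.memLp hq0 hqt hlm hω₀.1
      (Eventually.of_forall fun r => Eventually.of_forall fun y => hlb r y)
  · have hquot : ∀ (s : ℝ) (r : ℝ) (y : ℝ × ℝ), 0 < s →
        |s⁻¹ * (2 * poissonExt t s (r - y.1, y.2) - 2 * poissonExt t 0 (r - y.1, y.2))|
          ≤ 2 * B * (t + ((r - y.1) ^ 2 + y.2 ^ 2))⁻¹ := fun s r y hs => by
      rw [← mul_sub, abs_mul, abs_mul, abs_two, abs_inv, abs_of_pos hs, inv_mul_le_iff₀ hs]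
      have := abs_poissonExt_sub_le ht hc hs.le (r - y.1, y.2)
      rw [← hB] at this
      simp only at this
      linarith
    have hqm : ∀ s : ℝ, Measurable (Function.uncurry fun (r : ℝ) (y : ℝ × ℝ) =>
        s⁻¹ * (2 * poissonExt t s (r - y.1, y.2) - 2 * poissonExt t 0 (r - y.1, y.2))) := fun s => by
      have h1 := hpm s
      have h2 := hpm 0
      simp only [Function.uncurry_def] at h1 h2 ⊢
      exact (h1.sub h2).const_mul _
    have hqb : ∀ᶠ s : ℝ in 𝓝[>] 0, ∀ r ∈ (univ : Set ℝ), ∀ᵐ y ∂(volume.restrict halfPlane),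
        |s⁻¹ * (2 * poissonExt t s (r - y.1, y.2) - 2 * poissonExt t 0 (r - y.1, y.2))|
          ≤ 2 * B * (t + ((r - y.1) ^ 2 + y.2 ^ 2))⁻¹ := by
      filter_upwards [self_mem_nhdsWithin] with s hs r _
      exact Eventually.of_forall fun y => hquot s r y hs
    -- The quotients converge to the kernel of the normal derivative found in
    -- `hasDerivAt_T0_boundary`, which identifies A applied to the trace.
    have hql : ∀ (r : ℝ) (y : ℝ × ℝ), Tendsto (fun s => s⁻¹ *
        (2 * poissonExt t s (r - y.1, y.2) - 2 * poissonExt t 0 (r - y.1, y.2))) (𝓝[>] 0)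
        (𝓝 (-2 * lapConv (gaussDeriv t) t 0 (r - y.1, y.2))) := fun r y => by
      have h := ((hasDerivAt_poissonExt ht 0 (r - y.1, y.2)).const_mul 2).tendsto_slope_zero_right
      simp only [zero_add, smul_eq_mul, mul_neg] at h
      rw [neg_mul]
      exact h
    have hqm' : ∀ᶠ s : ℝ in 𝓝[>] 0, Measurable (Function.uncurry fun (r : ℝ) (y : ℝ × ℝ) =>
        s⁻¹ * (2 * poissonExt t s (r - y.1, y.2) - 2 * poissonExt t 0 (r - y.1, y.2))) :=
      Eventually.of_forall fun s => hqm s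
    have hKm : Measurable (Function.uncurry fun (r : ℝ) (y : ℝ × ℝ) =>
        2 * B * (t + ((r - y.1) ^ 2 + y.2 ^ 2))⁻¹) := by
      simp only [Function.uncurry_def]
      fun_prop
    have hlim := hD.tendsto hq0 hqt (l := 𝓝[>] (0 : ℝ))
      (k := fun (s r : ℝ) (y : ℝ × ℝ) => s⁻¹ * (2 * poissonExt t s (r - y.1, y.2)
        - 2 * poissonExt t 0 (r - y.1, y.2)))
      (k₀ := fun (r : ℝ) (y : ℝ × ℝ) => -2 * lapConv (gaussDeriv t) t 0 (r - y.1, y.2))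
      hKm hqm' hlm hω₀.1 (S := univ) (by simp)
      hqb
      (fun r _ => Eventually.of_forall fun y => hlb r y)
      (fun r _ => Eventually.of_forall fun y => hql r y)
    refine hlim.congr' ?_
    filter_upwards [self_mem_nhdsWithin] with s hs
    have hs' : (0 : ℝ) < s := hs
    congr 1
    ext r
    have hint0 : IntegrableOn (fun y => 2 * poissonExt t 0 (r - y.1, y.2) * ω₀ y) halfPlane := by
      obtain ⟨C, hC, h⟩ := kernelW0_mul_bound hq1 hq2 hω₀ ht
      simpa only [kernelW0_boundary ht] using (h (r, 0)).1
    have hintq : IntegrableOn (fun y => s⁻¹ * (2 * poissonExt t s (r - y.1, y.2)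
        - 2 * poissonExt t 0 (r - y.1, y.2)) * ω₀ y) halfPlane := by
      obtain ⟨C, hC, hCle⟩ := exists_lintegral_bracket_le hq1 hq2 hω₀
      refine (integrable_of_le_bracket hω₀.1 hC (hCle (r, 0))
        (M := 2 * B * ((√t)⁻¹ * √(1 + 1 / t)))
        ((hqm s).comp measurable_prodMk_left)
        (Eventually.of_forall fun y => ?_)).1
      refine (hquot s r y hs').trans ?_
      rw [mul_assoc (2 * B)]
      gcongr
      have := inv_le_bracket ht ((r, 0) - y)
      simpa using this
    rw [congrFun hh r, poissonSemigroup_T0 hq1 hq2 hω₀ ht hs', T0_boundary ht]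
    congr 1
    -- Integrability at height s is recovered from that of the quotient and of the kernel at height
    -- 0.
    have hints : IntegrableOn (fun y => 2 * poissonExt t s (r - y.1, y.2) * ω₀ y) halfPlane := by
      refine ((hintq.const_mul s).add hint0).congr (Eventually.of_forall fun y => ?_)
      simp only [Pi.add_apply]
      field_simp
      ring
    rw [← integral_sub hints hint0, ← integral_const_mul]
    refine integral_congr_ae (Eventually.of_forall fun y => ?_)
    simp only
    ring

end

end HalfPlaneVorticity

end

theorem theoremA1 (q : ℝ≥0∞) (hq1 : 1 < q) (hq2 : q < 2)
    (ω₀ : ℝ × ℝ → ℝ)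
    (hω₀ : MemLp ω₀ q (volume.restrict HalfPlaneVorticity.halfPlane))
    (htrace : ∀ᵐ x₁ : ℝ, (HalfPlaneVorticity.biotSavart ω₀ (x₁, 0)).1 = 0) :
    -- the Hilbert transform in the kernel `W₀` exists
    (∀ t : ℝ, 0 < t → ∀ z : ℝ × ℝ, ∃ v : ℝ,
      HalfPlaneVorticity.HasHilbertAt
        (fun r : ℝ => HalfPlaneVorticity.partial1 (HalfPlaneVorticity.gradConv t) (r, z.2))
        z.1 v) ∧
    -- the integral in `T₀(t) ω₀` converges absolutely at every point, and its value is in `L^q`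
    (∀ t : ℝ, 0 < t → ∀ x ∈ HalfPlaneVorticity.closedHalfPlane,
      IntegrableOn (fun y => HalfPlaneVorticity.kernelW0 t x y * ω₀ y)
        HalfPlaneVorticity.halfPlane) ∧
    (∀ t : ℝ, 0 < t →
      MemLp (HalfPlaneVorticity.T0 ω₀ t) q (volume.restrict HalfPlaneVorticity.halfPlane)) ∧
    -- the heat equation with the nonlocal boundary condition
    HalfPlaneVorticity.IsNonlocalHeatSolution q (HalfPlaneVorticity.T0 ω₀) ∧
    -- the initial condition
    Tendsto (fun t : ℝ =>
        eLpNorm (fun x => HalfPlaneVorticity.T0 ω₀ t x - ω₀ x) q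
          (volume.restrict HalfPlaneVorticity.halfPlane))
      (𝓝[>] 0) (𝓝 0) := by
  refine ⟨fun t ht z => ⟨_, HalfPlaneVorticity.hasHilbertAt_partial1_gradConv ht z⟩,
    fun t ht x _ => ?_, fun t ht => HalfPlaneVorticity.memLp_T0 hq1 hq2 hω₀ ht,
    ⟨?_, fun t ht x _ => HalfPlaneVorticity.T0_heat hq1 hq2 hω₀ ht x,
      fun t ht => HalfPlaneVorticity.isPoissonGenerator_T0 hq1 hq2 hω₀ ht⟩,
    HalfPlaneVorticity.tendsto_T0 hq1 hq2 hω₀ htrace⟩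
  · obtain ⟨C, hC, h⟩ := HalfPlaneVorticity.kernelW0_mul_bound hq1 hq2 hω₀ ht
    exact (h x).1
  · exact (HalfPlaneVorticity.contDiffOn_T0 hq1 hq2 hω₀ 2).mono
      (prod_mono_right (subset_univ _))
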